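/- Conventions. A 3-manifold is a smooth, Hausdorff, second countable 3-manifold, possibly with boundary, not necessarily compact or connected. Let $R$ be a commutative ring with $1$, $k\ge 0$ and $r_0,\dots,r_{k-1}\in R$. For an oriented 3-manifold $M$ let $\mathcal L(M)$ be the set of ambient isotopy classes of oriented links (closed oriented 1-dimensional smooth submanifolds with finitely many components) in the interior of $M$. The $k$th skein module $\mathcal S_k(M;R)(r_0,\dots,r_{k-1})$, written $\mathcal S(M)$ for short, is the quotient of the free $R$-module on $\mathcal L(M)$ by the submodule generated by all expressions $r_0L_0+r_1L_1+\dots+r_{k-1}L_{k-1}$, where $L_0,\dots,L_{k-1}$ are links that are identical outside a ball, oriented as $M$, in which $L_i$ consists of two parallel strands, oriented in the same direction, with $i-1$ positive half twists (so that $L_0,L_1,L_2$ are the usual $L_-$, $L_0$, $L_+$). An embedding of oriented 3-manifolds is an orientation preserving smooth embedding. In (a)--(d) the empty link may either be counted as a link or not (throughout); in (e) it is counted as a link. Proposition 4. (a) If $f:M\to N$ is an embedding of oriented 3-manifolds, then $f$ induces a homomorphism $f_*:\mathcal S(M)\to\mathcal S(N)$, that is, there is exactly one $R$-linear map $f_*$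 with $f_*[L]=[f(L)]$ for every oriented link $L$ in $M$. (b) If $f,g:M\to N$ are isotopic embeddings, then $f_*=g_*$. (c) If the oriented 3-manifold $N$ is obtained from the oriented 3-manifold $M$ by adding a 2-handle along a simple closed curve in $\partial M$ and $f:M\to N$ is the natural embedding, orientation preserving, then $f_*:\mathcal S(M)\to\mathcal S(N)$ is an epimorphism. (d) If the oriented 3-manifold $\widehat M$ is obtained from the oriented 3-manifold $M$ by capping off some 2-spheres in $\partial M$ by 3-cells and $f:M\to\widehat M$ is the natural embedding, orientation preserving, then $f_*:\mathcal S(M)\to\mathcal S(\widehat M)$ is an isomorphism. (e) For the disjoint sum $M\sqcup N$ of oriented 3-manifolds there is an isomorphism of $R$-modules $\mathcal S(M)\otimes_R\mathcal S(N)\cong\mathcal S(M\sqcup N)$ that sends $[L]\otimes[L']$ to $[L\sqcup L']$ for all oriented links $L$ in $M$ and $L'$ in $N$. -/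

import Mathlib

open scoped Manifold ContDiff TensorProduct Topology

noncomputable section

namespace Skein

/-- Euclidean three-space. -/
abbrev E3 : Type := EuclideanSpace ℝ (Fin 3)

/-- The linear map `A` is an isomorphism that carries the orientation `o` to `o'`. -/
def CarriesOrientation {V W : Type*} [AddCommGroup V] [Module ℝ V] [AddCommGroup W] [Module ℝ W]
    (A : V →ₗ[ℝ] W) (o : Orientation ℝ V (Fin 3)) (o' : Orientation ℝ W (Fin 3)) : Prop :=
  ∃ e : V ≃ₗ[ℝ] W, (e : V →ₗ[ℝ] W) = A ∧ Orientation.map (Fin 3) e o = o'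

/-- An oriented smooth 3-manifold, possibly with boundary: Hausdorff, second countable, not
necessarily compact or connected. The orientation is a choice of orientation of every tangent
space which is locally constant when it is read in a chart. -/
structure OrientedThreeManifold where
  carrier : Type*
  [topology : TopologicalSpace carrier]
  [charts : ChartedSpace (EuclideanHalfSpace 3) carrier]
  [smooth : IsManifold (𝓡∂ 3) ∞ carrier]
  [hausdorff : T2Space carrier]
  [countable : SecondCountableTopology carrier]
  orient : ∀ x : carrier, Orientation ℝ (TangentSpace (𝓡∂ 3) x) (Fin 3)
  orient_locally_constant : ∀ x₀ : carrier, ∃ o : Orientation ℝ E3 (Fin 3), ∀ᶠ x in 𝓝 x₀,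
    CarriesOrientation
      (mfderiv (𝓡∂ 3) 𝓘(ℝ, E3) (extChartAt (𝓡∂ 3) x₀) x).toLinearMap (orient x) o

instance : CoeSort OrientedThreeManifold (Type _) := ⟨OrientedThreeManifold.carrier⟩

attribute [instance] OrientedThreeManifold.topology OrientedThreeManifold.charts
  OrientedThreeManifold.smooth OrientedThreeManifold.hausdorff OrientedThreeManifold.countable

/-- The standard orientation of `ℝ³`. -/
def stdOrientation : Orientation ℝ E3 (Fin 3) :=
  (EuclideanSpace.basisFun (Fin 3) ℝ).toBasis.orientation

/-! ### Embeddings -/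

/-- Smooth embeddings of 3-manifolds (no condition relates the two boundaries). -/
structure IsSmoothEmb {M N : OrientedThreeManifold} (f : M → N) : Prop where
  contMDiff : ContMDiff (𝓡∂ 3) (𝓡∂ 3) ∞ f
  isEmbedding : Topology.IsEmbedding f
  immersion : ∀ x, Function.Injective (mfderiv (𝓡∂ 3) (𝓡∂ 3) f x)

/-- Orientation preserving smooth embeddings of oriented 3-manifolds. -/
structure OrientedEmbedding (M N : OrientedThreeManifold) where
  toFun : M → N
  isSmoothEmb : IsSmoothEmb toFun
  orientation_preserving : ∀ x, CarriesOrientation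
    (mfderiv (𝓡∂ 3) (𝓡∂ 3) toFun x).toLinearMap (M.orient x) (N.orient (toFun x))

/-- `f` and `g` are isotopic through smooth embeddings `F t`, `0 ≤ t ≤ 1`. -/
def IsotopicEmbeddings {M N : OrientedThreeManifold} (f g : M → N) : Prop :=
  ∃ F : ℝ → M → N,
    ContMDiff (𝓘(ℝ, ℝ).prod (𝓡∂ 3)) (𝓡∂ 3) ∞ (fun p : ℝ × M => F p.1 p.2) ∧
    (∀ t ∈ Set.Icc (0 : ℝ) 1, IsSmoothEmb (F t)) ∧ F 0 = f ∧ F 1 = g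

/-! ### Oriented links and ambient isotopy -/

/-- A parametrization of an oriented link with `n` components in the interior of `M`: a smooth
embedding of `n` disjoint copies of the circle `ℝ / ℤ`. -/
structure IsLinkParam {M : OrientedThreeManifold} {n : ℕ} (γ : Fin n → ℝ → M) : Prop where
  contMDiff : ∀ i, ContMDiff 𝓘(ℝ, ℝ) (𝓡∂ 3) ∞ (γ i)
  periodic : ∀ i, Function.Periodic (γ i) 1
  injective : ∀ i j s t, γ i s = γ j t → i = j ∧ ∃ m : ℤ, s = t + m
  regular : ∀ i t, Function.Injective (mfderiv 𝓘(ℝ, ℝ) (𝓡∂ 3) (γ i) t)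
  interior : ∀ i t, γ i t ∈ (𝓡∂ 3).interior (M : Type _)

/-- An oriented link in the interior of `M`, as an unparametrized object. It is recorded by the set
of all its positively directed tangent vectors: the base points form the underlying compact
1-manifold and the vectors give its orientation. The link may be empty. -/
@[ext]
structure OrientedLink (M : OrientedThreeManifold) where
  carrier : Set (TangentBundle (𝓡∂ 3) M)
  exists_param : ∃ (n : ℕ) (γ : Fin n → ℝ → M), IsLinkParam γ ∧
    carrier = {p | ∃ (i : Fin n) (t c : ℝ), 0 < c ∧
      p = tangentMap 𝓘(ℝ, ℝ) (𝓡∂ 3) (γ i) ⟨t, c⟩}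

/-- A smooth ambient isotopy of `M` (a smooth family of diffeomorphisms that starts at the
identity) carries `L` to `L'`. -/
def AmbientIsotopic {M : OrientedThreeManifold} (L L' : OrientedLink M) : Prop :=
  ∃ Φ : ℝ → Diffeomorph (𝓡∂ 3) (𝓡∂ 3) M M ∞,
    ContMDiff (𝓘(ℝ, ℝ).prod (𝓡∂ 3)) (𝓡∂ 3) ∞ (fun p : ℝ × M => Φ p.1 p.2) ∧
    (∀ x, Φ 0 x = x) ∧
    L'.carrier = tangentMap (𝓡∂ 3) (𝓡∂ 3) (Φ 1) '' L.carrier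

theorem AmbientIsotopic.refl {M : OrientedThreeManifold} (L : OrientedLink M) :
    AmbientIsotopic L L := by
  refine ⟨fun _ => Diffeomorph.refl _ _ _, contMDiff_snd, fun _ => rfl, ?_⟩
  have : (⇑(Diffeomorph.refl (𝓡∂ 3) M ∞)) = id := rfl
  rw [this, tangentMap_id, Set.image_id]

theorem AmbientIsotopic.symm {M : OrientedThreeManifold} {L L' : OrientedLink M}
    (h : AmbientIsotopic L L') : AmbientIsotopic L' L := by
  obtain ⟨Φ, hs, h0, hL⟩ := h
  refine ⟨fun t => (Φ 1).symm.trans (Φ (1 - t)), ?_, ?_, ?_⟩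
  · have h1 : ContMDiff (𝓘(ℝ, ℝ).prod (𝓡∂ 3)) 𝓘(ℝ, ℝ) ∞ (fun p : ℝ × M => 1 - p.1) :=
      ContMDiff.comp (g := fun t : ℝ => 1 - t) (I' := 𝓘(ℝ, ℝ))
        (contMDiff_iff_contDiff.2 (contDiff_const.sub contDiff_id)) contMDiff_fst
    have h2 : ContMDiff (𝓘(ℝ, ℝ).prod (𝓡∂ 3)) (𝓡∂ 3) ∞
        (fun p : ℝ × M => (Φ 1).symm p.2) :=
      (Φ 1).symm.contMDiff.comp contMDiff_snd
    exact hs.comp (h1.prodMk h2)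
  · intro x
    simp
  · have e : (⇑((Φ 1).symm.trans (Φ (1 - 1)))) = ⇑(Φ 1).symm := by
      funext x
      simp [h0]
    have hd : MDifferentiable (𝓡∂ 3) (𝓡∂ 3) (Φ 1) := (Φ 1).contMDiff.mdifferentiable (by simp)
    have hd' : MDifferentiable (𝓡∂ 3) (𝓡∂ 3) (Φ 1).symm :=
      (Φ 1).symm.contMDiff.mdifferentiable (by simp)
    have hid : (⇑(Φ 1).symm ∘ ⇑(Φ 1)) = id := by
      funext x
      simp
    rw [e, hL, ← Set.image_comp, ← tangentMap_comp hd' hd, hid, tangentMap_id, Set.image_id]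

theorem AmbientIsotopic.trans {M : OrientedThreeManifold} {L L' L'' : OrientedLink M}
    (h : AmbientIsotopic L L') (h' : AmbientIsotopic L' L'') : AmbientIsotopic L L'' := by
  obtain ⟨Φ, hs, h0, hL⟩ := h
  obtain ⟨Ψ, hs', h0', hL'⟩ := h'
  refine ⟨fun t => (Φ t).trans (Ψ t), ?_, ?_, ?_⟩
  · exact hs'.comp (contMDiff_fst.prodMk hs)
  · intro x
    simp [h0, h0']
  · have hd : MDifferentiable (𝓡∂ 3) (𝓡∂ 3) (Φ 1) := (Φ 1).contMDiff.mdifferentiable (by simp)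
    have hd' : MDifferentiable (𝓡∂ 3) (𝓡∂ 3) (Ψ 1) := (Ψ 1).contMDiff.mdifferentiable (by simp)
    have e : (⇑((Φ 1).trans (Ψ 1))) = ⇑(Ψ 1) ∘ ⇑(Φ 1) := rfl
    rw [e, hL', hL, ← Set.image_comp, ← tangentMap_comp hd' hd]

/-- The links admitted as generators: all oriented links if `allowEmpty` holds, all nonempty
oriented links otherwise. -/
def Link (allowEmpty : Prop) (M : OrientedThreeManifold) : Type _ :=
  {L : OrientedLink M // allowEmpty ∨ L.carrier.Nonempty}

/-- Ambient isotopy as an equivalence relation. -/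
instance linkSetoid (allowEmpty : Prop) (M : OrientedThreeManifold) :
    Setoid (Link allowEmpty M) where
  r L L' := AmbientIsotopic L.1 L'.1
  iseqv := ⟨fun L => AmbientIsotopic.refl L.1, fun h => h.symm, fun h h' => h.trans h'⟩

/-- The set of ambient isotopy classes of oriented links in `M`. -/
def LinkClass (allowEmpty : Prop) (M : OrientedThreeManifold) : Type _ :=
  Quotient (linkSetoid allowEmpty M)

/-! ### Skein modules -/

/-- A strand of the standard twist: it runs upwards at distance `1/2` from the vertical axis and
makes `m` positive half turns about it between the heights `-1/2` and `1/2`. It starts at the angle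
`0` for `ε = 1` and at the angle `π` for `ε = -1`. -/
def twistStrand (m : ℤ) (ε : ℝ) (z : ℝ) : E3 :=
  !₂[ε / 2 * Real.cos (m * Real.pi * Real.smoothTransition (z + 1 / 2)),
     ε / 2 * Real.sin (m * Real.pi * Real.smoothTransition (z + 1 / 2)), z]

/-- The two parallel oriented strands with `m` half twists: `m` positive crossings for `m ≥ 0`,
`-m` negative crossings for `m ≤ 0`, as the set of their positively directed tangent vectors. -/
def twistTangle (m : ℤ) : Set (TangentBundle 𝓘(ℝ, E3) E3) :=
  {p | ∃ ε z c : ℝ, (ε = 1 ∨ ε = -1) ∧ 0 < c ∧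
    p = tangentMap 𝓘(ℝ, ℝ) 𝓘(ℝ, E3) (twistStrand m ε) ⟨z, c⟩}

/-- The oriented links `L 0, …, L (k - 1)` coincide outside a ball in the interior of `M`, and in
that ball, which is identified with the unit ball of `ℝ³` by an orientation preserving embedding
`b`, the link `L i` is the standard tangle of two parallel strands with `i - 1` half twists. Thus
`L 0`, `L 1`, `L 2` are the links that are also called `L₋`, `L₀`, `L₊`. -/
def IsSkeinFamily {M : OrientedThreeManifold} {k : ℕ} (L : Fin k → OrientedLink M) : Prop :=
  ∃ b : E3 → M,
    ContMDiff 𝓘(ℝ, E3) (𝓡∂ 3) ∞ b ∧ Topology.IsEmbedding b ∧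
    (∀ x, CarriesOrientation (V := E3)
      (mfderiv 𝓘(ℝ, E3) (𝓡∂ 3) b x).toLinearMap stdOrientation (M.orient (b x))) ∧
    (∀ x, b x ∈ (𝓡∂ 3).interior (M : Type _)) ∧
    (∀ i, ∀ p : TangentBundle (𝓡∂ 3) M, p.proj ∈ b '' Metric.closedBall 0 1 →
      (p ∈ (L i).carrier ↔
        p ∈ tangentMap 𝓘(ℝ, E3) (𝓡∂ 3) b '' twistTangle ((i : ℕ) - 1 : ℤ))) ∧
    (∀ i j, ∀ p : TangentBundle (𝓡∂ 3) M, p.proj ∉ b '' Metric.closedBall 0 1 →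
      (p ∈ (L i).carrier ↔ p ∈ (L j).carrier))

section Module

variable (allowEmpty : Prop) (M : OrientedThreeManifold) {R : Type*} [CommRing R] {k : ℕ}
  (r : Fin k → R)

/-- The submodule generated by the linear skein expressions `∑ r i • L i`. -/
def skeinSubmodule : Submodule R (LinkClass allowEmpty M →₀ R) :=
  Submodule.span R {x | ∃ L : Fin k → Link allowEmpty M,
    IsSkeinFamily (fun i => (L i).1) ∧
      x = ∑ i, Finsupp.single (Quotient.mk (linkSetoid allowEmpty M) (L i)) (r i)}

/-- The `k`-th skein module of `M` with coefficients `r 0, …, r (k - 1)`. -/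
abbrev SkeinModule : Type _ :=
  (LinkClass allowEmpty M →₀ R) ⧸ skeinSubmodule allowEmpty M r

variable {M}

/-- The class of a link in the skein module. -/
def linkClass (L : Link allowEmpty M) : SkeinModule allowEmpty M r :=
  Submodule.Quotient.mk (Finsupp.single (Quotient.mk (linkSetoid allowEmpty M) L) 1)

/-- `F` is the homomorphism of skein modules induced by the map `f` of manifolds: for every link
`L`, the image `f(L)`, with the orientation carried along, is a link, and `F [L] = [f(L)]`. -/
def IsInduced {N : OrientedThreeManifold} (f : M → N)
    (F : SkeinModule allowEmpty M r →ₗ[R] SkeinModule allowEmpty N r) : Prop :=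
  ∀ L : Link allowEmpty M, ∃ L' : Link allowEmpty N,
    L'.1.carrier = tangentMap (𝓡∂ 3) (𝓡∂ 3) f '' L.1.carrier ∧
      F (linkClass allowEmpty r L) = linkClass allowEmpty r L'

end Module

/-! ### Handles, caps and disjoint sums -/

/-- The 2-handle `D² × [-1, 1]`. -/
def twoHandle : Set (EuclideanSpace ℝ (Fin 2) × ℝ) :=
  Metric.closedBall 0 1 ×ˢ Set.Icc (-1) 1

/-- `N` is obtained from `M` by adding a 2-handle along a simple closed curve in the boundary of
`M`, with natural embedding `f`: there is an embedded copy `h (D² × [-1, 1])` of the handle in `N`,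
smooth in the interior of the handle, which together with `f(M)` covers `N` and meets `f(M)` exactly
in the annulus `h (S¹ × [-1, 1])`; this annulus, whose core is the attaching curve, lies in
`f(∂M)`, and the two discs `h (D² × {±1})` lie in `∂N`. No particular way to round the corners along
`h (S¹ × {±1})` is prescribed. -/
def IsTwoHandleAddition {M N : OrientedThreeManifold} (f : M → N) : Prop :=
  ∃ h : EuclideanSpace ℝ (Fin 2) × ℝ → N,
    ContinuousOn h twoHandle ∧ Set.InjOn h twoHandle ∧
    ContMDiffOn 𝓘(ℝ, EuclideanSpace ℝ (Fin 2) × ℝ) (𝓡∂ 3) ∞ h (interior twoHandle) ∧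
    (∀ p ∈ interior twoHandle,
      Function.Injective (mfderiv 𝓘(ℝ, EuclideanSpace ℝ (Fin 2) × ℝ) (𝓡∂ 3) h p)) ∧
    Set.range f ∪ h '' twoHandle = Set.univ ∧
    (∀ p ∈ twoHandle, h p ∈ Set.range f ↔ ‖p.1‖ = 1) ∧
    (∀ p ∈ twoHandle, ‖p.1‖ = 1 → h p ∈ f '' (𝓡∂ 3).boundary (M : Type _)) ∧
    (∀ p ∈ twoHandle, |p.2| = 1 → h p ∈ (𝓡∂ 3).boundary (N : Type _))

/-- `N` is obtained from `M` by capping off 2-spheres in the boundary of `M` by 3-cells, with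
natural embedding `f`: there is a family of pairwise disjoint embedded 3-cells `b j (D³)` in `N`,
smooth in the interior of the cells, which together with `f(M)` cover `N`, and each of which meets
`f(M)` exactly in its boundary sphere `b j (S²)`; this sphere lies in `f(∂M)`. -/
def IsSphereCapping {M N : OrientedThreeManifold} (f : M → N) : Prop :=
  ∃ (J : Type) (b : J → E3 → N),
    (∀ j, ContinuousOn (b j) (Metric.closedBall 0 1)) ∧
    (∀ j, Set.InjOn (b j) (Metric.closedBall 0 1)) ∧
    Pairwise (fun i j => Disjoint (b i '' Metric.closedBall 0 1) (b j '' Metric.closedBall 0 1)) ∧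
    (∀ j, ContMDiffOn 𝓘(ℝ, E3) (𝓡∂ 3) ∞ (b j) (Metric.ball 0 1)) ∧
    (∀ j, ∀ x ∈ Metric.ball (0 : E3) 1,
      Function.Injective (mfderiv 𝓘(ℝ, E3) (𝓡∂ 3) (b j) x)) ∧
    Set.range f ∪ ⋃ j, b j '' Metric.closedBall 0 1 = Set.univ ∧
    (∀ j, ∀ x ∈ Metric.closedBall (0 : E3) 1, b j x ∈ Set.range f ↔ ‖x‖ = 1) ∧
    (∀ j, ∀ x ∈ Metric.sphere (0 : E3) 1, b j x ∈ f '' (𝓡∂ 3).boundary (M : Type _))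

/-- `P` is the disjoint sum of `M` and `N` with the inclusions `i` and `j`. -/
def IsDisjointSum {M N P : OrientedThreeManifold} (i : M → P) (j : N → P) : Prop :=
  IsOpen (Set.range i) ∧ IsOpen (Set.range j) ∧ IsCompl (Set.range i) (Set.range j)

end Skein

end

/-! A linear map out of a skein module is the same thing as an isotopy invariant of links that
satisfies the skein relations (`exists_skeinModule_lift`), and it is determined by its values on
links (`skeinModule_linearMap_ext`). Every part of the theorem thus becomes a question of moving
links, isotopies of links and skein families around in 3-manifolds.

The basic engine is isotopy extension along a link (`AmbientIsotopicIn.of_family`). No vector field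
is integrated. A smooth family of maps starting at the identity and supported in a compact set of
interior points consists of diffeomorphisms for short times, and short steps are chained by
connectedness of the unit interval. Since links are compact, this yields (a) and (b) for arbitrary,
possibly noncompact, manifolds with boundary.

For (c) and (d), a 2-handle and a family of 3-cells are both cells, unit ball of `V` times `C`,
attached along the unit sphere times `C` (`CellAttachment`), with `V` of dimension 2 or 3. Smooth
objects of dimension less than that of `V`, projected to `V`, have Hausdorff dimension too small to
fill an open set, so they miss an axis over some point `p` (`exists_axis_avoiding`). What misses the
axes can be pushed radially towards the attaching region and then across it into the image of the
interior of `M` (`CellAttachment.exists_push`). Links are one-dimensional, so they leave 2-handles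
and 3-cells: the induced maps are surjective. Tracks of isotopies are two-dimensional and leave
3-cells, so isotopies in the capped manifold can be pulled back. A skein family contains a
three-dimensional ball, which general position does not control; an ambient isotopy first moves the
ball off the centres of the cells, and then ball and links are pushed out together.

The crossing of the attaching region uses no collar and no smooth model of the handle at its
corners. Near the image of a boundary point of `M`, the range of the embedding is closed under small
shifts in the image of the inward direction, and such shifts land in the image of the interior
(`exists_shift_of_isBoundaryPoint`). This comes from extending the embedding across the boundary by
a Lipschitz reflection. The same fact shows that the attaching region lies in the interior of `N`
and that the cells are locally finite there.

For (e), components of links, paths of points under isotopies and balls of skein families are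
connected, so each lies in one summand. Restriction to the summands and disjoint union are therefore
mutually inverse and respect isotopies and skein relations. -/

open scoped Manifold ContDiff TensorProduct Topology NNReal

noncomputable section

namespace Skein

open Set Function Filter

/-! ### Inverse function theorem at interior points -/

section InverseFunction

variable {E E' : Type*} [NormedAddCommGroup E] [NormedSpace ℝ E]
  [NormedAddCommGroup E'] [NormedSpace ℝ E']
  {H H' : Type*} [TopologicalSpace H] [TopologicalSpace H']
  {I : ModelWithCorners ℝ E H} {J : ModelWithCorners ℝ E' H'}
  {M N : Type*} [TopologicalSpace N] [ChartedSpace H' N]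
  [TopologicalSpace M] [ChartedSpace H M]

/-- The inverse function theorem for a smooth map between vector spaces, as a partial
diffeomorphism. -/
theorem exists_partialDiffeomorph_of_hasFDerivAt [CompleteSpace E] {F : E → E'} {V : Set E}
    (hV : IsOpen V) (hF : ContDiffOn ℝ ∞ F V) {a : E} (ha : a ∈ V) (A : E ≃L[ℝ] E')
    (hA : HasFDerivAt F (A : E →L[ℝ] E') a) :
    ∃ Φ : PartialDiffeomorph 𝓘(ℝ, E) 𝓘(ℝ, E') E E' ∞,
      a ∈ Φ.source ∧ Φ.source ⊆ V ∧ ∀ x, Φ x = F x := by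
  have hFa : ContDiffAt ℝ ∞ F a := hF.contDiffAt (hV.mem_nhds ha)
  let e := hFa.toOpenPartialHomeomorph F hA (by simp)
  -- A smooth inverse is needed on a whole open set, not only at the image of `a`. Invertibility of
  -- the derivative is an open condition, so the local inverse is restricted to points where it
  -- persists.
  let W : Set E := V ∩ fderiv ℝ F ⁻¹' range ((↑) : (E ≃L[ℝ] E') → E →L[ℝ] E')
  have hW : IsOpen W :=
    (hF.continuousOn_fderiv_of_isOpen hV (by simp)).isOpen_inter_preimage hV
      ContinuousLinearEquiv.isOpen
  have haW : a ∈ W := ⟨ha, A, hA.fderiv.symm⟩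
  let e' := e.restrOpen W hW
  have hee : ∀ x, e x = F x := fun x => rfl
  have hsrc : e'.source ⊆ W := by
    intro x hx
    rw [OpenPartialHomeomorph.restrOpen_source] at hx
    exact hx.2
  have hae : a ∈ e'.source := by
    rw [OpenPartialHomeomorph.restrOpen_source]
    exact ⟨hFa.mem_toOpenPartialHomeomorph_source hA (by simp), haW⟩
  refine ⟨⟨e'.toPartialEquiv, e'.open_source, e'.open_target, ?_, ?_⟩, hae,
    fun x hx => (hsrc hx).1, fun x => rfl⟩
  · exact contMDiffOn_iff_contDiffOn.2 (hF.mono fun x hx => (hsrc hx).1)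
  · refine contMDiffOn_iff_contDiffOn.2 fun y hy => ContDiffAt.contDiffWithinAt ?_
    have hx : e'.symm y ∈ e'.source := e'.map_target hy
    obtain ⟨hxV, B, hB⟩ := hsrc hx
    have hFx : ContDiffAt ℝ ∞ F (e'.symm y) := hF.contDiffAt (hV.mem_nhds hxV)
    refine e'.contDiffAt_symm hy (f₀' := B) ?_ hFx
    rw [hB]
    exact (hFx.differentiableAt (by simp)).hasFDerivAt

/-- The extended chart, restricted to the interior of the model, as a partial diffeomorphism. -/
def interiorChart (I : ModelWithCorners ℝ E H) [IsManifold I ∞ M] (x : M) :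
    PartialDiffeomorph I 𝓘(ℝ, E) M E ∞ where
  toFun := extChartAt I x
  invFun := (extChartAt I x).symm
  source := (extChartAt I x).source ∩ extChartAt I x ⁻¹' interior (range I)
  target := (extChartAt I x).target ∩ interior (range I)
  map_source' y hy := ⟨(extChartAt I x).map_source hy.1, hy.2⟩
  map_target' y hy := ⟨(extChartAt I x).map_target hy.1, by
    simpa only [mem_preimage, (extChartAt I x).right_inv hy.1] using hy.2⟩
  left_inv' y hy := (extChartAt I x).left_inv hy.1
  right_inv' y hy := (extChartAt I x).right_inv hy.1
  open_source := (continuousOn_extChartAt x).isOpen_inter_preimage (isOpen_extChartAt_source x)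
    isOpen_interior
  open_target := by
    have : (extChartAt I x).target ∩ interior (range I) =
        I.symm ⁻¹' (chartAt H x).target ∩ interior (range I) := by
      rw [extChartAt_target, inter_assoc, inter_eq_self_of_subset_right interior_subset]
    rw [this]
    exact ((chartAt H x).open_target.preimage I.continuous_symm).inter isOpen_interior
  contMDiffOn_toFun := (contMDiffOn_extChartAt (I := I) (x := x)).mono (by
    rw [extChartAt_source]; exact inter_subset_left)
  contMDiffOn_invFun := (contMDiffOn_extChartAt_symm (I := I) x).mono inter_subset_left

theorem surjective_mfderiv_of_injective [FiniteDimensional ℝ E]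
    [FiniteDimensional ℝ E'] (hdim : Module.finrank ℝ E = Module.finrank ℝ E') {f : M → N} {x : M}
    (hinj : Injective (mfderiv I J f x)) : Surjective (mfderiv I J f x) :=
  (LinearMap.injective_iff_surjective_of_finrank_eq_finrank
    (V := E) (V₂ := E') hdim (f := (mfderiv I J f x).toLinearMap)).1 hinj

/-- The inverse function theorem at an interior point of a manifold with corners. -/
theorem isLocalDiffeomorphAt_of_injective_mfderiv [FiniteDimensional ℝ E]
    [FiniteDimensional ℝ E'] (hdim : Module.finrank ℝ E = Module.finrank ℝ E')
    [IsManifold I ∞ M] [IsManifold J ∞ N] {f : M → N} {U : Set M} (hU : IsOpen U)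
    (hf : ContMDiffOn I J ∞ f U) {x : M} (hxU : x ∈ U) (hx : I.IsInteriorPoint x)
    (hinj : Injective (mfderiv I J f x)) : IsLocalDiffeomorphAt I J ∞ f x := by
  have hfx : MDifferentiableAt I J f x :=
    (hf.contMDiffAt (hU.mem_nhds hxU)).mdifferentiableAt (by simp)
  have hbij : Bijective (mfderiv I J f x) := ⟨hinj, surjective_mfderiv_of_injective hdim hinj⟩
  -- A surjective differential at an interior point forces an interior value, so both sides have
  -- charts onto open sets and the Euclidean theorem applies.
  have hy : J.IsInteriorPoint (f x) := hfx.isInteriorPoint_of_surjective_mfderiv hbij.2 hx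
  have hxs : x ∈ (interiorChart I x).source := ⟨mem_extChartAt_source x, hx⟩
  have hys : f x ∈ (interiorChart J (f x)).source := ⟨mem_extChartAt_source (f x), hy⟩
  let φ := (interiorChart I x).toOpenPartialHomeomorph
  let ψ := (interiorChart J (f x)).toOpenPartialHomeomorph
  let U₁ : Set M := U ∩ f ⁻¹' ψ.source
  have hU₁ : IsOpen U₁ := hf.continuousOn.isOpen_inter_preimage hU ψ.open_source
  let V : Set E := φ.target ∩ φ.symm ⁻¹' U₁
  have hV : IsOpen V := φ.isOpen_inter_preimage_symm hU₁
  let F : E → E' := writtenInExtChartAt I J x f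
  have hF : ContDiffOn ℝ ∞ F V := by
    rw [← contMDiffOn_iff_contDiffOn]
    refine (interiorChart J (f x)).contMDiffOn.comp (t := (interiorChart J (f x)).source)
      (hf.comp ((interiorChart I x).symm.contMDiffOn.mono fun z hz => hz.1) ?_) ?_
    · exact fun z hz => hz.2.1
    · exact fun z hz => hz.2.2
  have haV : extChartAt I x x ∈ V := by
    refine ⟨φ.map_source hxs, ?_⟩
    have : φ.symm (extChartAt I x x) = x := φ.left_inv hxs
    simp only [mem_preimage, this]
    exact ⟨hxU, hys⟩
  have hFd : HasFDerivAt F (mfderiv I J f x : E →L[ℝ] E') (extChartAt I x x) := by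
    have h := hfx.hasMFDerivAt.2
    exact h.hasFDerivAt (mem_interior_iff_mem_nhds.1 hx)
  let A₀ : E →L[ℝ] E' := mfderiv I J f x
  let A : E ≃L[ℝ] E' := (LinearEquiv.ofBijective (A₀ : E →ₗ[ℝ] E') hbij).toContinuousLinearEquiv
  have hAF : HasFDerivAt F (A : E →L[ℝ] E') (extChartAt I x x) := by
    have : (A : E →L[ℝ] E') = (mfderiv I J f x : E →L[ℝ] E') := by ext v; rfl
    rw [this]
    exact hFd
  obtain ⟨Θ, haΘ, hΘV, hΘF⟩ := exists_partialDiffeomorph_of_hasFDerivAt hV hF haV A hAF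
  refine ⟨((interiorChart I x).trans Θ).trans (interiorChart J (f x)).symm, ?_, ?_⟩
  · refine ⟨⟨hxs, haΘ⟩, ?_⟩
    have h1 : F (extChartAt I x x) = extChartAt J (f x) (f x) := by simp [F, writtenInExtChartAt]
    have : (Θ (extChartAt I x x)) ∈ (interiorChart J (f x)).target := by
      rw [hΘF, h1]; exact (interiorChart J (f x)).map_source hys
    exact this
  · rintro z ⟨⟨hz, hzΘ⟩, -⟩
    have hz' : (extChartAt I x).symm (extChartAt I x z) = z := (extChartAt I x).left_inv hz.1
    have hzV : extChartAt I x z ∈ V := hΘV hzΘ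
    have hfz : f z ∈ (extChartAt J (f x)).source := by
      have : φ.symm (extChartAt I x z) ∈ U₁ := hzV.2
      have h2 : φ.symm (extChartAt I x z) = z := hz'
      rw [h2] at this
      exact this.2.1
    have : f z = (extChartAt J (f x)).symm (Θ (extChartAt I x z)) := by
      rw [hΘF]
      simp only [F, writtenInExtChartAt, comp_apply, hz', (extChartAt J (f x)).left_inv hfz]
    exact this

/-- An injective immersion between manifolds of the same dimension, defined on an open set of
interior points, is an open embedding with smooth inverse. -/
theorem exists_smooth_leftInverse_of_injOn [FiniteDimensional ℝ E]
    [FiniteDimensional ℝ E'] (hdim : Module.finrank ℝ E = Module.finrank ℝ E')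
    [IsManifold I ∞ M] [IsManifold J ∞ N] [Nonempty M] {f : M → N} {U : Set M} (hU : IsOpen U)
    (hf : ContMDiffOn I J ∞ f U) (hUi : U ⊆ I.interior M) (hinj : InjOn f U)
    (himm : ∀ x ∈ U, Injective (mfderiv I J f x)) :
    ∃ g : N → M, IsOpen (f '' U) ∧ f '' U ⊆ J.interior N ∧ ContMDiffOn J I ∞ g (f '' U) ∧
      ∀ x ∈ U, g (f x) = x := by
  have hloc : ∀ x ∈ U, IsLocalDiffeomorphAt I J ∞ f x := fun x hx =>
    isLocalDiffeomorphAt_of_injective_mfderiv hdim hU hf hx (hUi hx) (himm x hx)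
  -- By injectivity on `U` the smooth local inverses agree with the single set-theoretic inverse
  -- `invFunOn f U`, which is therefore smooth.
  have key : ∀ x ∈ U, ∃ V ⊆ f '' U, IsOpen V ∧ f x ∈ V ∧ ContMDiffOn J I ∞ (invFunOn f U) V := by
    intro x hx
    obtain ⟨Φ, hxΦ, hΦ⟩ := hloc x hx
    have hright : ∀ y ∈ Φ.target, f (Φ.invFun y) = y := fun y hy => by
      exact (hΦ (Φ.map_target hy)).trans (Φ.right_inv hy)
    refine ⟨Φ.target ∩ Φ.invFun ⁻¹' U, ?_, ?_, ?_, ?_⟩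
    · exact fun y hy => ⟨_, hy.2, hright y hy.1⟩
    · exact Φ.toOpenPartialHomeomorph.isOpen_inter_preimage_symm hU
    · refine ⟨hΦ hxΦ ▸ Φ.map_source hxΦ, ?_⟩
      have : Φ.invFun (f x) = x := by rw [hΦ hxΦ]; exact Φ.left_inv hxΦ
      simpa only [mem_preimage, this] using hx
    · refine (Φ.contMDiffOn_invFun.mono (fun y hy => hy.1)).congr ?_
      rintro y ⟨hy, hyU⟩
      conv_lhs => rw [← hright y hy]
      exact hinj.leftInvOn_invFunOn hyU
  refine ⟨invFunOn f U, ?_, ?_, ?_, fun x hx => hinj.leftInvOn_invFunOn hx⟩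
  · rw [isOpen_iff_forall_mem_open]
    rintro _ ⟨x, hx, rfl⟩
    obtain ⟨V, hV, hVo, hxV, -⟩ := key x hx
    exact ⟨V, hV, hVo, hxV⟩
  · rintro _ ⟨x, hx, rfl⟩
    exact ((hloc x hx).isInteriorPoint_iff (by simp)).1 (hUi hx)
  · rintro _ ⟨x, hx, rfl⟩
    obtain ⟨V, hV, hVo, hxV, hs⟩ := key x hx
    exact (hs.contMDiffAt (hVo.mem_nhds hxV)).contMDiffWithinAt

end InverseFunction

/-! ### Short-time isotopies -/

section SmallIsotopy

variable {E : Type*} [NormedAddCommGroup E] [NormedSpace ℝ E]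
  {H : Type*} [TopologicalSpace H] {I : ModelWithCorners ℝ E H}
  {X : Type*} [TopologicalSpace X] [ChartedSpace H X] [IsManifold I ∞ X]

/-- The inverse of an extended chart at an interior point is smooth at the image of the point. -/
theorem contMDiffAt_extChartAt_symm_of_isInteriorPoint {y : X} (hy : I.IsInteriorPoint y) :
    ContMDiffAt 𝓘(ℝ, E) I ∞ (extChartAt I y).symm (extChartAt I y y) :=
  (interiorChart I y).contMDiffOn_invFun.contMDiffAt
    ((interiorChart I y).open_target.mem_nhds ⟨mem_extChartAt_target y, hy⟩)

/-- A smooth family of maps that starts at the identity is, near an interior point and for small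
times, injective with injective differentials. -/
theorem exists_nhds_injOn_of_smooth_family {Ψ : ℝ → X → X} {y : X}
    (hy : I.IsInteriorPoint y)
    (hΨ : ∀ᶠ p in 𝓝 ((0 : ℝ), y),
      ContMDiffAt (𝓘(ℝ, ℝ).prod I) I ∞ (fun p : ℝ × X => Ψ p.1 p.2) p)
    (h0 : ∀ᶠ x in 𝓝 y, Ψ 0 x = x) :
    ∃ W ∈ 𝓝 ((0 : ℝ), y), InjOn (fun p : ℝ × X => (p.1, Ψ p.1 p.2)) W ∧
      ∀ p ∈ W, Injective (mfderiv I I (Ψ p.1) p.2) := by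
  let φ := extChartAt I y
  let a : E := φ y
  let ψ : ℝ × E → E := fun p => φ (Ψ p.1 (φ.symm p.2))
  have hφa : φ.symm a = y := extChartAt_to_inv y
  have h0y : Ψ 0 y = y := h0.self_of_nhds
  have hsymm := contMDiffAt_extChartAt_symm_of_isInteriorPoint hy
  have hpair : ContMDiffAt 𝓘(ℝ, ℝ × E) (𝓘(ℝ, ℝ).prod I) ∞
      (fun p : ℝ × E => (p.1, φ.symm p.2)) (0, a) :=
    (contDiff_fst.contMDiff.contMDiffAt).prodMk
      (ContMDiffAt.comp (0, a) (g := φ.symm) hsymm contDiff_snd.contMDiff.contMDiffAt)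
  have hψ : ContDiffAt ℝ ∞ ψ (0, a) := by
    rw [← contMDiffAt_iff_contDiffAt]
    have h1 : ContMDiffAt 𝓘(ℝ, ℝ × E) I ∞ (fun p : ℝ × E => Ψ p.1 (φ.symm p.2)) (0, a) := by
      refine ContMDiffAt.comp (0, a) (g := fun p : ℝ × X => Ψ p.1 p.2) ?_ hpair
      simp only [hφa]
      exact hΨ.self_of_nhds
    refine ContMDiffAt.comp (0, a) (g := φ) ?_ h1
    simp only [hφa, h0y]
    exact contMDiffAt_extChartAt
  have hstrict : HasStrictFDerivAt ψ (fderiv ℝ ψ (0, a)) (0, a) :=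
    hψ.hasStrictFDerivAt (by simp)
  -- In the chart the family is the identity at time zero, so its derivative is the identity on
  -- spatial vectors. Strict differentiability then makes the slices at small times differ from the
  -- identity by a map with Lipschitz constant `1/2`, which gives injectivity.
  have hD : ∀ v : E, fderiv ℝ ψ (0, a) (0, v) = v := by
    intro v
    have h1 : HasFDerivAt (fun u : E => ψ (0, u))
        ((fderiv ℝ ψ (0, a)).comp (ContinuousLinearMap.inr ℝ ℝ E)) a :=
      (hstrict.hasFDerivAt).comp a (hasFDerivAt_prodMk_right (0 : ℝ) a)
    have h2 : (fun u : E => ψ (0, u)) =ᶠ[𝓝 a] id := by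
      have hc : Tendsto φ.symm (𝓝 a) (𝓝 y) := by
        have := hsymm.continuousAt.tendsto
        rwa [extChartAt_to_inv] at this
      have ht : ∀ᶠ u in 𝓝 a, u ∈ φ.target := by
        filter_upwards [(interiorChart I y).open_target.mem_nhds
          (⟨mem_extChartAt_target y, hy⟩ : a ∈ (interiorChart I y).target)] with u hu
        exact hu.1
      filter_upwards [hc.eventually h0, ht] with u hu hut
      simp only [ψ, hu, id]
      exact φ.right_inv hut
    have h3 : HasFDerivAt (fun u : E => ψ (0, u)) (ContinuousLinearMap.id ℝ E) a :=
      (hasFDerivAt_id a).congr_of_eventuallyEq h2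
    have := h1.unique h3
    simpa using congrArg (fun T : E →L[ℝ] E => T v) this
  have hest : ∀ᶠ q : (ℝ × E) × (ℝ × E) in 𝓝 ((0, a), (0, a)),
      ‖ψ q.1 - ψ q.2 - fderiv ℝ ψ (0, a) (q.1 - q.2)‖ ≤ 1 / 2 * ‖q.1 - q.2‖ :=
    hstrict.isLittleO.def (by norm_num)
  rw [nhds_prod_eq] at hest
  obtain ⟨T, hT, hTT⟩ := mem_prod_same_iff.1 hest
  have hTest : ∀ {p q : ℝ × E}, p ∈ T → q ∈ T →
      ‖ψ p - ψ q - fderiv ℝ ψ (0, a) (p - q)‖ ≤ 1 / 2 * ‖p - q‖ :=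
    fun hp hq => hTT (mk_mem_prod hp hq)
  have hψd : ∀ᶠ q in 𝓝 ((0 : ℝ), a), ContDiffAt ℝ 1 ψ q :=
    (hψ.of_le (by simp)).eventually (by simp)
  have hT' : ∀ᶠ q in 𝓝 ((0 : ℝ), a), q ∈ interior T ∧ ContDiffAt ℝ 1 ψ q :=
    Filter.Eventually.and (interior_mem_nhds.2 hT) hψd
  have hchart : Tendsto (fun p : ℝ × X => (p.1, φ p.2)) (𝓝 (0, y)) (𝓝 (0, a)) :=
    (continuous_fst.continuousAt.prodMk
      ((continuousAt_extChartAt y).comp (x := ((0 : ℝ), y)) continuous_snd.continuousAt))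
  have hsrc : ∀ᶠ p in 𝓝 ((0 : ℝ), y), p.2 ∈ φ.source :=
    continuous_snd.continuousAt.eventually (extChartAt_source_mem_nhds y)
  have hsrc' : ∀ᶠ p in 𝓝 ((0 : ℝ), y), Ψ p.1 p.2 ∈ φ.source := by
    refine hΨ.self_of_nhds.continuousAt.eventually ?_
    simp only [h0y]
    exact extChartAt_source_mem_nhds y
  have hall := (hchart.eventually hT').and (hsrc.and (hsrc'.and hΨ))
  refine ⟨_, hall, ?_, ?_⟩
  · rintro ⟨s, x⟩ ⟨⟨hx1, -⟩, hx2, hx3, -⟩ ⟨s', x'⟩ ⟨⟨hx1', -⟩, hx2', hx3', -⟩ heq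
    simp only [Prod.mk.injEq] at heq
    obtain ⟨rfl, heq⟩ := heq
    have := hTest (interior_subset hx1) (interior_subset hx1')
    have e1 : ψ (s, φ x) = ψ (s, φ x') := by
      simp only [ψ]
      rw [φ.left_inv hx2, φ.left_inv hx2']
      exact congrArg φ heq
    have e2 : ((s, φ x) - (s, φ x') : ℝ × E) = (0, φ x - φ x') := by simp
    simp only [e1, e2, hD] at this
    have hn : ‖((0 : ℝ), φ x - φ x')‖ = ‖φ x - φ x'‖ := by simp [Prod.norm_def]
    rw [hn, sub_self, zero_sub, norm_neg] at this
    have h4 : ‖φ x - φ x'‖ = 0 := by nlinarith [norm_nonneg (φ x - φ x')]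
    have h5 : φ x = φ x' := sub_eq_zero.1 (norm_eq_zero.1 h4)
    rw [Prod.mk.injEq]
    exact ⟨rfl, φ.injOn hx2 hx2' h5⟩
  · rintro ⟨s, x⟩ ⟨⟨hx1, hx1d⟩, hx2, hx3, hx4⟩
    dsimp only at hx1 hx1d hx2 hx3 hx4 ⊢
    set u : E := φ x with hu
    have hder : HasFDerivAt (fun w : E => ψ (s, w))
        ((fderiv ℝ ψ (s, u)).comp (ContinuousLinearMap.inr ℝ ℝ E)) u :=
      ((hx1d.differentiableAt (by simp)).hasFDerivAt).comp u (hasFDerivAt_prodMk_right s u)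
    have hinj1 : Injective (fderiv ℝ (fun w : E => ψ (s, w)) u) := by
      -- The same Lipschitz estimate bounds the derivative: it is within `1/2` of the identity and
      -- so has no kernel.
      have hle : ‖fderiv ℝ (fun w : E => ψ (s, w) - w) u‖ ≤ 1 / 2 := by
        refine norm_fderiv_le_of_lip' ℝ (by norm_num) ?_
        have : ∀ᶠ w in 𝓝 u, (s, w) ∈ interior T := by
          have hc : ContinuousAt (fun w : E => (s, w)) u := by fun_prop
          exact hc.eventually (isOpen_interior.mem_nhds hx1)
        filter_upwards [this] with w hw
        have := hTest (interior_subset hw) (interior_subset hx1)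
        have e2 : ((s, w) - (s, u) : ℝ × E) = (0, w - u) := by simp
        have hn : ‖((0 : ℝ), w - u)‖ = ‖w - u‖ := by simp [Prod.norm_def]
        simp only [e2, hD, hn] at this
        convert this using 2
        abel
      have hsub : fderiv ℝ (fun w : E => ψ (s, w) - w) u =
          fderiv ℝ (fun w : E => ψ (s, w)) u - ContinuousLinearMap.id ℝ E := by
        rw [hder.fderiv]
        exact (hder.sub (hasFDerivAt_id u)).fderiv
      rw [injective_iff_map_eq_zero]
      intro v hv
      have h6 := (fderiv ℝ (fun w : E => ψ (s, w) - w) u).le_of_opNorm_le hle v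
      rw [hsub] at h6
      simp only [sub_apply, hv, zero_sub, norm_neg,
        ContinuousLinearMap.id_apply] at h6
      have : ‖v‖ = 0 := by nlinarith [norm_nonneg v]
      exact norm_eq_zero.1 this
    have hΨs : ContMDiffAt I I ∞ (Ψ s) x :=
      ContMDiffAt.comp x (g := fun p : ℝ × X => Ψ p.1 p.2) (f := fun z => (s, z)) hx4
        (contMDiffAt_const.prodMk contMDiffAt_id)
    have hφx : MDifferentiableAt I 𝓘(ℝ, E) φ x := by
      exact (contMDiffAt_extChartAt' (n := ∞) (by simpa [φ] using hx2)).mdifferentiableAt (by simp)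
    have hφΨ : MDifferentiableAt I 𝓘(ℝ, E) φ (Ψ s x) := by
      exact (contMDiffAt_extChartAt' (n := ∞) (by simpa [φ] using hx3)).mdifferentiableAt (by simp)
    have hcomm : (fun z => φ (Ψ s z)) =ᶠ[𝓝 x] (fun w : E => ψ (s, w)) ∘ φ := by
      filter_upwards [extChartAt_source_mem_nhds' hx2] with z hz
      simp only [ψ, comp_apply]
      rw [φ.left_inv hz]
    have e1 : mfderiv I 𝓘(ℝ, E) (fun z => φ (Ψ s z)) x =
        (mfderiv I 𝓘(ℝ, E) φ (Ψ s x)).comp (mfderiv I I (Ψ s) x) :=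
      mfderiv_comp x hφΨ (hΨs.mdifferentiableAt (by simp))
    have e2 : mfderiv I 𝓘(ℝ, E) ((fun w : E => ψ (s, w)) ∘ φ) x =
        (mfderiv 𝓘(ℝ, E) 𝓘(ℝ, E) (fun w : E => ψ (s, w)) (φ x)).comp
          (mfderiv I 𝓘(ℝ, E) φ x) :=
      mfderiv_comp x hder.differentiableAt.mdifferentiableAt hφx
    have hinj2 : Injective (mfderiv I 𝓘(ℝ, E) (fun z => φ (Ψ s z)) x) := by
      rw [hcomm.mfderiv_eq, e2, mfderiv_eq_fderiv]
      exact hinj1.comp (isInvertible_mfderiv_extChartAt hx2).injective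
    rw [e1] at hinj2
    exact Injective.of_comp hinj2

end SmallIsotopy

section SmallIsotopy

variable {E : Type*} [NormedAddCommGroup E] [NormedSpace ℝ E]
  {H : Type*} [TopologicalSpace H] {I : ModelWithCorners ℝ E H}
  {X : Type*} [TopologicalSpace X] [ChartedSpace H X] [IsManifold I ∞ X]

/-- A smooth family of maps that starts at the identity and is supported in a compact set of
interior points consists of diffeomorphisms for small times. -/
theorem exists_diffeomorph_of_small [T2Space X] [FiniteDimensional ℝ E] {Ψ : ℝ → X → X}
    {K : Set X} (hK : IsCompact K) (hKi : K ⊆ I.interior X) {ε : ℝ} (hε : 0 < ε)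
    (hΨ : ContMDiffOn (𝓘(ℝ, ℝ).prod I) I ∞ (fun p : ℝ × X => Ψ p.1 p.2) (Ioo (-ε) ε ×ˢ univ))
    (h0 : ∀ x, Ψ 0 x = x) (hfix : ∀ s x, x ∉ K → Ψ s x = x) :
    ∃ δ > 0, δ ≤ ε ∧ ∀ s, |s| < δ → ∃ Φ : Diffeomorph I I X X ∞, ∀ x, Φ x = Ψ s x := by
  have hO : IsOpen (Ioo (-ε) ε ×ˢ (univ : Set X)) := isOpen_Ioo.prod isOpen_univ
  have hmem : ∀ y : X, ((0 : ℝ), y) ∈ Ioo (-ε) ε ×ˢ (univ : Set X) := fun y =>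
    ⟨⟨by linarith, hε⟩, mem_univ _⟩
  have hat : ∀ p ∈ Ioo (-ε) ε ×ˢ (univ : Set X),
      ContMDiffAt (𝓘(ℝ, ℝ).prod I) I ∞ (fun p : ℝ × X => Ψ p.1 p.2) p := fun p hp =>
    hΨ.contMDiffAt (hO.mem_nhds hp)
  have hloc : ∀ y ∈ K, ∃ W ∈ 𝓝 ((0 : ℝ), y), InjOn (fun p : ℝ × X => (p.1, Ψ p.1 p.2)) W ∧
      ∀ p ∈ W, Injective (mfderiv I I (Ψ p.1) p.2) := fun y hy =>
    exists_nhds_injOn_of_smooth_family (hKi hy)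
      (by filter_upwards [hO.mem_nhds (hmem y)] with p hp using hat p hp)
      (Eventually.of_forall h0)
  -- Local injectivity at each point of the compact set `{0} × K`, together with injectivity on it,
  -- gives injectivity on a neighbourhood; the tube lemma then makes this neighbourhood a product.
  obtain ⟨T, hT, hTinj⟩ := Set.InjOn.exists_mem_nhdsSet
    (f := fun p : ℝ × X => (p.1, Ψ p.1 p.2)) (s := {(0 : ℝ)} ×ˢ K)
    (by
      rintro ⟨s, x⟩ ⟨hs, -⟩ ⟨s', x'⟩ ⟨hs', -⟩ heq
      obtain rfl : s = 0 := hs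
      obtain rfl : s' = 0 := hs'
      simpa [h0] using heq)
    (isCompact_singleton.prod hK)
    (by
      rintro ⟨s, x⟩ ⟨hs, -⟩
      obtain rfl : s = 0 := hs
      exact continuous_fst.continuousAt.prodMk (hat _ (hmem x)).continuousAt)
    (by
      rintro ⟨s, x⟩ ⟨hs, hx⟩
      obtain rfl : s = 0 := hs
      obtain ⟨W, hW, hWi, -⟩ := hloc x hx
      exact ⟨W, hW, hWi⟩)
  obtain ⟨n, hn, hsn, hnT⟩ := mem_nhdsSet_iff_exists.1 hT
  obtain ⟨u, v, hu, hv, hu0, hKv, huv⟩ := generalized_tube_lemma isCompact_singleton hK hn hsn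
  have hu0' : u ∈ 𝓝 (0 : ℝ) := hu.mem_nhds (hu0 rfl)
  have hS2 : ∀ᶠ s in 𝓝 (0 : ℝ), ∀ x ∈ K, Injective (mfderiv I I (Ψ s) x) := by
    refine hK.eventually_forall_of_forall_eventually fun x hx => ?_
    obtain ⟨W, hW, -, hWd⟩ := hloc x hx
    filter_upwards [hW] with p hp using hWd p hp
  have hS3 : ∀ᶠ s in 𝓝 (0 : ℝ), ∀ x ∈ K, Ψ s x ∈ v := by
    refine hK.eventually_forall_of_forall_eventually fun x hx => ?_
    refine (hat _ (hmem x)).continuousAt.eventually ?_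
    simp only [h0]
    exact hv.mem_nhds (hKv hx)
  obtain ⟨δ, hδ, hδall⟩ := Metric.eventually_nhds_iff.1 ((hS2.and hS3).and hu0')
  refine ⟨min δ ε, lt_min hδ hε, min_le_right _ _, fun s hs => ?_⟩
  obtain ⟨⟨hs2, hs3⟩, hsu⟩ := hδall (y := s) (by
    rw [Real.dist_eq, sub_zero]; exact hs.trans_le (min_le_left _ _))
  have hsε : |s| < ε := hs.trans_le (min_le_right _ _)
  have hsmooth : ∀ r : ℝ, |r| < ε → ContMDiff I I ∞ (Ψ r) := fun r hr x =>
    ContMDiffAt.comp x (g := fun p : ℝ × X => Ψ p.1 p.2) (f := fun z => (r, z))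
      (hat _ ⟨abs_lt.1 hr, mem_univ _⟩) (contMDiffAt_const.prodMk contMDiffAt_id)
  have hcont : Continuous (Ψ s) := (hsmooth s hsε).continuous
  have hinjv : InjOn (Ψ s) v := by
    intro x hx x' hx' heq
    have := hTinj (hnT (huv (mk_mem_prod hsu hx))) (hnT (huv (mk_mem_prod hsu hx')))
      (by simp [heq])
    exact congrArg Prod.snd this
  have hinj : Injective (Ψ s) := by
    -- Points of `K` stay in `v` and all other points are fixed, so `v` is mapped into itself while
    -- points outside `v` do not move.
    have hne : ∀ x x', x ∈ v → x' ∉ v → Ψ s x ≠ Ψ s x' := by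
      intro x x' hx hx' heq
      have hx'K : x' ∉ K := fun h => hx' (hKv h)
      rw [hfix s x' hx'K] at heq
      by_cases hxK : x ∈ K
      · exact hx' (heq ▸ hs3 x hxK)
      · rw [hfix s x hxK] at heq
        exact hx' (heq ▸ hx)
    intro x x' heq
    by_cases hx : x ∈ v <;> by_cases hx' : x' ∈ v
    · exact hinjv hx hx' heq
    · exact (hne x x' hx hx' heq).elim
    · exact (hne x' x hx' hx heq.symm).elim
    · rwa [hfix s x fun h => hx (hKv h), hfix s x' fun h => hx' (hKv h)] at heq
  have hld : ∀ x, IsLocalDiffeomorphAt I I ∞ (Ψ s) x := by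
    intro x
    by_cases hx : x ∈ K
    · exact isLocalDiffeomorphAt_of_injective_mfderiv rfl isOpen_univ
        (hsmooth s hsε).contMDiffOn (mem_univ x) (hKi hx) (hs2 x hx)
    · refine ⟨⟨⟨id, id, Kᶜ, Kᶜ, fun _ h => h, fun _ h => h, fun _ _ => rfl, fun _ _ => rfl⟩,
        hK.isClosed.isOpen_compl, hK.isClosed.isOpen_compl, contMDiffOn_id, contMDiffOn_id⟩, hx,
        fun z hz => ?_⟩
      exact hfix s z hz
  have hopen : IsOpen (range (Ψ s)) := IsLocalDiffeomorph.isOpen_range (I := I) (J := I) hld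
  have hclosed : IsClosed (range (Ψ s)) := by
    have hcl : ∀ x ∈ closure Kᶜ, Ψ s x = x := fun x hx =>
      closure_minimal (fun z hz => hfix s z hz) (isClosed_eq hcont continuous_id) hx
    have : range (Ψ s) = Ψ s '' K ∪ closure Kᶜ := by
      apply Subset.antisymm
      · rintro _ ⟨x, rfl⟩
        by_cases hx : x ∈ K
        · exact Or.inl (mem_image_of_mem _ hx)
        · rw [hfix s x hx]
          exact Or.inr (subset_closure hx)
      · rintro y (⟨x, -, rfl⟩ | hy)
        · exact mem_range_self x
        · exact ⟨y, hcl y hy⟩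
    rw [this]
    exact ((hK.image hcont).isClosed).union isClosed_closure
  -- The range is open and closed. The path `Ψ (τ * s) y` joins `y` to `Ψ s y`, which is in the
  -- range, so `y` is too; no connectedness of `X` is needed.
  have hsurj : Surjective (Ψ s) := by
    intro y
    have hpath : Continuous fun τ : Icc (0 : ℝ) 1 => Ψ (τ * s) y := by
      rw [continuous_iff_continuousAt]
      intro τ
      have h1 : |(τ : ℝ) * s| < ε := by
        rw [abs_mul, abs_of_nonneg τ.2.1]
        exact lt_of_le_of_lt (mul_le_of_le_one_left (abs_nonneg s) τ.2.2) hsε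
      exact ContinuousAt.comp (g := fun p : ℝ × X => Ψ p.1 p.2)
        (f := fun τ : Icc (0 : ℝ) 1 => ((τ : ℝ) * s, y)) (x := τ)
        (hat _ ⟨abs_lt.1 h1, mem_univ _⟩).continuousAt (by fun_prop)
    have hclop : IsClopen ((fun τ : Icc (0 : ℝ) 1 => Ψ (τ * s) y) ⁻¹' range (Ψ s)) :=
      IsClopen.preimage ⟨hclosed, hopen⟩ hpath
    have huniv := hclop.eq_univ ⟨⟨1, by simp⟩, by simp⟩
    have : (⟨0, by simp⟩ : Icc (0 : ℝ) 1) ∈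
        (fun τ : Icc (0 : ℝ) 1 => Ψ (τ * s) y) ⁻¹' range (Ψ s) := huniv ▸ mem_univ _
    simpa [h0] using this
  let e : X ≃ X := Equiv.ofBijective (Ψ s) ⟨hinj, hsurj⟩
  refine ⟨⟨e, hsmooth s hsε, ?_⟩, fun x => rfl⟩
  intro y
  obtain ⟨x, rfl⟩ := hsurj y
  obtain ⟨Φ, hxΦ, hΦ⟩ := hld x
  have hnb : Φ.target ∈ 𝓝 (Ψ s x) := Φ.open_target.mem_nhds (hΦ hxΦ ▸ Φ.map_source hxΦ)
  refine (Φ.contMDiffOn_invFun.contMDiffAt hnb).congr_of_eventuallyEq ?_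
  filter_upwards [hnb] with z hz
  refine e.injective ?_
  have h1 : e (e.symm z) = z := e.apply_symm_apply z
  refine h1.trans ?_
  exact ((hΦ (Φ.map_target hz)).trans (Φ.right_inv hz)).symm

/-- The smooth isotopy obtained from a family as in `exists_diffeomorph_of_small` by slowing it
down. -/
theorem exists_isotopy_of_small [T2Space X] [FiniteDimensional ℝ E] {Ψ : ℝ → X → X}
    {K : Set X} (hK : IsCompact K) (hKi : K ⊆ I.interior X) {ε : ℝ} (hε : 0 < ε)
    (hΨ : ContMDiffOn (𝓘(ℝ, ℝ).prod I) I ∞ (fun p : ℝ × X => Ψ p.1 p.2) (Ioo (-ε) ε ×ˢ univ))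
    (h0 : ∀ x, Ψ 0 x = x) (hfix : ∀ s x, x ∉ K → Ψ s x = x) :
    ∃ δ > 0, ∀ s, |s| < δ → ∃ Φ : ℝ → Diffeomorph I I X X ∞,
      ContMDiff (𝓘(ℝ, ℝ).prod I) I ∞ (fun p : ℝ × X => Φ p.1 p.2) ∧
      ∀ t x, Φ t x = Ψ (s * Real.smoothTransition t) x := by
  obtain ⟨δ, hδ, hδε, hall⟩ := exists_diffeomorph_of_small hK hKi hε hΨ h0 hfix
  refine ⟨δ, hδ, fun s hs => ?_⟩
  have hbound : ∀ t : ℝ, |s * Real.smoothTransition t| < δ := fun t => by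
    rw [abs_mul, abs_of_nonneg (Real.smoothTransition.nonneg t)]
    exact lt_of_le_of_lt
      (mul_le_of_le_one_right (abs_nonneg s) (Real.smoothTransition.le_one t)) hs
  choose Φ hΦ using fun t : ℝ => hall _ (hbound t)
  refine ⟨Φ, ?_, hΦ⟩
  simp only [hΦ]
  have h1 : ContMDiff (𝓘(ℝ, ℝ).prod I) 𝓘(ℝ, ℝ) ∞
      (fun p : ℝ × X => s * Real.smoothTransition p.1) :=
    ContMDiff.comp (g := fun t : ℝ => s * Real.smoothTransition t) (I' := 𝓘(ℝ, ℝ))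
      (contMDiff_iff_contDiff.2 (contDiff_const.mul Real.smoothTransition.contDiff)) contMDiff_fst
  intro p
  refine ContMDiffAt.comp p (g := fun p : ℝ × X => Ψ p.1 p.2)
    (f := fun p : ℝ × X => (s * Real.smoothTransition p.1, p.2))
    (hΨ.contMDiffAt ((isOpen_Ioo.prod isOpen_univ).mem_nhds
      ⟨abs_lt.1 ((hbound p.1).trans_le hδε), mem_univ _⟩)) ?_
  exact (h1 p).prodMk contMDiffAt_snd

/-- Isotopy extension for short times: a smooth family of maps, defined near a compact set of
interior points and starting at the identity, agrees near this set and for small times with the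
time-one map of an ambient isotopy supported in a given neighbourhood. -/
theorem exists_isotopy_eventuallyEq [T2Space X] [FiniteDimensional ℝ E] [SigmaCompactSpace X]
    {G : ℝ → X → X} {O : Set (ℝ × X)} (hO : IsOpen O)
    (hG : ContMDiffOn (𝓘(ℝ, ℝ).prod I) I ∞ (fun p : ℝ × X => G p.1 p.2) O)
    (hG0 : ∀ x, (0, x) ∈ O → G 0 x = x) {C : Set X} (hC : IsCompact C)
    (hCi : C ⊆ I.interior X) (hCO : ∀ x ∈ C, ((0 : ℝ), x) ∈ O) {U : Set X} (hU : IsOpen U)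
    (hCU : C ⊆ U) :
    ∃ δ > 0, ∀ s, |s| < δ → ∃ Φ : ℝ → Diffeomorph I I X X ∞,
      ContMDiff (𝓘(ℝ, ℝ).prod I) I ∞ (fun p : ℝ × X => Φ p.1 p.2) ∧ (∀ x, Φ 0 x = x) ∧
      (∀ t x, x ∉ U → Φ t x = x) ∧ ∀ x ∈ C, ⇑(Φ 1) =ᶠ[𝓝 x] G s := by
  classical
  have : LocallyCompactSpace X := Manifold.locallyCompact_of_finiteDimensional I
  have hInt : IsOpen (I.interior X) := ModelWithCorners.isOpen_interior (n := ∞) (by simp)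
  let U₁ : Set X := U ∩ I.interior X ∩ (fun x => ((0 : ℝ), x)) ⁻¹' O
  have hU₁ : IsOpen U₁ := (hU.inter hInt).inter (hO.preimage (by fun_prop))
  have hCU₁ : C ⊆ U₁ := fun x hx => ⟨⟨hCU hx, hCi hx⟩, hCO x hx⟩
  obtain ⟨K, hK, hCK, hKU⟩ := exists_compact_between hC hU₁ hCU₁
  obtain ⟨χ, hχ1, hχ0, hχ01⟩ := exists_contMDiffMap_one_nhds_of_subset_interior I
    (n := ⊤) hC.isClosed hCK
  have hKO : ∀ᶠ s in 𝓝 (0 : ℝ), ∀ x ∈ K, (s, x) ∈ O :=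
    hK.eventually_forall_of_forall_eventually fun x hx => hO.mem_nhds (hKU hx).2
  obtain ⟨ε, hε, hεO⟩ := Metric.eventually_nhds_iff.1 hKO
  have hscale : ∀ s x, |s| < ε → |s * χ x| < ε := fun s x hs => by
    rw [abs_mul, abs_of_nonneg (hχ01 x).1]
    exact lt_of_le_of_lt (mul_le_of_le_one_right (abs_nonneg s) (hχ01 x).2) hs
  -- The cut-off function slows down time instead of scaling a displacement, so no linear structure
  -- on `X` is required; where it vanishes the family is at time zero, that is, the identity.
  let Ψ : ℝ → X → X := fun s x => if x ∈ K then G (s * χ x) x else x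
  have h0 : ∀ x, Ψ 0 x = x := fun x => by
    by_cases hx : x ∈ K
    · simp only [Ψ, if_pos hx, zero_mul]
      exact hG0 x (hKU hx).2
    · simp only [Ψ, if_neg hx]
  have hfix : ∀ s x, x ∉ K → Ψ s x = x := fun s x hx => by simp only [Ψ, if_neg hx]
  have hΨ : ContMDiffOn (𝓘(ℝ, ℝ).prod I) I ∞ (fun p : ℝ × X => Ψ p.1 p.2)
      (Ioo (-ε) ε ×ˢ univ) := by
    rintro ⟨s, x⟩ ⟨hs, -⟩
    refine ContMDiffAt.contMDiffWithinAt ?_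
    by_cases hx : x ∈ K
    · have hmul : ContMDiffAt (𝓘(ℝ, ℝ).prod I) 𝓘(ℝ, ℝ) ∞
          (fun p : ℝ × X => p.1 * χ p.2) (s, x) :=
        contMDiffAt_fst.mul (ContMDiffAt.comp (s, x) (g := χ) (χ.contMDiff x) contMDiffAt_snd)
      have hsx : (s * χ x, x) ∈ O := hεO
        (by rw [Real.dist_eq, sub_zero]; exact hscale s x (abs_lt.2 hs)) x hx
      have hGs : ContMDiffAt (𝓘(ℝ, ℝ).prod I) I ∞ (fun p : ℝ × X => G (p.1 * χ p.2) p.2)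
          (s, x) :=
        ContMDiffAt.comp (s, x) (g := fun p : ℝ × X => G p.1 p.2)
          (f := fun p : ℝ × X => (p.1 * χ p.2, p.2))
          (hG.contMDiffAt (hO.mem_nhds hsx)) (hmul.prodMk contMDiffAt_snd)
      refine hGs.congr_of_eventuallyEq ?_
      filter_upwards [continuous_snd.continuousAt.eventually (hU₁.mem_nhds (hKU hx))]
        with p hp
      by_cases hpK : p.2 ∈ K
      · simp only [Ψ, if_pos hpK]
      · simp only [Ψ, if_neg hpK, hχ0 p.2 hpK, mul_zero]
        exact (hG0 _ hp.2).symm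
    · refine (contMDiffAt_snd (I := 𝓘(ℝ, ℝ)) (J := I) (n := ∞)).congr_of_eventuallyEq ?_
      filter_upwards [continuous_snd.continuousAt.eventually
        (hK.isClosed.isOpen_compl.mem_nhds hx)] with p hp
      exact hfix _ _ hp
  obtain ⟨δ, hδ, hall⟩ := exists_isotopy_of_small hK (fun x hx => (hKU hx).1.2) hε hΨ h0 hfix
  refine ⟨δ, hδ, fun s hs => ?_⟩
  obtain ⟨Φ, hΦs, hΦ⟩ := hall s hs
  refine ⟨Φ, hΦs, fun x => ?_, fun t x hx => ?_, fun x hx => ?_⟩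
  · rw [hΦ, Real.smoothTransition.zero, mul_zero, h0]
  · rw [hΦ]
    exact hfix _ _ fun h => hx (hKU h).1.1
  · have h1 : ∀ᶠ z in 𝓝 x, χ z = 1 := hχ1.filter_mono (nhds_le_nhdsSet hx)
    have h2 : ∀ᶠ z in 𝓝 x, z ∈ K := mem_interior_iff_mem_nhds.1 (hCK hx)
    filter_upwards [h1, h2] with z hz1 hz2
    rw [hΦ, Real.smoothTransition.one, mul_one]
    simp only [Ψ, if_pos hz2, hz1, mul_one]

end SmallIsotopy

/-- Maps that agree near a point induce the same map on tangent vectors at this point. -/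
theorem tangentMap_congr_of_eventuallyEq {E E' : Type*} [NormedAddCommGroup E] [NormedSpace ℝ E]
    [NormedAddCommGroup E'] [NormedSpace ℝ E'] {H H' : Type*} [TopologicalSpace H]
    [TopologicalSpace H'] {I : ModelWithCorners ℝ E H} {J : ModelWithCorners ℝ E' H'}
    {M N : Type*} [TopologicalSpace M] [ChartedSpace H M] [TopologicalSpace N]
    [ChartedSpace H' N] {f g : M → N} {p : TangentBundle I M} (h : f =ᶠ[𝓝 p.proj] g) :
    tangentMap I J f p = tangentMap I J g p := by
  have h1 : f p.proj = g p.proj := h.eq_of_nhds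
  have h2 : (mfderiv I J f p.proj : E →L[ℝ] E') = mfderiv I J g p.proj := h.mfderiv_eq
  have h3 : ∀ (z z' : N) (v v' : E'), z = z' → v = v' →
      (⟨z, v⟩ : TangentBundle J N) = ⟨z', v'⟩ := by
    rintro z _ v _ rfl rfl
    rfl
  exact h3 _ _ _ _ h1 (congrArg (fun T : E →L[ℝ] E' => T p.2) h2)

instance (M : OrientedThreeManifold) : SigmaCompactSpace M := by
  have : LocallyCompactSpace M := Manifold.locallyCompact_of_finiteDimensional (𝓡∂ 3)
  infer_instance

theorem isOpen_interior_manifold (M : OrientedThreeManifold) :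
    IsOpen ((𝓡∂ 3).interior (M : Type _)) :=
  ModelWithCorners.isOpen_interior (n := ∞) (by simp)

/-! ### Links, their supports and their images -/

namespace OrientedLink

variable {M N : OrientedThreeManifold}

/-- The underlying set of a link. -/
def support (L : OrientedLink M) : Set M := Bundle.TotalSpace.proj '' L.carrier

/-- The base points of the tangent vectors of a parametrized link. -/
theorem proj_image_setOf {ι : Type*} (γ : ι → ℝ → M) :
    Bundle.TotalSpace.proj '' {p : TangentBundle (𝓡∂ 3) M | ∃ (i : ι) (t c : ℝ), 0 < c ∧
      p = tangentMap 𝓘(ℝ, ℝ) (𝓡∂ 3) (γ i) ⟨t, c⟩} = {x | ∃ i t, γ i t = x} := by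
  ext x
  constructor
  · rintro ⟨_, ⟨i, t, c, hc, rfl⟩, rfl⟩
    exact ⟨i, t, rfl⟩
  · rintro ⟨i, t, rfl⟩
    exact ⟨_, ⟨i, t, 1, one_pos, rfl⟩, rfl⟩

/-- By periodicity a link is the image of finitely many copies of the unit interval. Compactness is
what allows isotopy extension in noncompact manifolds. -/
theorem isCompact_support (L : OrientedLink M) : IsCompact L.support := by
  obtain ⟨n, γ, hγ, hL⟩ := L.exists_param
  rw [support, hL, proj_image_setOf]
  have : {x | ∃ i t, γ i t = x} = ⋃ i, γ i '' Icc 0 1 := by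
    ext x
    simp only [mem_ofPred_eq, mem_iUnion, mem_image]
    refine exists_congr fun i => ⟨?_, fun ⟨t, _, h⟩ => ⟨t, h⟩⟩
    rintro ⟨t, rfl⟩
    refine ⟨Int.fract t, ⟨Int.fract_nonneg t, (Int.fract_lt_one t).le⟩, ?_⟩
    have := (hγ.periodic i).sub_int_mul_eq (x := t) ⌊t⌋
    rwa [mul_one] at this
  rw [this]
  exact isCompact_iUnion fun i => isCompact_Icc.image (hγ.contMDiff i).continuous

theorem support_subset_interior (L : OrientedLink M) :
    L.support ⊆ (𝓡∂ 3).interior (M : Type _) := by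
  obtain ⟨n, γ, hγ, hL⟩ := L.exists_param
  rw [support, hL, proj_image_setOf]
  rintro _ ⟨i, t, rfl⟩
  exact hγ.interior i t

theorem mem_support_of_mem {L : OrientedLink M} {p : TangentBundle (𝓡∂ 3) M}
    (hp : p ∈ L.carrier) : p.proj ∈ L.support := mem_image_of_mem _ hp

/-- A link given by a parametrization indexed by an arbitrary finite type. -/
theorem exists_of_finite {ι : Type*} [Finite ι] {γ : ι → ℝ → M}
    (hs : ∀ i, ContMDiff 𝓘(ℝ, ℝ) (𝓡∂ 3) ∞ (γ i)) (hp : ∀ i, Periodic (γ i) 1)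
    (hinj : ∀ i j s t, γ i s = γ j t → i = j ∧ ∃ m : ℤ, s = t + m)
    (hreg : ∀ i t, Injective (mfderiv 𝓘(ℝ, ℝ) (𝓡∂ 3) (γ i) t))
    (hint : ∀ i t, γ i t ∈ (𝓡∂ 3).interior (M : Type _)) :
    ∃ L : OrientedLink M, L.carrier = {p | ∃ (i : ι) (t c : ℝ), 0 < c ∧
      p = tangentMap 𝓘(ℝ, ℝ) (𝓡∂ 3) (γ i) ⟨t, c⟩} := by
  obtain ⟨n, ⟨e⟩⟩ := Finite.exists_equiv_fin ι
  refine ⟨⟨_, n, fun i => γ (e.symm i), ⟨fun i => hs _, fun i => hp _, fun i j s t h => ?_,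
    fun i => hreg _, fun i => hint _⟩, rfl⟩, ?_⟩
  · obtain ⟨h1, h2⟩ := hinj _ _ _ _ h
    exact ⟨e.symm.injective h1, h2⟩
  · ext p
    constructor
    · rintro ⟨i, h⟩
      exact ⟨_, h⟩
    · rintro ⟨i, h⟩
      exact ⟨e i, by simpa using h⟩

/-- The image of a link under a map that is an injective immersion near the link. -/
theorem exists_map (L : OrientedLink M) {f : M → N} {U : Set M} (hU : IsOpen U)
    (hf : ContMDiffOn (𝓡∂ 3) (𝓡∂ 3) ∞ f U) (hinj : InjOn f U)
    (himm : ∀ x ∈ U, Injective (mfderiv (𝓡∂ 3) (𝓡∂ 3) f x)) (hLU : L.support ⊆ U) :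
    ∃ L' : OrientedLink N, L'.carrier = tangentMap (𝓡∂ 3) (𝓡∂ 3) f '' L.carrier := by
  obtain ⟨n, γ, hγ, hL⟩ := L.exists_param
  have hγU : ∀ i t, γ i t ∈ U := fun i t => hLU (by
    rw [support, hL, proj_image_setOf]; exact ⟨i, t, rfl⟩)
  have hfat : ∀ i t, ContMDiffAt (𝓡∂ 3) (𝓡∂ 3) ∞ f (γ i t) := fun i t =>
    hf.contMDiffAt (hU.mem_nhds (hγU i t))
  have hfd : ∀ i t, MDifferentiableAt (𝓡∂ 3) (𝓡∂ 3) f (γ i t) := fun i t =>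
    (hfat i t).mdifferentiableAt (by simp)
  have hγd : ∀ i t, MDifferentiableAt 𝓘(ℝ, ℝ) (𝓡∂ 3) (γ i) t := fun i t =>
    (hγ.contMDiff i t).mdifferentiableAt (by simp)
  obtain ⟨L', hL'⟩ := exists_of_finite (γ := fun i t => f (γ i t))
    (fun i t => ContMDiffAt.comp t (hfat i t) (hγ.contMDiff i t))
    (fun i t => congrArg f (hγ.periodic i t))
    (fun i j s t h => hγ.injective i j s t (hinj (hγU i s) (hγU j t) h))
    (fun i t => by
      have : mfderiv 𝓘(ℝ, ℝ) (𝓡∂ 3) (fun t => f (γ i t)) t =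
          (mfderiv (𝓡∂ 3) (𝓡∂ 3) f (γ i t)).comp (mfderiv 𝓘(ℝ, ℝ) (𝓡∂ 3) (γ i) t) :=
        mfderiv_comp t (hfd i t) (hγd i t)
      rw [this]
      exact (himm _ (hγU i t)).comp (hγ.regular i t))
    (fun i t => (hfd i t).isInteriorPoint_of_surjective_mfderiv
      (surjective_mfderiv_of_injective rfl (himm _ (hγU i t))) (hγ.interior i t))
  refine ⟨L', ?_⟩
  have hcomp : ∀ i t (c : ℝ), tangentMap 𝓘(ℝ, ℝ) (𝓡∂ 3) (fun t => f (γ i t)) ⟨t, c⟩ =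
      tangentMap (𝓡∂ 3) (𝓡∂ 3) f (tangentMap 𝓘(ℝ, ℝ) (𝓡∂ 3) (γ i) ⟨t, c⟩) := fun i t c =>
    tangentMap_comp_at (I' := 𝓡∂ 3) (g := f) (f := γ i) ⟨t, c⟩ (hfd i t) (hγd i t)
  rw [hL', hL]
  ext p
  constructor
  · rintro ⟨i, t, c, hc, rfl⟩
    exact ⟨_, ⟨i, t, c, hc, rfl⟩, (hcomp i t c).symm⟩
  · rintro ⟨_, ⟨i, t, c, hc, rfl⟩, rfl⟩
    exact ⟨i, t, c, hc, (hcomp i t c).symm⟩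

theorem support_eq_image {L : OrientedLink M} {L' : OrientedLink N} {f : M → N}
    (h : L'.carrier = tangentMap (𝓡∂ 3) (𝓡∂ 3) f '' L.carrier) : L'.support = f '' L.support := by
  rw [support, support, h, image_image, image_image]
  rfl

end OrientedLink

/-! ### Isotopy extension for links -/

/-- A smooth ambient isotopy of `M` that is the identity outside `U` carries `L` to `L'`. -/
def AmbientIsotopicIn {M : OrientedThreeManifold} (U : Set M) (L L' : OrientedLink M) : Prop :=
  ∃ Φ : ℝ → Diffeomorph (𝓡∂ 3) (𝓡∂ 3) M M ∞,
    ContMDiff (𝓘(ℝ, ℝ).prod (𝓡∂ 3)) (𝓡∂ 3) ∞ (fun p : ℝ × M => Φ p.1 p.2) ∧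
    (∀ x, Φ 0 x = x) ∧ (∀ t x, x ∉ U → Φ t x = x) ∧
    L'.carrier = tangentMap (𝓡∂ 3) (𝓡∂ 3) (Φ 1) '' L.carrier

namespace AmbientIsotopicIn

variable {M : OrientedThreeManifold} {U : Set M} {L L' L'' : OrientedLink M}

theorem ambientIsotopic (h : AmbientIsotopicIn U L L') : AmbientIsotopic L L' := by
  obtain ⟨Φ, hs, h0, -, hL⟩ := h
  exact ⟨Φ, hs, h0, hL⟩

theorem of_eq (h : L.carrier = L'.carrier) : AmbientIsotopicIn U L L' := by
  obtain rfl : L = L' := OrientedLink.ext h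
  refine ⟨fun _ => Diffeomorph.refl _ _ _, contMDiff_snd, fun _ => rfl, fun _ _ _ => rfl, ?_⟩
  have : (⇑(Diffeomorph.refl (𝓡∂ 3) M ∞)) = id := rfl
  rw [this, tangentMap_id, Set.image_id]

theorem symm (h : AmbientIsotopicIn U L L') : AmbientIsotopicIn U L' L := by
  obtain ⟨Φ, hs, h0, hU, hL⟩ := h
  have hUs : ∀ x ∉ U, (Φ 1).symm x = x := fun x hx => by
    conv_lhs => rw [← hU 1 x hx]
    exact (Φ 1).symm_apply_apply x
  refine ⟨fun t => (Φ 1).symm.trans (Φ (1 - t)), ?_, ?_, ?_, ?_⟩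
  · have h1 : ContMDiff (𝓘(ℝ, ℝ).prod (𝓡∂ 3)) 𝓘(ℝ, ℝ) ∞ (fun p : ℝ × M => 1 - p.1) :=
      ContMDiff.comp (g := fun t : ℝ => 1 - t) (I' := 𝓘(ℝ, ℝ))
        (contMDiff_iff_contDiff.2 (contDiff_const.sub contDiff_id)) contMDiff_fst
    have h2 : ContMDiff (𝓘(ℝ, ℝ).prod (𝓡∂ 3)) (𝓡∂ 3) ∞
        (fun p : ℝ × M => (Φ 1).symm p.2) :=
      (Φ 1).symm.contMDiff.comp contMDiff_snd
    exact hs.comp (h1.prodMk h2)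
  · intro x
    simp
  · intro t x hx
    simp [hUs x hx, hU _ x hx]
  · have e : (⇑((Φ 1).symm.trans (Φ (1 - 1)))) = ⇑(Φ 1).symm := by
      funext x
      simp [h0]
    have hd : MDifferentiable (𝓡∂ 3) (𝓡∂ 3) (Φ 1) := (Φ 1).contMDiff.mdifferentiable (by simp)
    have hd' : MDifferentiable (𝓡∂ 3) (𝓡∂ 3) (Φ 1).symm :=
      (Φ 1).symm.contMDiff.mdifferentiable (by simp)
    have hid : (⇑(Φ 1).symm ∘ ⇑(Φ 1)) = id := by
      funext x
      simp
    rw [e, hL, ← Set.image_comp, ← tangentMap_comp hd' hd, hid, tangentMap_id, Set.image_id]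

theorem trans (h : AmbientIsotopicIn U L L') (h' : AmbientIsotopicIn U L' L'') :
    AmbientIsotopicIn U L L'' := by
  obtain ⟨Φ, hs, h0, hU, hL⟩ := h
  obtain ⟨Ψ, hs', h0', hU', hL'⟩ := h'
  refine ⟨fun t => (Φ t).trans (Ψ t), ?_, ?_, ?_, ?_⟩
  · exact hs'.comp (contMDiff_fst.prodMk hs)
  · intro x
    simp [h0, h0']
  · intro t x hx
    simp [hU t x hx, hU' t x hx]
  · have hd : MDifferentiable (𝓡∂ 3) (𝓡∂ 3) (Φ 1) := (Φ 1).contMDiff.mdifferentiable (by simp)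
    have hd' : MDifferentiable (𝓡∂ 3) (𝓡∂ 3) (Ψ 1) := (Ψ 1).contMDiff.mdifferentiable (by simp)
    have e : (⇑((Φ 1).trans (Ψ 1))) = ⇑(Ψ 1) ∘ ⇑(Φ 1) := rfl
    rw [e, hL', hL, ← Set.image_comp, ← tangentMap_comp hd' hd]

/-- Isotopy extension: a smooth family of injective immersions, defined near a link, moves the link
by an ambient isotopy, which is supported in any given neighbourhood of the track of the link. -/
theorem of_family {N : OrientedThreeManifold} (L : OrientedLink N) {F : ℝ → N → M}
    {O : Set (ℝ × N)} (hO : IsOpen O)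
    (hF : ContMDiffOn (𝓘(ℝ, ℝ).prod (𝓡∂ 3)) (𝓡∂ 3) ∞ (fun p : ℝ × N => F p.1 p.2) O)
    (hinj : ∀ t ∈ Icc (0 : ℝ) 1, InjOn (F t) {y | (t, y) ∈ O})
    (himm : ∀ t ∈ Icc (0 : ℝ) 1, ∀ y, (t, y) ∈ O →
      Injective (mfderiv (𝓡∂ 3) (𝓡∂ 3) (F t) y))
    (hL : ∀ t ∈ Icc (0 : ℝ) 1, ∀ y ∈ L.support, (t, y) ∈ O) (hU : IsOpen U)
    (hLU : ∀ t ∈ Icc (0 : ℝ) 1, ∀ y ∈ L.support, F t y ∈ U) {L₀ L₁ : OrientedLink M}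
    (h₀ : L₀.carrier = tangentMap (𝓡∂ 3) (𝓡∂ 3) (F 0) '' L.carrier)
    (h₁ : L₁.carrier = tangentMap (𝓡∂ 3) (𝓡∂ 3) (F 1) '' L.carrier) :
    AmbientIsotopicIn U L₀ L₁ := by
  rcases isEmpty_or_nonempty N with hN | hN
  · have hE : IsEmpty (TangentBundle (𝓡∂ 3) N) := ⟨fun p => hN.false p.proj⟩
    refine of_eq ?_
    rw [h₀, h₁, eq_empty_of_isEmpty L.carrier, image_empty, image_empty]
  have hslice : ∀ t : ℝ, IsOpen {y | (t, y) ∈ O} := fun t => hO.preimage (by fun_prop)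
  have hFt : ∀ t, ContMDiffOn (𝓡∂ 3) (𝓡∂ 3) ∞ (F t) {y | (t, y) ∈ O} := fun t y hy =>
    (ContMDiffAt.comp y (g := fun p : ℝ × N => F p.1 p.2) (f := fun z => (t, z))
      (hF.contMDiffAt (hO.mem_nhds hy))
      (contMDiffAt_const.prodMk contMDiffAt_id)).contMDiffWithinAt
  have hex : ∀ t ∈ Icc (0 : ℝ) 1, ∃ A : OrientedLink M,
      A.carrier = tangentMap (𝓡∂ 3) (𝓡∂ 3) (F t) '' L.carrier := fun t ht =>
    L.exists_map (hslice t) (hFt t) (hinj t ht) (himm t ht) (hL t ht)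
  -- Ambient isotopy inside `U` is symmetric and transitive, so by connectedness of the interval it
  -- suffices to compare each time with nearby times.
  refine isPreconnected_Icc.induction₂ (s := Icc (0 : ℝ) 1)
    (fun t t' => ∀ A A' : OrientedLink M,
      A.carrier = tangentMap (𝓡∂ 3) (𝓡∂ 3) (F t) '' L.carrier →
      A'.carrier = tangentMap (𝓡∂ 3) (𝓡∂ 3) (F t') '' L.carrier → AmbientIsotopicIn U A A')
    ?_ ?_ ?_ (left_mem_Icc.2 zero_le_one) (right_mem_Icc.2 zero_le_one) L₀ L₁ h₀ h₁
  · intro t₀ ht₀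
    obtain ⟨A, hA⟩ := hex t₀ ht₀
    let Y₀ : Set N := {y | (t₀, y) ∈ O} ∩ (𝓡∂ 3).interior (N : Type _)
    have hY₀ : IsOpen Y₀ := (hslice t₀).inter (isOpen_interior_manifold N)
    have hLY : L.support ⊆ Y₀ := fun y hy => ⟨hL t₀ ht₀ y hy, L.support_subset_interior hy⟩
    -- With the smooth inverse `g` of `F t₀`, the maps `F (t₀ + s) ∘ g` are self-maps of part of `M`
    -- that start at the identity, as the short-time extension requires.
    obtain ⟨g, hVo, -, hg, hgF⟩ := exists_smooth_leftInverse_of_injOn (I := 𝓡∂ 3) (J := 𝓡∂ 3)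
      rfl hY₀ ((hFt t₀).mono inter_subset_left) inter_subset_right
      ((hinj t₀ ht₀).mono inter_subset_left) (fun y hy => himm t₀ ht₀ y hy.1)
    have hgp : ContMDiffOn (𝓘(ℝ, ℝ).prod (𝓡∂ 3)) (𝓘(ℝ, ℝ).prod (𝓡∂ 3)) ∞
        (fun p : ℝ × M => (t₀ + p.1, g p.2)) (univ ×ˢ (F t₀ '' Y₀)) := by
      have h1 : ContMDiff (𝓘(ℝ, ℝ).prod (𝓡∂ 3)) 𝓘(ℝ, ℝ) ∞ (fun p : ℝ × M => t₀ + p.1) :=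
        ContMDiff.comp (g := fun t : ℝ => t₀ + t) (I' := 𝓘(ℝ, ℝ))
          (contMDiff_iff_contDiff.2 (contDiff_const.add contDiff_id)) contMDiff_fst
      exact h1.contMDiffOn.prodMk
        (hg.comp contMDiffOn_snd fun p hp => hp.2)
    let O' : Set (ℝ × M) := (univ ×ˢ (F t₀ '' Y₀)) ∩ (fun p : ℝ × M => (t₀ + p.1, g p.2)) ⁻¹' O
    have hO' : IsOpen O' := hgp.continuousOn.isOpen_inter_preimage (isOpen_univ.prod hVo) hO
    have hsupp : A.support = F t₀ '' L.support := OrientedLink.support_eq_image hA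
    obtain ⟨δ, hδ, hδ'⟩ := exists_isotopy_eventuallyEq (I := 𝓡∂ 3)
      (G := fun s x => F (t₀ + s) (g x)) hO'
      (hF.comp (hgp.mono inter_subset_left) fun p hp => hp.2)
      (by
        rintro _ ⟨⟨-, ⟨y, hy, rfl⟩⟩, -⟩
        simp [hgF y hy])
      A.isCompact_support A.support_subset_interior
      (by
        rw [hsupp]
        rintro _ ⟨y, hy, rfl⟩
        refine ⟨⟨mem_univ _, mem_image_of_mem _ (hLY hy)⟩, ?_⟩
        simp only [mem_preimage, add_zero, hgF y (hLY hy)]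
        exact hL t₀ ht₀ y hy)
      hU
      (by
        rw [hsupp]
        rintro _ ⟨y, hy, rfl⟩
        exact hLU t₀ ht₀ y hy)
    have hnear : ∀ᶠ t in 𝓝[Icc 0 1] t₀, |t - t₀| < δ :=
      mem_nhdsWithin_of_mem_nhds (Metric.ball_mem_nhds t₀ hδ)
    filter_upwards [hnear, self_mem_nhdsWithin] with t ht htI B B' hB hB'
    obtain rfl : B = A := OrientedLink.ext (hB.trans hA.symm)
    obtain ⟨Φ, hΦs, hΦ0, hΦU, hΦG⟩ := hδ' (t - t₀) ht
    refine ⟨Φ, hΦs, hΦ0, hΦU, ?_⟩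
    rw [hB', hB, image_image]
    refine image_congr fun p hp => ?_
    have hpL := OrientedLink.mem_support_of_mem hp
    have hpY := hLY hpL
    have hpd : MDifferentiableAt (𝓡∂ 3) (𝓡∂ 3) (F t₀) p.proj :=
      ((hFt t₀).contMDiffAt ((hslice t₀).mem_nhds hpY.1)).mdifferentiableAt (by simp)
    have h1 : tangentMap (𝓡∂ 3) (𝓡∂ 3) (Φ 1 ∘ F t₀) p =
        tangentMap (𝓡∂ 3) (𝓡∂ 3) (Φ 1) (tangentMap (𝓡∂ 3) (𝓡∂ 3) (F t₀) p) :=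
      tangentMap_comp_at p ((Φ 1).contMDiff.mdifferentiable (by simp) _) hpd
    rw [← h1]
    refine tangentMap_congr_of_eventuallyEq ?_
    have h2 : ∀ᶠ y in 𝓝 p.proj, Φ 1 (F t₀ y) = F (t₀ + (t - t₀)) (g (F t₀ y)) :=
      hpd.continuousAt.eventually (hΦG _ (hsupp ▸ mem_image_of_mem _ hpL))
    filter_upwards [h2, hY₀.mem_nhds hpY] with y hy hyY
    rw [comp_apply, hy, hgF y hyY, add_sub_cancel]
  · intro t t' t'' _ ht' _ h h' A A'' hA hA''
    obtain ⟨A', hA'⟩ := hex t' ht'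
    exact (h A A' hA hA').trans (h' A' A'' hA' hA'')
  · intro t t' _ _ h A A' hA hA'
    exact (h A' A hA' hA).symm

end AmbientIsotopicIn

/-! ### Orientations, and skein families under embeddings -/

section Orientation

variable {V W Z : Type*} [AddCommGroup V] [Module ℝ V] [AddCommGroup W] [Module ℝ W]
  [AddCommGroup Z] [Module ℝ Z]

theorem map_trans_orientation (e : V ≃ₗ[ℝ] W) (e' : W ≃ₗ[ℝ] Z)
    (o : Orientation ℝ V (Fin 3)) :
    Orientation.map (Fin 3) (e.trans e') o =
      Orientation.map (Fin 3) e' (Orientation.map (Fin 3) e o) := by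
  induction o using Module.Ray.ind with
  | h v hv =>
    rw [Orientation.map_apply, Orientation.map_apply, Orientation.map_apply]
    rfl

theorem CarriesOrientation.comp {A : V →ₗ[ℝ] W} {B : W →ₗ[ℝ] Z} {o : Orientation ℝ V (Fin 3)}
    {o' : Orientation ℝ W (Fin 3)} {o'' : Orientation ℝ Z (Fin 3)}
    (hB : CarriesOrientation B o' o'') (hA : CarriesOrientation A o o') :
    CarriesOrientation (B ∘ₗ A) o o'' := by
  obtain ⟨e, rfl, rfl⟩ := hA
  obtain ⟨e', rfl, rfl⟩ := hB
  exact ⟨e.trans e', rfl, map_trans_orientation e e' o⟩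

theorem CarriesOrientation.injective {A : V →ₗ[ℝ] W} {o : Orientation ℝ V (Fin 3)}
    {o' : Orientation ℝ W (Fin 3)} (hA : CarriesOrientation A o o') : Injective A := by
  obtain ⟨e, rfl, -⟩ := hA
  exact e.injective

/-- If `B` is a left inverse of an orientation preserving isomorphism `A`, then `B` preserves the
orientation. -/
theorem CarriesOrientation.of_comp_left {A : V →ₗ[ℝ] W} {B : W →ₗ[ℝ] Z}
    {o : Orientation ℝ V (Fin 3)} {o' : Orientation ℝ W (Fin 3)} {o'' : Orientation ℝ Z (Fin 3)}
    (hA : CarriesOrientation A o o') (hBA : CarriesOrientation (B ∘ₗ A) o o'') :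
    CarriesOrientation B o' o'' := by
  obtain ⟨e, rfl, rfl⟩ := hA
  obtain ⟨e', he', rfl⟩ := hBA
  refine ⟨e.symm.trans e', ?_, ?_⟩
  · ext w
    have := LinearMap.congr_fun he' (e.symm w)
    simpa using this
  · have : e.trans (e.symm.trans e') = e' := LinearEquiv.ext fun v => by simp
    rw [← map_trans_orientation, this]

end Orientation

/-- An injective immersion of a Euclidean space into a manifold of the same dimension is an open
embedding. -/
theorem isOpenEmbedding_of_immersion {E : Type*} [NormedAddCommGroup E] [NormedSpace ℝ E]
    [FiniteDimensional ℝ E] (hdim : Module.finrank ℝ E = 3) {N : OrientedThreeManifold}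
    {c : E → N} (hc : ContMDiff 𝓘(ℝ, E) (𝓡∂ 3) ∞ c) (hinj : Injective c)
    (himm : ∀ x, Injective (mfderiv 𝓘(ℝ, E) (𝓡∂ 3) c x)) : Topology.IsOpenEmbedding c := by
  refine .of_continuous_injective_isOpenMap hc.continuous hinj fun W hW => ?_
  obtain ⟨g, hg, -⟩ := exists_smooth_leftInverse_of_injOn (I := 𝓘(ℝ, E)) (J := 𝓡∂ 3)
    (by rw [hdim]; simp) hW hc.contMDiffOn
    (fun x _ => ModelWithCorners.interior_eq_univ (I := 𝓘(ℝ, E)) (M := E) ▸ mem_univ x)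
    hinj.injOn (fun x _ => himm x)
  exact hg

/-- The links `L i` form a skein family with respect to the parametrized ball `b`. -/
structure IsSkeinFamilyIn {M : OrientedThreeManifold} {k : ℕ} (b : E3 → M)
    (L : Fin k → OrientedLink M) : Prop where
  contMDiff : ContMDiff 𝓘(ℝ, E3) (𝓡∂ 3) ∞ b
  isEmbedding : Topology.IsEmbedding b
  orientation : ∀ x, CarriesOrientation (V := E3)
      (mfderiv 𝓘(ℝ, E3) (𝓡∂ 3) b x).toLinearMap stdOrientation (M.orient (b x))
  interior : ∀ x, b x ∈ (𝓡∂ 3).interior (M : Type _)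
  inside : ∀ i, ∀ p : TangentBundle (𝓡∂ 3) M, p.proj ∈ b '' Metric.closedBall 0 1 →
      (p ∈ (L i).carrier ↔
        p ∈ tangentMap 𝓘(ℝ, E3) (𝓡∂ 3) b '' twistTangle ((i : ℕ) - 1 : ℤ))
  outside : ∀ i j, ∀ p : TangentBundle (𝓡∂ 3) M, p.proj ∉ b '' Metric.closedBall 0 1 →
      (p ∈ (L i).carrier ↔ p ∈ (L j).carrier)

theorem isSkeinFamily_iff {M : OrientedThreeManifold} {k : ℕ} {L : Fin k → OrientedLink M} :
    IsSkeinFamily L ↔ ∃ b : E3 → M, IsSkeinFamilyIn b L :=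
  ⟨fun ⟨b, h1, h2, h3, h4, h5, h6⟩ => ⟨b, h1, h2, h3, h4, h5, h6⟩,
    fun ⟨b, h1, h2, h3, h4, h5, h6⟩ => ⟨b, h1, h2, h3, h4, h5, h6⟩⟩

/-- An orientation preserving injective map, defined near the links and the ball, carries skein
families to skein families. -/
theorem IsSkeinFamilyIn.map {M N : OrientedThreeManifold} {k : ℕ} {b : E3 → M}
    {L : Fin k → OrientedLink M} (h : IsSkeinFamilyIn b L) {g : M → N} {U : Set M}
    (hU : IsOpen U) (hg : ContMDiffOn (𝓡∂ 3) (𝓡∂ 3) ∞ g U) (hinj : InjOn g U)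
    (hor : ∀ x ∈ U, CarriesOrientation
      (mfderiv (𝓡∂ 3) (𝓡∂ 3) g x).toLinearMap (M.orient x) (N.orient (g x)))
    (hb : ∀ x, b x ∈ U) (hLU : ∀ i, (L i).support ⊆ U) {L' : Fin k → OrientedLink N}
    (hL' : ∀ i, (L' i).carrier = tangentMap (𝓡∂ 3) (𝓡∂ 3) g '' (L i).carrier) :
    IsSkeinFamilyIn (fun x => g (b x)) L' := by
  have hgat : ∀ x ∈ U, ContMDiffAt (𝓡∂ 3) (𝓡∂ 3) ∞ g x := fun x hx =>
    hg.contMDiffAt (hU.mem_nhds hx)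
  have hgd : ∀ x ∈ U, MDifferentiableAt (𝓡∂ 3) (𝓡∂ 3) g x := fun x hx =>
    (hgat x hx).mdifferentiableAt (by simp)
  have hbd : ∀ x, MDifferentiableAt 𝓘(ℝ, E3) (𝓡∂ 3) b x := fun x =>
    (h.contMDiff x).mdifferentiableAt (by simp)
  have hsm : ContMDiff 𝓘(ℝ, E3) (𝓡∂ 3) ∞ (fun x => g (b x)) := fun x =>
    ContMDiffAt.comp x (hgat _ (hb x)) (h.contMDiff x)
  have hori : ∀ x, CarriesOrientation (V := E3)
      (mfderiv 𝓘(ℝ, E3) (𝓡∂ 3) (fun x => g (b x)) x).toLinearMap stdOrientation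
        (N.orient (g (b x))) := fun x => by
    have : mfderiv 𝓘(ℝ, E3) (𝓡∂ 3) (fun x => g (b x)) x =
        (mfderiv (𝓡∂ 3) (𝓡∂ 3) g (b x)).comp (mfderiv 𝓘(ℝ, E3) (𝓡∂ 3) b x) :=
      mfderiv_comp x (hgd _ (hb x)) (hbd x)
    rw [this]
    exact (hor _ (hb x)).comp (h.orientation x)
  have hinjb : Injective fun x => g (b x) := fun x y hxy =>
    h.isEmbedding.injective (hinj (hb x) (hb y) hxy)
  have htan : ∀ p : TangentBundle 𝓘(ℝ, E3) E3,
      tangentMap 𝓘(ℝ, E3) (𝓡∂ 3) (fun x => g (b x)) p =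
        tangentMap (𝓡∂ 3) (𝓡∂ 3) g (tangentMap 𝓘(ℝ, E3) (𝓡∂ 3) b p) := fun p =>
    tangentMap_comp_at (I' := 𝓡∂ 3) (g := g) (f := b) p (hgd _ (hb _)) (hbd _)
  have hsupp : ∀ i, ∀ q ∈ (L i).carrier, q.proj ∈ U := fun i q hq =>
    hLU i (OrientedLink.mem_support_of_mem hq)
  refine ⟨hsm, (isOpenEmbedding_of_immersion (by simp) hsm hinjb
    fun x => (hori x).injective).isEmbedding, hori, fun x => ?_, ?_, ?_⟩
  · exact (hgd _ (hb x)).isInteriorPoint_of_surjective_mfderiv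
      (surjective_mfderiv_of_injective rfl (hor _ (hb x)).injective) (h.interior x)
  · intro i p hp
    rw [hL' i]
    constructor
    · rintro ⟨q, hq, rfl⟩
      obtain ⟨x, hx, hxq⟩ := hp
      have hqx : b x = q.proj := hinj (hb x) (hsupp i q hq) hxq
      obtain ⟨r, hr, rfl⟩ := (h.inside i q ⟨x, hx, hqx⟩).1 hq
      exact ⟨r, hr, htan r⟩
    · rintro ⟨r, hr, rfl⟩
      obtain ⟨x, hx, hxr⟩ := hp
      have hxr' : x = r.proj := hinjb hxr
      refine ⟨tangentMap 𝓘(ℝ, E3) (𝓡∂ 3) b r, ?_, (htan r).symm⟩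
      exact (h.inside i _ ⟨x, hx, congrArg b hxr'⟩).2 ⟨r, hr, rfl⟩
  · have key : ∀ i j, ∀ p : TangentBundle (𝓡∂ 3) N,
        p.proj ∉ (fun x => g (b x)) '' Metric.closedBall 0 1 →
        p ∈ (L' i).carrier → p ∈ (L' j).carrier := by
      intro i j p hp hpi
      rw [hL'] at hpi ⊢
      obtain ⟨q, hq, rfl⟩ := hpi
      refine ⟨q, (h.outside i j q ?_).1 hq, rfl⟩
      rintro ⟨x, hx, hxq⟩
      exact hp ⟨x, hx, congrArg g hxq⟩
    exact fun i j p hp => ⟨key i j p hp, key j i p hp⟩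

/-! ### Action of embeddings on links, isotopies and skein families -/

namespace OrientedEmbedding

variable {M N : OrientedThreeManifold} (f : OrientedEmbedding M N)

/-- The image of a link under an embedding. -/
def mapLink (L : OrientedLink M) : OrientedLink N where
  carrier := tangentMap (𝓡∂ 3) (𝓡∂ 3) f.toFun '' L.carrier
  exists_param := by
    obtain ⟨L', hL'⟩ := L.exists_map isOpen_univ f.isSmoothEmb.contMDiff.contMDiffOn
      f.isSmoothEmb.isEmbedding.injective.injOn (fun x _ => f.isSmoothEmb.immersion x)
      (subset_univ _)
    rw [← hL']
    exact L'.exists_param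

theorem mapLink_carrier (L : OrientedLink M) :
    (f.mapLink L).carrier = tangentMap (𝓡∂ 3) (𝓡∂ 3) f.toFun '' L.carrier := rfl

theorem isSkeinFamily_mapLink {k : ℕ} {L : Fin k → OrientedLink M} (h : IsSkeinFamily L) :
    IsSkeinFamily fun i => f.mapLink (L i) := by
  obtain ⟨b, hb⟩ := isSkeinFamily_iff.1 h
  exact isSkeinFamily_iff.2 ⟨_, hb.map isOpen_univ f.isSmoothEmb.contMDiff.contMDiffOn
    f.isSmoothEmb.isEmbedding.injective.injOn (fun x _ => f.orientation_preserving x)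
    (fun x => mem_univ _) (fun i => subset_univ _) fun i => rfl⟩

/-- An isotopy of embeddings need not extend to an ambient isotopy when `M` is not compact, but
isotopy extension along the compact link suffices. -/
theorem ambientIsotopic_of_isotopic {f g : OrientedEmbedding M N}
    (h : IsotopicEmbeddings f.toFun g.toFun) (L : OrientedLink M) :
    AmbientIsotopic (f.mapLink L) (g.mapLink L) := by
  obtain ⟨F, hF, hemb, h0, h1⟩ := h
  refine (AmbientIsotopicIn.of_family (U := univ) (F := F) L isOpen_univ hF.contMDiffOn
    (fun t ht => (hemb t ht).isEmbedding.injective.injOn)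
    (fun t ht y _ => (hemb t ht).immersion y) (fun _ _ _ _ => mem_univ _) isOpen_univ
    (fun _ _ _ _ => mem_univ _) ?_ ?_).ambientIsotopic
  · rw [h0, mapLink_carrier]
  · rw [h1, mapLink_carrier]

theorem _root_.Skein.mdifferentiable_diffeomorph
    (Φ : Diffeomorph (𝓡∂ 3) (𝓡∂ 3) M M ∞) : MDifferentiable (𝓡∂ 3) (𝓡∂ 3) Φ :=
  Φ.contMDiff.mdifferentiable (by simp)

theorem _root_.Skein.injective_mfderiv_diffeomorph
    (Φ : Diffeomorph (𝓡∂ 3) (𝓡∂ 3) M M ∞) (x : M) :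
    Injective (mfderiv (𝓡∂ 3) (𝓡∂ 3) Φ x) :=
  (Φ.mfderivToContinuousLinearEquiv (by simp) x).injective

/-- An ambient isotopy of the source gives an ambient isotopy of the images of links, supported in
the image of the interior. -/
theorem ambientIsotopicIn_mapLink {L L' : OrientedLink M} (h : AmbientIsotopic L L')
    {U : Set N} (hU : IsOpen U) (hfU : f.toFun '' (𝓡∂ 3).interior (M : Type _) ⊆ U) :
    AmbientIsotopicIn U (f.mapLink L) (f.mapLink L') := by
  obtain ⟨Φ, hs, h0, hL⟩ := h
  have hfd : MDifferentiable (𝓡∂ 3) (𝓡∂ 3) f.toFun :=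
    f.isSmoothEmb.contMDiff.mdifferentiable (by simp)
  refine AmbientIsotopicIn.of_family (F := fun t x => f.toFun (Φ t x)) L isOpen_univ
    (f.isSmoothEmb.contMDiff.comp hs).contMDiffOn
    (fun t _ => (f.isSmoothEmb.isEmbedding.injective.comp (Φ t).injective).injOn)
    (fun t _ y _ => ?_) (fun _ _ _ _ => mem_univ _) hU (fun t _ y hy => ?_) ?_ ?_
  · have : mfderiv (𝓡∂ 3) (𝓡∂ 3) (fun x => f.toFun (Φ t x)) y =
        (mfderiv (𝓡∂ 3) (𝓡∂ 3) f.toFun (Φ t y)).comp (mfderiv (𝓡∂ 3) (𝓡∂ 3) (Φ t) y) :=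
      mfderiv_comp y (hfd _) (mdifferentiable_diffeomorph (Φ t) y)
    rw [this]
    exact (f.isSmoothEmb.immersion _).comp (injective_mfderiv_diffeomorph (Φ t) y)
  · refine hfU (mem_image_of_mem _ ?_)
    exact (mdifferentiable_diffeomorph (Φ t) y).isInteriorPoint_of_surjective_mfderiv
      (surjective_mfderiv_of_injective rfl (injective_mfderiv_diffeomorph (Φ t) y))
      (L.support_subset_interior hy)
  · have : (fun x => f.toFun (Φ 0 x)) = f.toFun := funext fun x => by rw [h0]
    rw [this, mapLink_carrier]
  · have : (fun x => f.toFun (Φ 1 x)) = f.toFun ∘ Φ 1 := rfl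
    rw [this, tangentMap_comp hfd (mdifferentiable_diffeomorph (Φ 1)), image_comp, ← hL,
      mapLink_carrier]

end OrientedEmbedding

/-! ### Linear maps out of skein modules; functoriality and isotopy invariance -/

section Induced

variable {allowEmpty : Prop} {M N : OrientedThreeManifold} {R : Type*} [CommRing R] {k : ℕ}
  {r : Fin k → R}

theorem linkClass_eq_of_ambientIsotopic {L L' : Link allowEmpty M}
    (h : AmbientIsotopic L.1 L'.1) :
    linkClass allowEmpty r L = linkClass allowEmpty r L' := by
  have : Quotient.mk (linkSetoid allowEmpty M) L = Quotient.mk (linkSetoid allowEmpty M) L' :=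
    Quotient.sound h
  rw [linkClass, linkClass, this]

/-- Linear maps on a skein module are determined by their values on links. -/
theorem skeinModule_linearMap_ext {P : Type*} [AddCommGroup P] [Module R P]
    {F G : SkeinModule allowEmpty M r →ₗ[R] P}
    (h : ∀ L, F (linkClass allowEmpty r L) = G (linkClass allowEmpty r L)) : F = G := by
  refine Submodule.linearMap_qext _ (Finsupp.lhom_ext' fun c => LinearMap.ext_ring ?_)
  induction c using Quotient.inductionOn with
  | h L => exact h L

/-- The ambient isotopy class of a link. -/
def LinkClass.mk (L : Link allowEmpty M) : LinkClass allowEmpty M :=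
  Quotient.mk (linkSetoid allowEmpty M) L

/-- The image of an admissible link under an embedding. -/
def OrientedEmbedding.mapAdmissible (f : OrientedEmbedding M N) (L : Link allowEmpty M) :
    Link allowEmpty N :=
  ⟨f.mapLink L.1, L.2.imp id fun h => h.image _⟩

theorem linkClass_eq_mk (L : Link allowEmpty M) : linkClass allowEmpty r L =
    Submodule.Quotient.mk (Finsupp.single (LinkClass.mk L) 1) := rfl

/-- The skein relation. -/
theorem sum_smul_linkClass_eq_zero {L : Fin k → Link allowEmpty M}
    (hL : IsSkeinFamily fun i => (L i).1) : ∑ i, r i • linkClass allowEmpty r (L i) = 0 := by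
  have h : (∑ i, Finsupp.single (LinkClass.mk (L i)) (r i) : LinkClass allowEmpty M →₀ R) ∈
      skeinSubmodule allowEmpty M r := Submodule.subset_span ⟨L, hL, rfl⟩
  rw [← Submodule.Quotient.mk_eq_zero, ← Submodule.mkQ_apply, map_sum] at h
  rw [← h]
  refine Finset.sum_congr rfl fun i _ => ?_
  rw [linkClass_eq_mk, ← Submodule.mkQ_apply, ← map_smul, Finsupp.smul_single, smul_eq_mul,
    mul_one]

/-- Linear maps on a skein module are given by isotopy invariants of links that satisfy the skein
relations. -/
theorem exists_skeinModule_lift {P : Type*} [AddCommGroup P] [Module R P]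
    (φ : Link allowEmpty M → P)
    (hφ : ∀ L L' : Link allowEmpty M, AmbientIsotopic L.1 L'.1 → φ L = φ L')
    (hrel : ∀ L : Fin k → Link allowEmpty M, IsSkeinFamily (fun i => (L i).1) →
      ∑ i, r i • φ (L i) = 0) :
    ∃ F : SkeinModule allowEmpty M r →ₗ[R] P, ∀ L, F (linkClass allowEmpty r L) = φ L := by
  let ψ : LinkClass allowEmpty M → P := Quotient.lift φ hφ
  have hψ : ∀ L, ψ (LinkClass.mk L) = φ L := fun L => rfl
  let F₀ : (LinkClass allowEmpty M →₀ R) →ₗ[R] P := Finsupp.linearCombination R ψ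
  have hle : skeinSubmodule allowEmpty M r ≤ LinearMap.ker F₀ := by
    refine Submodule.span_le.2 ?_
    rintro _ ⟨L, hL, rfl⟩
    change F₀ (∑ i, Finsupp.single (LinkClass.mk (L i)) (r i)) = 0
    rw [map_sum, ← hrel L hL]
    refine Finset.sum_congr rfl fun i _ => ?_
    rw [Finsupp.linearCombination_single, hψ]
  refine ⟨Submodule.liftQ _ F₀ hle, fun L => ?_⟩
  rw [linkClass_eq_mk, Submodule.liftQ_apply, Finsupp.linearCombination_single, one_smul, hψ]

theorem IsInduced.apply_linkClass {f : OrientedEmbedding M N}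
    {F : SkeinModule allowEmpty M r →ₗ[R] SkeinModule allowEmpty N r}
    (hF : IsInduced allowEmpty r f.toFun F) (L : Link allowEmpty M) :
    F (linkClass allowEmpty r L) = linkClass allowEmpty r (f.mapAdmissible L) := by
  obtain ⟨L', hL', h⟩ := hF L
  rw [h]
  congr 1
  exact Subtype.ext (OrientedLink.ext hL')

/-- Images of isotopic links are isotopic by isotopy extension, since an ambient isotopy of `M`
itself may not extend over `N`. Images of skein families are skein families, and uniqueness holds
because links generate. -/
theorem existsUnique_isInduced (f : OrientedEmbedding M N) :
    ∃! F : SkeinModule allowEmpty M r →ₗ[R] SkeinModule allowEmpty N r,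
      IsInduced allowEmpty r f.toFun F := by
  obtain ⟨F, hF⟩ := exists_skeinModule_lift (r := r)
    (fun L : Link allowEmpty M => linkClass allowEmpty r (f.mapAdmissible L))
    (fun L L' h => linkClass_eq_of_ambientIsotopic
      (f.ambientIsotopicIn_mapLink h isOpen_univ (subset_univ _)).ambientIsotopic)
    (fun L hL => sum_smul_linkClass_eq_zero (f.isSkeinFamily_mapLink hL))
  refine ⟨F, fun L => ⟨f.mapAdmissible L, rfl, hF L⟩, ?_⟩
  intro G hG
  refine skeinModule_linearMap_ext fun L => ?_
  rw [hG.apply_linkClass, hF]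

theorem isInduced_eq_of_isotopic {f g : OrientedEmbedding M N}
    (h : IsotopicEmbeddings f.toFun g.toFun)
    {F G : SkeinModule allowEmpty M r →ₗ[R] SkeinModule allowEmpty N r}
    (hF : IsInduced allowEmpty r f.toFun F) (hG : IsInduced allowEmpty r g.toFun G) : F = G := by
  refine skeinModule_linearMap_ext fun L => ?_
  rw [hF.apply_linkClass, hG.apply_linkClass]
  exact linkClass_eq_of_ambientIsotopic
    (OrientedEmbedding.ambientIsotopic_of_isotopic h L.1)

end Induced

/-! ### Ambient isotopies supported in an embedded cell -/

/-- `Φ` is a smooth ambient isotopy of `N`, starting at the identity. -/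
structure IsAmbientIsotopy {N : OrientedThreeManifold}
    (Φ : ℝ → Diffeomorph (𝓡∂ 3) (𝓡∂ 3) N N ∞) : Prop where
  contMDiff : ContMDiff (𝓘(ℝ, ℝ).prod (𝓡∂ 3)) (𝓡∂ 3) ∞ (fun p : ℝ × N => Φ p.1 p.2)
  zero : ∀ x, Φ 0 x = x

namespace IsAmbientIsotopy

variable {N : OrientedThreeManifold} {Φ Ψ : ℝ → Diffeomorph (𝓡∂ 3) (𝓡∂ 3) N N ∞}

theorem refl (N : OrientedThreeManifold) :
    IsAmbientIsotopy (N := N) fun _ => Diffeomorph.refl _ _ _ :=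
  ⟨contMDiff_snd, fun _ => rfl⟩

theorem trans (h : IsAmbientIsotopy Φ) (h' : IsAmbientIsotopy Ψ) :
    IsAmbientIsotopy fun t => (Φ t).trans (Ψ t) :=
  ⟨h'.contMDiff.comp (contMDiff_fst.prodMk h.contMDiff), fun x => by simp [h.zero, h'.zero]⟩

end IsAmbientIsotopy

section Displacement

variable {E : Type*} [NormedAddCommGroup E] [NormedSpace ℝ E] [FiniteDimensional ℝ E]

/-- A compactly supported vector field in an embedded open set of a vector space displaces the
points of this set for short times by an ambient isotopy. -/
theorem exists_isotopy_displacement (hdim : Module.finrank ℝ E = 3) {N : OrientedThreeManifold}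
    {c : E → N} {B : Set E} (hB : IsOpen B) (hc : ContMDiffOn 𝓘(ℝ, E) (𝓡∂ 3) ∞ c B)
    (hinj : InjOn c B) (himm : ∀ x ∈ B, Injective (mfderiv 𝓘(ℝ, E) (𝓡∂ 3) c x))
    {v : E → E} (hv : ContDiff ℝ ∞ v) {K : Set E} (hK : IsCompact K) (hKB : K ⊆ B)
    (hvK : ∀ x ∉ K, v x = 0) :
    ∃ δ > 0, ∀ τ, |τ| < δ → ∃ Φ : ℝ → Diffeomorph (𝓡∂ 3) (𝓡∂ 3) N N ∞, IsAmbientIsotopy Φ ∧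
      (∀ t, ∀ x ∈ B, x + (τ * Real.smoothTransition t) • v x ∈ B ∧
        Φ t (c x) = c (x + (τ * Real.smoothTransition t) • v x)) ∧
      ∀ t, ∀ y ∉ c '' B, Φ t y = y := by
  classical
  obtain ⟨g, hVo, hVi, hg, hgc⟩ := exists_smooth_leftInverse_of_injOn (I := 𝓘(ℝ, E)) (J := 𝓡∂ 3)
    (by rw [hdim]; simp) hB hc
    (fun x _ => ModelWithCorners.interior_eq_univ (I := 𝓘(ℝ, E)) (M := E) ▸ mem_univ x)
    hinj himm
  have hK' : IsCompact (c '' K) := hK.image_of_continuousOn (hc.continuousOn.mono hKB)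
  have hK'V : c '' K ⊆ c '' B := image_mono hKB
  have hev : ∀ᶠ s in 𝓝 (0 : ℝ), ∀ x ∈ K, x + s • v x ∈ B := by
    refine hK.eventually_forall_of_forall_eventually fun x hx => ?_
    have hcont : ContinuousAt (fun p : ℝ × E => p.2 + p.1 • v p.2) (0, x) :=
      (continuous_snd.add (continuous_fst.smul (hv.continuous.comp continuous_snd))).continuousAt
    refine hcont.eventually (hB.mem_nhds ?_)
    simpa using hKB hx
  obtain ⟨ε, hε, hεB⟩ := Metric.eventually_nhds_iff.1 hev
  have hεB' : ∀ s : ℝ, |s| < ε → ∀ x ∈ B, x + s • v x ∈ B := fun s hs x hx => by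
    by_cases hxK : x ∈ K
    · exact hεB (by rwa [Real.dist_eq, sub_zero]) x hxK
    · simpa [hvK x hxK] using hx
  -- In cell coordinates points move along straight lines; the compact support of `v` lets the
  -- family be continued by the identity.
  let Ψ : ℝ → N → N := fun s y => if y ∈ c '' B then c (g y + s • v (g y)) else y
  have hΨc : ∀ s, ∀ x ∈ B, Ψ s (c x) = c (x + s • v x) := fun s x hx => by
    simp only [Ψ, if_pos (mem_image_of_mem c hx), hgc x hx]
  have hΨn : ∀ s, ∀ y ∉ c '' B, Ψ s y = y := fun s y hy => by simp only [Ψ, if_neg hy]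
  have h0 : ∀ y, Ψ 0 y = y := fun y => by
    by_cases hy : y ∈ c '' B
    · obtain ⟨x, hx, rfl⟩ := hy
      simp [hΨc 0 x hx]
    · exact hΨn 0 y hy
  have hfix : ∀ s y, y ∉ c '' K → Ψ s y = y := fun s y hy => by
    by_cases hyB : y ∈ c '' B
    · obtain ⟨x, hx, rfl⟩ := hyB
      have : x ∉ K := fun h => hy (mem_image_of_mem c h)
      simp [hΨc s x hx, hvK x this]
    · exact hΨn s y hyB
  have hΨ : ContMDiffOn (𝓘(ℝ, ℝ).prod (𝓡∂ 3)) (𝓡∂ 3) ∞ (fun p : ℝ × N => Ψ p.1 p.2)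
      (Ioo (-ε) ε ×ˢ univ) := by
    rintro ⟨s, y⟩ ⟨hs, -⟩
    refine ContMDiffAt.contMDiffWithinAt ?_
    by_cases hy : y ∈ c '' B
    · have hg' : ContMDiffAt (𝓘(ℝ, ℝ).prod (𝓡∂ 3)) 𝓘(ℝ, E) ∞ (fun p : ℝ × N => g p.2) (s, y) :=
        ContMDiffAt.comp (s, y) (g := g) (hg.contMDiffAt (hVo.mem_nhds hy)) contMDiffAt_snd
      have hvg : ContMDiffAt (𝓘(ℝ, ℝ).prod (𝓡∂ 3)) 𝓘(ℝ, E) ∞ (fun p : ℝ × N => v (g p.2))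
          (s, y) := ContMDiffAt.comp (s, y) (g := v) hv.contMDiff.contMDiffAt hg'
      have hsum : ContMDiffAt (𝓘(ℝ, ℝ).prod (𝓡∂ 3)) 𝓘(ℝ, E) ∞
          (fun p : ℝ × N => g p.2 + p.1 • v (g p.2)) (s, y) :=
        hg'.add (contMDiffAt_fst.smul hvg)
      have hcat : ContMDiffAt 𝓘(ℝ, E) (𝓡∂ 3) ∞ c (g y + s • v (g y)) := by
        obtain ⟨x, hx, rfl⟩ := hy
        rw [hgc x hx]
        exact hc.contMDiffAt (hB.mem_nhds (hεB' s (abs_lt.2 hs) x hx))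
      refine (ContMDiffAt.comp (s, y) (g := c) (f := fun p : ℝ × N => g p.2 + p.1 • v (g p.2))
        hcat hsum).congr_of_eventuallyEq ?_
      filter_upwards [continuous_snd.continuousAt.eventually (hVo.mem_nhds hy)] with p hp
      exact if_pos hp
    · refine (contMDiffAt_snd (I := 𝓘(ℝ, ℝ)) (J := 𝓡∂ 3) (n := ∞)).congr_of_eventuallyEq ?_
      filter_upwards [continuous_snd.continuousAt.eventually
        (hK'.isClosed.isOpen_compl.mem_nhds fun h => hy (hK'V h))] with p hp
      exact hfix _ _ hp
  obtain ⟨δ, hδ, hall⟩ := exists_isotopy_of_small hK' (hK'V.trans hVi) hε hΨ h0 hfix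
  refine ⟨min δ ε, lt_min hδ hε, fun τ hτ => ?_⟩
  obtain ⟨Φ, hΦs, hΦ⟩ := hall τ (hτ.trans_le (min_le_left _ _))
  refine ⟨Φ, ⟨hΦs, fun x => ?_⟩, fun t x hx => ⟨hεB' _ ?_ x hx, ?_⟩, fun t y hy => ?_⟩
  · rw [hΦ, Real.smoothTransition.zero, mul_zero, h0]
  · rw [abs_mul, abs_of_nonneg (Real.smoothTransition.nonneg t)]
    exact lt_of_le_of_lt (mul_le_of_le_one_right (abs_nonneg τ)
      (Real.smoothTransition.le_one t)) (hτ.trans_le (min_le_right _ _))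
  · rw [hΦ, hΨc _ x hx]
  · rw [hΦ, hΨn _ y hy]

end Displacement

section RadialPush

variable {V W : Type*} [NormedAddCommGroup V] [NormedSpace ℝ V] [FiniteDimensional ℝ V]
  [NormedAddCommGroup W] [NormedSpace ℝ W] [FiniteDimensional ℝ W]

/-- Inside an embedded cell `V × W`, a set that keeps away from the axis `{p} × W` can be pushed out
of a concentric smaller ball by an ambient isotopy supported in the cell. -/
theorem exists_isotopy_radial (hdim : Module.finrank ℝ (V × W) = 3) {N : OrientedThreeManifold}
    {c : V × W → N} {B : Set (V × W)} (hB : IsOpen B)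
    (hc : ContMDiffOn 𝓘(ℝ, V × W) (𝓡∂ 3) ∞ c B) (hinj : InjOn c B)
    (himm : ∀ x ∈ B, Injective (mfderiv 𝓘(ℝ, V × W) (𝓡∂ 3) c x))
    {C : Set W} (hC : IsCompact C) {ρ : ℝ} (hρB : Metric.closedBall (0 : V) ρ ×ˢ C ⊆ B)
    {p : V} (hp : ‖p‖ ≤ ρ) {η : ℝ} (hη : 0 < η) :
    ∃ Φ : ℝ → Diffeomorph (𝓡∂ 3) (𝓡∂ 3) N N ∞, IsAmbientIsotopy Φ ∧
      (∀ t, ∀ y ∉ c '' B, Φ t y = y) ∧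
      ∀ x ∈ B, x.2 ∈ C → η ≤ ‖x.1 - p‖ →
        ∃ x' ∈ B, x'.2 ∈ C ∧ ρ < ‖x'.1‖ ∧ Φ 1 (c x) = c x' := by
  let D : Set (V × W) := Metric.closedBall (0 : V) ρ ×ˢ C
  have hD : IsCompact D := (isCompact_closedBall 0 ρ).prod hC
  obtain ⟨K, hK, hDK, hKB⟩ := exists_compact_between hD hB hρB
  obtain ⟨χ, hχ1, hχ0, hχ01⟩ := exists_contMDiffMap_one_nhds_of_subset_interior 𝓘(ℝ, V × W)
    (n := ⊤) hD.isClosed hDK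
  have hχD : ∀ x ∈ D, χ x = 1 := fun x hx => hχ1.self_of_nhdsSet x hx
  -- The field points radially away from `p` in the `V` factor and vanishes in the `W` factor, so
  -- the second coordinate, and with it membership in `C`, is preserved.
  let v : V × W → V × W := fun x => χ x • (x.1 - p, 0)
  have hχs : ContDiff ℝ ∞ χ := χ.contMDiff.contDiff
  have hv : ContDiff ℝ ∞ v :=
    hχs.smul ((contDiff_fst.sub contDiff_const).prodMk contDiff_const)
  obtain ⟨δ, hδ, hall⟩ := exists_isotopy_displacement hdim hB hc hinj himm hv hK hKB
    (fun x hx => by simp [v, hχ0 x hx])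
  obtain ⟨Φ, hΦ, hΦB, hΦn⟩ := hall (δ / 2) (by rw [abs_of_pos (by linarith)]; linarith)
  set τ := δ / 2 with hτ
  have hτ0 : 0 < τ := by positivity
  -- One short displacement multiplies the distance from `p` by `1 + τ` inside the ball of radius
  -- `ρ`, and never brings an outside point back in.
  have step : ∀ x ∈ B, x.2 ∈ C → ∃ x' ∈ B, x'.2 ∈ C ∧ Φ 1 (c x) = c x' ∧
      (ρ < ‖x.1‖ → ρ < ‖x'.1‖) ∧ (‖x.1‖ ≤ ρ → ‖x'.1 - p‖ = (1 + τ) * ‖x.1 - p‖) := by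
    intro x hx hxC
    obtain ⟨h1, h2⟩ := hΦB 1 x hx
    rw [Real.smoothTransition.one, mul_one] at h1 h2
    have e1 : (x + τ • v x).1 = x.1 + (τ * χ x) • (x.1 - p) := by simp [v, smul_smul]
    have e2 : (x + τ • v x).2 = x.2 := by simp [v]
    refine ⟨_, h1, e2 ▸ hxC, h2, fun hx1 => ?_, fun hx1 => ?_⟩
    -- If the displaced point were in the ball, `(1 + σ) • x.1`, its sum with `σ • p`, would have
    -- norm at most `(1 + σ) * ρ`. This is where `‖p‖ ≤ ρ` enters.
    · by_contra! hcon
      rw [e1] at hcon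
      set σ := τ * χ x with hσ
      have hσ0 : 0 ≤ σ := mul_nonneg hτ0.le (hχ01 x).1
      have h3 : (1 + σ) • x.1 = (x.1 + σ • (x.1 - p)) + σ • p := by
        rw [add_smul, one_smul, smul_sub]; abel
      have h4 : (1 + σ) * ‖x.1‖ ≤ (1 + σ) * ρ := by
        calc (1 + σ) * ‖x.1‖ = ‖(1 + σ) • x.1‖ := by
              rw [norm_smul, Real.norm_of_nonneg (by linarith)]
          _ ≤ ‖x.1 + σ • (x.1 - p)‖ + ‖σ • p‖ := h3 ▸ norm_add_le _ _
          _ ≤ ρ + σ * ρ := by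
              rw [norm_smul, Real.norm_of_nonneg hσ0]
              exact add_le_add hcon (mul_le_mul_of_nonneg_left hp hσ0)
          _ = (1 + σ) * ρ := by ring
      exact absurd (le_of_mul_le_mul_left h4 (by linarith)) (not_le.2 hx1)
    · have hxD : x ∈ D := ⟨by simpa using hx1, hxC⟩
      rw [e1, hχD x hxD, mul_one]
      have : x.1 + τ • (x.1 - p) - p = (1 + τ) • (x.1 - p) := by
        rw [add_smul, one_smul]; abel
      rw [this, norm_smul, Real.norm_of_nonneg (by linarith)]
  -- The displacement is a diffeomorphism only for short times, so a long push is obtained by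
  -- iteration.
  have iter : ∀ n : ℕ, ∃ Ψ : ℝ → Diffeomorph (𝓡∂ 3) (𝓡∂ 3) N N ∞, IsAmbientIsotopy Ψ ∧
      (∀ t, ∀ y ∉ c '' B, Ψ t y = y) ∧
      ∀ x ∈ B, x.2 ∈ C → ∃ x' ∈ B, x'.2 ∈ C ∧ Ψ 1 (c x) = c x' ∧
        (ρ < ‖x'.1‖ ∨ (1 + τ) ^ n * ‖x.1 - p‖ ≤ ‖x'.1 - p‖) := by
    intro n
    induction n with
    | zero =>
      exact ⟨_, IsAmbientIsotopy.refl N, fun _ _ _ => rfl, fun x hx hxC =>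
        ⟨x, hx, hxC, rfl, Or.inr (by simp)⟩⟩
    | succ n ih =>
      obtain ⟨Ψ, hΨ, hΨn, hΨx⟩ := ih
      refine ⟨_, hΨ.trans hΦ, fun t y hy => ?_, fun x hx hxC => ?_⟩
      · simp [hΨn t y hy, hΦn t y hy]
      · obtain ⟨x', hx', hx'C, hΨ', hor⟩ := hΨx x hx hxC
        obtain ⟨x'', hx'', hx''C, hΦ', hA, hA'⟩ := step x' hx' hx'C
        refine ⟨x'', hx'', hx''C, by simp [hΨ', hΦ'], ?_⟩
        rcases lt_or_ge ρ ‖x'.1‖ with h | h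
        · exact Or.inl (hA h)
        · refine Or.inr ?_
          rw [hA' h, pow_succ, mul_comm _ (1 + τ), mul_assoc]
          exact mul_le_mul_of_nonneg_left (hor.resolve_left (not_lt.2 h)) (by linarith)
  -- A point in the ball of radius `ρ` is at distance at most `ρ + ‖p‖` from `p`; enough steps
  -- expand the initial distance `η` beyond this bound.
  obtain ⟨n, hn⟩ := pow_unbounded_of_one_lt ((ρ + ‖p‖) / η) (by linarith : 1 < 1 + τ)
  obtain ⟨Ψ, hΨ, hΨn, hΨx⟩ := iter n
  refine ⟨Ψ, hΨ, hΨn, fun x hx hxC hxη => ?_⟩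
  obtain ⟨x', hx', hx'C, hΨ', hor⟩ := hΨx x hx hxC
  refine ⟨x', hx', hx'C, ?_, hΨ'⟩
  rcases hor with h | h
  · exact h
  · have h1 : ρ + ‖p‖ < (1 + τ) ^ n * η := (div_lt_iff₀ hη).1 hn
    have h2 : (1 + τ) ^ n * η ≤ (1 + τ) ^ n * ‖x.1 - p‖ :=
      mul_le_mul_of_nonneg_left hxη (by positivity)
    have h3 := norm_sub_le x'.1 p
    linarith

end RadialPush

/-! ### Embeddings near boundary points: shifts in the inward direction -/

/-- The first unit vector, which points into the half-space. -/
def inwardVector : E3 := EuclideanSpace.single 0 1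

/-- The reflection of the lower half-space into the upper one. -/
def foldHalfSpace (x : E3) : E3 := !₂[|x 0|, x 1, x 2]

/-- This is the reverse triangle inequality in the first coordinate. The constant one matters:
reflecting an error term across the boundary does not worsen its Lipschitz constant. -/
theorem lipschitzWith_foldHalfSpace : LipschitzWith 1 foldHalfSpace := by
  refine LipschitzWith.of_dist_le_mul fun x y => ?_
  rw [NNReal.coe_one, one_mul, EuclideanSpace.dist_eq, EuclideanSpace.dist_eq]
  refine Real.sqrt_le_sqrt ?_
  simp only [Fin.sum_univ_three, foldHalfSpace]
  have h : dist |x 0| |y 0| ≤ dist (x 0) (y 0) := by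
    rw [Real.dist_eq, Real.dist_eq]; exact abs_abs_sub_abs_le _ _
  have h' := pow_le_pow_left₀ dist_nonneg h 2
  simpa using h'

theorem foldHalfSpace_of_nonneg {x : E3} (hx : 0 ≤ x 0) : foldHalfSpace x = x := by
  ext i
  fin_cases i <;> simp [foldHalfSpace, abs_of_nonneg hx]

theorem foldHalfSpace_zero_nonneg (x : E3) : 0 ≤ foldHalfSpace x 0 := by
  simp [foldHalfSpace]

/-- A map of the half-space with invertible differential at a boundary point maps it, near this
point, onto a set that is closed under small shifts in the image of the inward direction. -/
theorem exists_shift_of_halfSpace {g : E3 → E3} {a : E3} (ha : a 0 = 0) (A : E3 ≃L[ℝ] E3)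
    (hg : ContDiffWithinAt ℝ 1 g {x | 0 ≤ x 0} a)
    (hA : HasFDerivWithinAt g (A : E3 →L[ℝ] E3) {x | 0 ≤ x 0} a) {T : Set E3}
    (hT : T ∈ 𝓝[{x : E3 | 0 ≤ x 0}] a) :
    ∃ r₀ > 0, ∃ r > 0, ∀ x₁ ∈ Metric.ball a r₀, 0 ≤ x₁ 0 → ∀ τ : ℝ, 0 < τ →
      g x₁ + τ • A inwardVector ∈ Metric.ball (g a) r →
      ∃ x₂ ∈ T, 0 < x₂ 0 ∧ g x₂ = g x₁ + τ • A inwardVector := by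
  set S : Set E3 := {x | 0 ≤ x 0} with hS
  have haS : a ∈ S := ha.ge
  have hconv : Convex ℝ S := EuclideanHalfSpace.convex
  have huniq : UniqueDiffWithinAt ℝ S a := by
    have := (𝓡∂ 3).uniqueDiffOn
    rw [range_modelWithCornersEuclideanHalfSpace] at this
    exact this a haS
  let Nn : ℝ≥0 := ‖(A.symm : E3 →L[ℝ] E3)‖₊
  have hNn : 0 < Nn := by

    rcases A.subsingleton_or_nnnorm_symm_pos with h | h
    · exact absurd h (not_subsingleton E3)
    · exact h
  -- Any constant below the inverse norm of `A⁻¹` makes the perturbed map locally surjective; the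
  -- extra factor `1/4` is used to show that the first coordinate grows.
  let c : ℝ≥0 := Nn⁻¹ / 4
  have hc0 : 0 < c := by positivity
  have hcN : c < Nn⁻¹ := by
    rw [← NNReal.coe_lt_coe]
    have h1 : (0 : ℝ) < ((Nn⁻¹ : ℝ≥0) : ℝ) := by positivity
    have h2 : (c : ℝ) = ((Nn⁻¹ : ℝ≥0) : ℝ) / 4 := by simp [c]
    linarith
  have hcN' : (Nn : ℝ) * c = 1 / 4 := by
    have : (Nn : ℝ) ≠ 0 := by exact_mod_cast hNn.ne'
    simp only [c, NNReal.coe_div, NNReal.coe_inv]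
    field_simp
    norm_num
  obtain ⟨u, hu, -, -, f', hf', hf'c⟩ :=
    (contDiffWithinAt_succ_iff_hasFDerivWithinAt' (n := 0) (by simp)).1
      (show ContDiffWithinAt ℝ (0 + 1) g S a by simpa using hg)
  rw [insert_eq_of_mem haS] at hu
  have hf'a : f' a = A := huniq.eq (hf' a (mem_of_mem_nhdsWithin haS hu)) hA
  obtain ⟨t, ht, hlip⟩ :=
    hconv.exists_nhdsWithin_lipschitzOnWith_of_hasFDerivWithinAt_of_nnnorm_lt (x := a)
    (f := fun x => g x - A x) (f' := fun x => f' x - (A : E3 →L[ℝ] E3))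
    (by filter_upwards [hu] with x hx using (hf' x hx).sub A.hasFDerivAt.hasFDerivWithinAt)
    (hf'c.continuousWithinAt.sub continuousWithinAt_const) c (by simpa [hf'a] using hc0)
  obtain ⟨r₀, hr₀, hr₀t⟩ := Metric.mem_nhdsWithin_iff.1 (inter_mem ht hT)
  have hfold : ∀ x ∈ Metric.ball a r₀, foldHalfSpace x ∈ t ∩ T := fun x hx => by
    refine hr₀t ⟨?_, foldHalfSpace_zero_nonneg x⟩
    have h1 := lipschitzWith_foldHalfSpace.dist_le_mul x a
    rw [foldHalfSpace_of_nonneg haS, NNReal.coe_one, one_mul] at h1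
    exact lt_of_le_of_lt h1 hx
  -- Folding extends the error `g - A` over a full ball with Lipschitz constant `c`. Thus `A + φ`
  -- extends `g` across the boundary as a small perturbation of a linear isomorphism, whose image
  -- contains a neighbourhood of `g a`.
  let φ : E3 → E3 := fun x => g (foldHalfSpace x) - A (foldHalfSpace x)
  have hφ : LipschitzOnWith c φ (Metric.ball a r₀) := by
    have := hlip.comp (lipschitzWith_foldHalfSpace.lipschitzOnWith (s := Metric.ball a r₀))
      (fun x hx => (hfold x hx).1)
    rwa [mul_one] at this
  let G : E3 → E3 := fun x => A x + φ x
  have hG : ∀ x, 0 ≤ x 0 → G x = g x := fun x hx => by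
    simp only [G, φ, foldHalfSpace_of_nonneg hx]; abel
  have hGa : ApproximatesLinearOn G (A : E3 →L[ℝ] E3) (Metric.ball a r₀) c := by
    rw [ApproximatesLinearOn.approximatesLinearOn_iff_lipschitzOnWith]
    have : G - ⇑(A : E3 →L[ℝ] E3) = φ := by
      funext x
      simp [G]
    rw [this]
    exact hφ
  have himg : G '' Metric.ball a r₀ ∈ 𝓝 (g a) := by
    rw [← hG a haS]
    exact hGa.image_mem_nhds A.toNonlinearRightInverse (Metric.ball_mem_nhds a hr₀)
      (Or.inr hcN)
  obtain ⟨r, hr, hrG⟩ := Metric.mem_nhds_iff.1 himg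
  refine ⟨r₀, hr₀, r, hr, fun x₁ hx₁ hx₁0 τ hτ hmem => ?_⟩
  obtain ⟨x₂, hx₂, hGx₂⟩ := hrG hmem
  -- The preimage differs from `x₁` by `τ` times the inward vector, up to an error of at most a
  -- quarter of `‖x₂ - x₁‖`. Hence `‖x₂ - x₁‖ ≤ 4τ/3`, the error is at most `τ/3`, and the first
  -- coordinate increases. In particular `x₂` is in the half-space, where the extension is `g`.
  have hpos : 0 < x₂ 0 := by
    have e1 : A (x₂ - x₁) = τ • A inwardVector - (φ x₂ - φ x₁) := by
      have h1 : A x₂ + φ x₂ = A x₁ + φ x₁ + τ • A inwardVector := by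
        rw [← hG x₁ hx₁0] at hGx₂; exact hGx₂
      rw [map_sub]
      rw [← sub_eq_zero] at h1 ⊢
      rw [← h1]
      abel
    have e2 : x₂ - x₁ = τ • inwardVector - A.symm (φ x₂ - φ x₁) := by
      have := congrArg A.symm e1
      simpa using this
    have h3 : ‖A.symm (φ x₂ - φ x₁)‖ ≤ 1 / 4 * ‖x₂ - x₁‖ := by
      have h4 : ‖A.symm (φ x₂ - φ x₁)‖ ≤ Nn * ‖φ x₂ - φ x₁‖ :=
        (A.symm : E3 →L[ℝ] E3).le_opNorm _
      have h5 : ‖φ x₂ - φ x₁‖ ≤ c * ‖x₂ - x₁‖ := by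
        have := hφ.dist_le_mul x₂ hx₂ x₁ hx₁
        rwa [dist_eq_norm, dist_eq_norm] at this
      calc _ ≤ Nn * (c * ‖x₂ - x₁‖) := h4.trans (mul_le_mul_of_nonneg_left h5 Nn.2)
        _ = _ := by rw [← mul_assoc, hcN']
    have h6 : ‖x₂ - x₁‖ ≤ τ + 1 / 4 * ‖x₂ - x₁‖ := by
      calc ‖x₂ - x₁‖ ≤ ‖τ • inwardVector‖ + ‖A.symm (φ x₂ - φ x₁)‖ := by
            conv_lhs => rw [e2]
            exact norm_sub_le _ _
        _ ≤ _ := by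
            have : ‖τ • inwardVector‖ = τ := by
              rw [norm_smul, Real.norm_of_nonneg hτ.le, inwardVector]; simp
            linarith
    have h7 : x₂ 0 - x₁ 0 = τ - (A.symm (φ x₂ - φ x₁)) 0 := by
      have := congrArg (fun z : E3 => z 0) e2
      simpa [inwardVector] using this
    have h8 : |(A.symm (φ x₂ - φ x₁)) 0| ≤ ‖A.symm (φ x₂ - φ x₁)‖ := by
      have := PiLp.norm_apply_le (A.symm (φ x₂ - φ x₁)) 0
      rwa [Real.norm_eq_abs] at this
    have h9 := le_abs_self ((A.symm (φ x₂ - φ x₁)) 0)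
    linarith
  refine ⟨x₂, ?_, hpos, ?_⟩
  · have := (hfold x₂ hx₂).2
    rwa [foldHalfSpace_of_nonneg hpos.le] at this
  · rw [← hG x₂ hpos.le, hGx₂]

theorem mem_range_halfSpace {x : E3} : x ∈ range (𝓡∂ 3) ↔ 0 ≤ x 0 := by
  rw [range_modelWithCornersEuclideanHalfSpace]; rfl

theorem mem_interior_range_halfSpace {x : E3} : x ∈ interior (range (𝓡∂ 3)) ↔ 0 < x 0 := by
  rw [interior_range_modelWithCornersEuclideanHalfSpace]; rfl

theorem isBoundaryPoint_iff_apply_zero {M : OrientedThreeManifold} {y : M} :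
    (𝓡∂ 3).IsBoundaryPoint y ↔ (extChartAt (𝓡∂ 3) y y) 0 = 0 := by
  have h := mem_range_halfSpace.1 (mem_of_subset_of_mem (extChartAt_target_subset_range y)
    (mem_extChartAt_target (I := 𝓡∂ 3) y))
  have h2 : (𝓡∂ 3).IsInteriorPoint y ↔ 0 < (extChartAt (𝓡∂ 3) y y) 0 :=
    mem_interior_range_halfSpace
  rw [ModelWithCorners.isBoundaryPoint_iff_not_isInteriorPoint, h2]
  constructor <;> intro h' <;> linarith

theorem isInteriorPoint_extChartAt_symm {M : OrientedThreeManifold} {y : M} {x : E3}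
    (hx : x ∈ (extChartAt (𝓡∂ 3) y).target) (hx0 : 0 < x 0) :
    (extChartAt (𝓡∂ 3) y).symm x ∈ (𝓡∂ 3).interior (M : Type _) :=
  (((interiorChart (𝓡∂ 3) y).symm.isLocalDiffeomorphAt _ _ _ (x := x)
    ⟨hx, mem_interior_range_halfSpace.2 hx0⟩).isInteriorPoint_iff (by simp)).1
    BoundarylessManifold.isInteriorPoint

theorem isBoundaryPoint_extChartAt_symm {M : OrientedThreeManifold} {y : M} {x : E3}
    (hx : x ∈ (extChartAt (𝓡∂ 3) y).target) (hx0 : x 0 = 0) :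
    (𝓡∂ 3).IsBoundaryPoint ((extChartAt (𝓡∂ 3) y).symm x) := by
  rw [ModelWithCorners.isBoundaryPoint_iff_not_isInteriorPoint,
    ModelWithCorners.isInteriorPoint_iff_of_mem_atlas (n := ∞) (by simp)
      (chart_mem_atlas _ y) (by
        rw [← extChartAt_source (𝓡∂ 3)]
        exact (extChartAt (𝓡∂ 3) y).map_target hx)]
  intro h
  have h1 : extChartAt (𝓡∂ 3) y ((extChartAt (𝓡∂ 3) y).symm x) ∈
    interior (extChartAt (𝓡∂ 3) y).target := h
  rw [(extChartAt (𝓡∂ 3) y).right_inv hx] at h1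
  have := mem_interior_range_halfSpace.1 (interior_mono (extChartAt_target_subset_range y) h1)
  linarith

/-- The image of the inward direction under the differential of `f`, read in a chart. -/
def inwardImage {M N : OrientedThreeManifold} (f : M → N) (y : M) : E3 :=
  (mfderiv (𝓡∂ 3) (𝓡∂ 3) f y : E3 →L[ℝ] E3) inwardVector

/-- Near the image of a boundary point, the image of an embedding is closed under small shifts in
the image of the inward direction. -/
theorem exists_shift_of_isBoundaryPoint {M N : OrientedThreeManifold} {f : M → N}
    (hf : IsSmoothEmb f) {y : M} (hy : (𝓡∂ 3).IsBoundaryPoint y) :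
    ∃ r > 0, ∀ n ∈ Metric.ball (extChartAt (𝓡∂ 3) (f y) (f y)) r,
      n ∈ (extChartAt (𝓡∂ 3) (f y)).target →
      (extChartAt (𝓡∂ 3) (f y)).symm n ∈ range f → ∀ τ : ℝ, 0 < τ →
      n + τ • inwardImage f y ∈ Metric.ball (extChartAt (𝓡∂ 3) (f y) (f y)) r →
      (extChartAt (𝓡∂ 3) (f y)).symm (n + τ • inwardImage f y) ∈
        f '' (𝓡∂ 3).interior (M : Type _) := by
  let φ := extChartAt (𝓡∂ 3) y
  let u := extChartAt (𝓡∂ 3) (f y)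
  let a : E3 := φ y
  let g : E3 → E3 := writtenInExtChartAt (𝓡∂ 3) (𝓡∂ 3) y f
  have ha : a 0 = 0 := isBoundaryPoint_iff_apply_zero.1 hy
  have hga : g a = u (f y) := by
    simp only [g, a, φ, u, writtenInExtChartAt, comp_apply, extChartAt_to_inv]
  let A₀ : E3 →L[ℝ] E3 := mfderiv (𝓡∂ 3) (𝓡∂ 3) f y
  have hbij : Bijective A₀ := ⟨hf.immersion y, surjective_mfderiv_of_injective rfl
    (hf.immersion y)⟩
  let A : E3 ≃L[ℝ] E3 := (LinearEquiv.ofBijective (A₀ : E3 →ₗ[ℝ] E3) hbij).toContinuousLinearEquiv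
  have hAA₀ : (A : E3 →L[ℝ] E3) = A₀ := by ext v; rfl
  have hrange : range (𝓡∂ 3) = {x : E3 | 0 ≤ x 0} := by
    ext x; exact mem_range_halfSpace
  have hgc : ContDiffWithinAt ℝ 1 g {x | 0 ≤ x 0} a := by
    rw [← hrange]
    exact (contMDiffAt_iff.1 (hf.contMDiff y)).2.of_le (by simp)
  have hgA : HasFDerivWithinAt g (A : E3 →L[ℝ] E3) {x | 0 ≤ x 0} a := by
    rw [← hrange, hAA₀]
    exact ((hf.contMDiff y).mdifferentiableAt (by simp)).hasMFDerivAt.2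
  let T : Set E3 := φ.target ∩ φ.symm ⁻¹' (f ⁻¹' u.source)
  have hT : T ∈ 𝓝[{x : E3 | 0 ≤ x 0}] a := by
    rw [← hrange]
    refine inter_mem (extChartAt_target_mem_nhdsWithin y) ?_
    refine mem_nhdsWithin_of_mem_nhds (extChartAt_preimage_mem_nhds ?_)
    exact hf.contMDiff.continuous.continuousAt.preimage_mem_nhds (extChartAt_source_mem_nhds _)
  obtain ⟨r₀, hr₀, r, hr, hshift⟩ := exists_shift_of_halfSpace ha A hgc hgA hT
  -- Since `f` is a topological embedding, points of its range near `f y` come from points near `y`,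
  -- so the chart at `y` sees the whole range there.
  have hnear : ∀ᶠ n in 𝓝[u.target] (u (f y)), ∀ z, f z = u.symm n →
      z ∈ φ.source ∧ φ z ∈ Metric.ball a r₀ := by
    have h1 : φ.source ∩ φ ⁻¹' Metric.ball a r₀ ∈ 𝓝 y :=
      inter_mem (extChartAt_source_mem_nhds y)
        ((continuousAt_extChartAt y).preimage_mem_nhds (Metric.ball_mem_nhds _ hr₀))
    rw [hf.isEmbedding.nhds_eq_comap] at h1
    obtain ⟨V, hV, hVs⟩ := h1
    have h2 : Tendsto u.symm (𝓝[u.target] (u (f y))) (𝓝 (f y)) := by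
      have := (continuousOn_extChartAt_symm (I := 𝓡∂ 3) (f y)) _ (mem_extChartAt_target (f y))
      have h3 := this.tendsto
      rwa [extChartAt_to_inv] at h3
    filter_upwards [h2.eventually hV] with n hn z hz
    exact hVs (show f z ∈ V from hz ▸ hn)
  obtain ⟨r₁, hr₁, hr₁n⟩ := Metric.mem_nhdsWithin_iff.1 hnear
  refine ⟨min r r₁, lt_min hr hr₁, fun n hn hnt hnr τ hτ hmem => ?_⟩
  obtain ⟨z, hz⟩ := hnr
  obtain ⟨hzs, hzb⟩ := hr₁n ⟨Metric.ball_subset_ball (min_le_right _ _) hn, hnt⟩ z hz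
  have hgz : g (φ z) = n := by
    have h1 : φ.symm (φ z) = z := φ.left_inv hzs
    simp only [g, writtenInExtChartAt, comp_apply]
    change u (f (φ.symm (φ z))) = n
    rw [h1, hz]
    exact u.right_inv hnt
  have hw : inwardImage f y = A inwardVector := rfl
  obtain ⟨x₂, hx₂T, hx₂0, hx₂⟩ := hshift (φ z) hzb
    (mem_range_halfSpace.1 (extChartAt_target_subset_range y (φ.map_source hzs))) τ hτ (by
      rw [hgz, hga, ← hw]
      exact Metric.ball_subset_ball (min_le_left _ _) hmem)
  refine ⟨φ.symm x₂, isInteriorPoint_extChartAt_symm hx₂T.1 hx₂0, ?_⟩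
  rw [hw]
  rw [hgz] at hx₂
  rw [← hx₂]
  exact (u.left_inv hx₂T.2).symm

/-- The image of a boundary point under an embedding with image a neighbourhood of this point lies
in the boundary. -/
theorem isBoundaryPoint_of_range_mem_nhds {M N : OrientedThreeManifold} {f : M → N}
    (hf : IsSmoothEmb f) {y : M} (hy : (𝓡∂ 3).IsBoundaryPoint y) (hr : range f ∈ 𝓝 (f y)) :
    (𝓡∂ 3).IsBoundaryPoint (f y) := by
  by_contra hcon
  rw [← ModelWithCorners.isInteriorPoint_iff_not_isBoundaryPoint] at hcon
  let u := extChartAt (𝓡∂ 3) (f y)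
  -- At an interior point one could step back from `f y` against the inward image while remaining in
  -- the range; shifting forward again would put `f y` in the image of the interior, against
  -- injectivity.
  obtain ⟨r, hr0, hshift⟩ := exists_shift_of_isBoundaryPoint hf hy
  have hc1 : ContinuousAt (fun τ : ℝ => u (f y) - τ • inwardImage f y) 0 := by fun_prop
  have hz : u (f y) - (0 : ℝ) • inwardImage f y = u (f y) := by simp
  have h1 : ∀ᶠ n in 𝓝 (u (f y)), n ∈ u.target ∧ u.symm n ∈ range f ∧
      n ∈ Metric.ball (u (f y)) r := by
    have ht : ∀ᶠ n in 𝓝 (u (f y)), n ∈ u.target := by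
      filter_upwards [(interiorChart (𝓡∂ 3) (f y)).open_target.mem_nhds
        (⟨mem_extChartAt_target (f y), hcon⟩)] with n hn
      exact hn.1
    have hs : ∀ᶠ n in 𝓝 (u (f y)), u.symm n ∈ range f := by
      refine (contMDiffAt_extChartAt_symm_of_isInteriorPoint hcon).continuousAt.eventually ?_
      rwa [extChartAt_to_inv]
    exact ht.and (hs.and (Metric.ball_mem_nhds _ hr0))
  have h2 : ∀ᶠ τ in 𝓝 (0 : ℝ), (u (f y) - τ • inwardImage f y) ∈ u.target ∧
      u.symm (u (f y) - τ • inwardImage f y) ∈ range f ∧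
      (u (f y) - τ • inwardImage f y) ∈ Metric.ball (u (f y)) r := by
    have := hc1.tendsto
    rw [hz] at this
    exact this.eventually h1
  obtain ⟨τ, ⟨ht1, ht2, ht3⟩, hτ⟩ := ((h2.filter_mono nhdsWithin_le_nhds).and
    (self_mem_nhdsWithin : Ioi (0 : ℝ) ∈ 𝓝[>] (0 : ℝ))).exists
  have h3 := hshift _ ht3 ht1 ht2 τ hτ
    (by rw [sub_add_cancel]; exact Metric.mem_ball_self hr0)
  rw [sub_add_cancel, extChartAt_to_inv] at h3
  obtain ⟨z, hz, hzy⟩ := h3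
  rw [hf.isEmbedding.injective hzy] at hz
  exact (ModelWithCorners.isBoundaryPoint_iff_not_isInteriorPoint y).1 hy hz

/-- The image of a boundary point at a boundary point: the inward direction goes to an inward
direction. -/
theorem inwardImage_pos {M N : OrientedThreeManifold} {f : M → N}
    (hf : IsSmoothEmb f) {y : M} (hy : (𝓡∂ 3).IsBoundaryPoint y)
    (hq : (𝓡∂ 3).IsBoundaryPoint (f y)) : 0 < inwardImage f y 0 := by
  let φ := extChartAt (𝓡∂ 3) y
  let g : E3 → E3 := writtenInExtChartAt (𝓡∂ 3) (𝓡∂ 3) y f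
  let A₀ : E3 →L[ℝ] E3 := mfderiv (𝓡∂ 3) (𝓡∂ 3) f y
  have ha : (φ y) 0 = 0 := isBoundaryPoint_iff_apply_zero.1 hy
  have hga : g (φ y) = extChartAt (𝓡∂ 3) (f y) (f y) := by
    simp only [g, φ, writtenInExtChartAt, comp_apply, extChartAt_to_inv]
  have hg0 : (g (φ y)) 0 = 0 := by rw [hga]; exact isBoundaryPoint_iff_apply_zero.1 hq
  have hgA : HasFDerivWithinAt g A₀ (range (𝓡∂ 3)) (φ y) :=
    ((hf.contMDiff y).mdifferentiableAt (by simp)).hasMFDerivAt.2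
  have hg1 : HasFDerivWithinAt (fun x => g x 0)
      ((EuclideanSpace.proj 0 : E3 →L[ℝ] ℝ).comp A₀) (range (𝓡∂ 3)) (φ y) :=
    (EuclideanSpace.proj 0 : E3 →L[ℝ] ℝ).hasFDerivAt.comp_hasFDerivWithinAt (φ y) hgA
  -- In charts the first coordinate of the image is nonnegative and vanishes at `y`. This minimum
  -- makes its derivative nonnegative on inward directions and zero on directions tangent to the
  -- boundary.
  have hmin : IsLocalMinOn (fun x => g x 0) (range (𝓡∂ 3)) (φ y) := by
    refine Eventually.of_forall fun x => ?_
    dsimp only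
    rw [hg0]
    refine mem_range_halfSpace.1 ?_
    exact mem_range_self _
  have hnonneg : ∀ v : E3, 0 ≤ v 0 → 0 ≤ (A₀ v) 0 := by
    intro v hv
    refine hmin.hasFDerivWithinAt_nonneg hg1 (mem_posTangentConeAt_of_segment_subset ?_)
    refine ((𝓡∂ 3).convex_range).segment_subset ?_ ?_
    · exact mem_range_halfSpace.2 ha.ge
    · refine mem_range_halfSpace.2 ?_
      simp [ha, hv]
  have hsurj : Surjective A₀ := surjective_mfderiv_of_injective rfl (hf.immersion y)
  -- Were the inward derivative zero as well, the differential would map into the boundary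
  -- hyperplane and could not be surjective.
  refine lt_of_le_of_ne (hnonneg inwardVector (by simp [inwardVector])) fun h0 => ?_
  obtain ⟨v, hv⟩ := hsurj inwardVector
  have hdec : A₀ v = (v 0) • A₀ inwardVector + A₀ (v - v 0 • inwardVector) := by
    rw [← map_smul, ← map_add]; simp
  have h1 : (A₀ (v - v 0 • inwardVector)) 0 = 0 := by
    refine le_antisymm ?_ (hnonneg _ (by simp [inwardVector]))
    have := hnonneg (-(v - v 0 • inwardVector)) (by simp [inwardVector])
    rw [map_neg] at this
    simpa using this
  have h2 : (A₀ v) 0 = 0 := by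
    rw [hdec]
    have : (A₀ inwardVector) 0 = 0 := h0.symm
    simp only [PiLp.add_apply, PiLp.smul_apply, this, h1]
    simp
  rw [hv] at h2
  simp [inwardVector] at h2

/-- If the boundary of the target near the image of a boundary point lies in the image of the
embedding, then the image is a neighbourhood of this point. -/
theorem range_mem_nhds_of_boundary_subset {M N : OrientedThreeManifold} {f : M → N}
    (hf : IsSmoothEmb f) {y : M} (hy : (𝓡∂ 3).IsBoundaryPoint y)
    (hq : (𝓡∂ 3).IsBoundaryPoint (f y))
    (hb : ∀ᶠ z in 𝓝 (f y), (𝓡∂ 3).IsBoundaryPoint z → z ∈ range f) : range f ∈ 𝓝 (f y) := by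
  let u := extChartAt (𝓡∂ 3) (f y)
  let w := inwardImage f y
  have hw : 0 < w 0 := inwardImage_pos hf hy hq
  have hu0 : (u (f y)) 0 = 0 := isBoundaryPoint_iff_apply_zero.1 hq
  obtain ⟨r, hr0, hshift⟩ := exists_shift_of_isBoundaryPoint hf hy
  -- Projection to the boundary hyperplane along `w`. A nearby point of the half-space is thus a
  -- boundary point, in the range by assumption, shifted by a nonnegative multiple of `w`.
  let π : E3 → E3 := fun n => n - (n 0 / w 0) • w
  have hπ0 : ∀ n, (π n) 0 = 0 := fun n => by simp [π, hw.ne']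
  have hπu : π (u (f y)) = u (f y) := by simp [π, hu0]
  have hπc : Continuous π := by fun_prop
  have hut : ∀ᶠ n in 𝓝 (u (f y)), 0 ≤ n 0 → n ∈ u.target ∧
      ((𝓡∂ 3).IsBoundaryPoint (u.symm n) → u.symm n ∈ range f) := by
    have h1 : ∀ᶠ n in 𝓝[range (𝓡∂ 3)] (u (f y)), n ∈ u.target ∧
        ((𝓡∂ 3).IsBoundaryPoint (u.symm n) → u.symm n ∈ range f) := by
      refine Eventually.and (extChartAt_target_mem_nhdsWithin (f y)) ?_
      refine mem_nhdsWithin_of_mem_nhds ?_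
      exact extChartAt_preimage_mem_nhds hb
    filter_upwards [eventually_nhdsWithin_iff.1 h1] with n hn hn0
    exact hn (mem_range_halfSpace.2 hn0)
  have hut' : ∀ᶠ n in 𝓝 (u (f y)), 0 ≤ (π n) 0 → π n ∈ u.target ∧
      ((𝓡∂ 3).IsBoundaryPoint (u.symm (π n)) → u.symm (π n) ∈ range f) := by
    have := hπc.tendsto (u (f y))
    rw [hπu] at this
    exact this.eventually hut
  have hball : ∀ᶠ n in 𝓝 (u (f y)), π n ∈ Metric.ball (u (f y)) r := by
    have := hπc.tendsto (u (f y))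
    rw [hπu] at this
    exact this.eventually (Metric.ball_mem_nhds _ hr0)
  have hfinal : ∀ᶠ n in 𝓝 (u (f y)), 0 ≤ n 0 → u.symm n ∈ range f := by
    filter_upwards [hut', hball, Metric.ball_mem_nhds (u (f y)) hr0] with n h1 h2 h3 hn0
    obtain ⟨h4, h5⟩ := h1 (hπ0 n).ge
    have h6 : u.symm (π n) ∈ range f := h5 (isBoundaryPoint_extChartAt_symm h4 (hπ0 n))
    rcases hn0.eq_or_lt with h | h
    · have : π n = n := by simp [π, ← h]
      rwa [this] at h6
    · have h7 : n = π n + (n 0 / w 0) • w := by simp [π]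
      have := hshift (π n) h2 h4 h6 (n 0 / w 0) (div_pos h hw) (h7 ▸ h3)
      change u.symm (π n + (n 0 / w 0) • w) ∈ _ at this
      rw [← h7] at this
      exact image_subset_range _ _ this
  have hlast : ∀ᶠ z in 𝓝 (f y), z ∈ u.source ∧ (0 ≤ (u z) 0 → u.symm (u z) ∈ range f) :=
    Eventually.and (extChartAt_source_mem_nhds _) ((continuousAt_extChartAt (f y)).eventually hfinal)
  filter_upwards [hlast] with z hz
  have := hz.2 (mem_range_halfSpace.1 (extChartAt_target_subset_range (f y) (u.map_source hz.1)))
  rwa [u.left_inv hz.1] at this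

/-! ### Pushing the image of an embedding into the image of the interior -/

section Cross

variable {M N : OrientedThreeManifold} {f : M → N}

/-- The image of the interior under an embedding is open, consists of interior points, and the
inverse map is smooth there. -/
theorem IsSmoothEmb.exists_leftInverse [Nonempty M] (hf : IsSmoothEmb f) :
    ∃ g : N → M, IsOpen (f '' (𝓡∂ 3).interior (M : Type _)) ∧
      f '' (𝓡∂ 3).interior (M : Type _) ⊆ (𝓡∂ 3).interior (N : Type _) ∧
      ContMDiffOn (𝓡∂ 3) (𝓡∂ 3) ∞ g (f '' (𝓡∂ 3).interior (M : Type _)) ∧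
      ∀ x ∈ (𝓡∂ 3).interior (M : Type _), g (f x) = x :=
  exists_smooth_leftInverse_of_injOn rfl (isOpen_interior_manifold M) hf.contMDiff.contMDiffOn
    Subset.rfl hf.isEmbedding.injective.injOn fun x _ => hf.immersion x

theorem IsSmoothEmb.isOpen_image_interior (hf : IsSmoothEmb f) :
    IsOpen (f '' (𝓡∂ 3).interior (M : Type _)) := by
  rcases isEmpty_or_nonempty M with hM | hM
  · rw [eq_empty_of_isEmpty ((𝓡∂ 3).interior (M : Type _)), image_empty]
    exact isOpen_empty
  · obtain ⟨g, h, -⟩ := hf.exists_leftInverse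
    exact h

/-- Near an interior point of `N`, the image of `f` can be pushed into the image of the interior. -/
theorem exists_isotopy_cross_local (hf : IsSmoothEmb f) {y : M}
    (hqi : f y ∈ (𝓡∂ 3).interior (N : Type _)) :
    ∃ Φ : ℝ → Diffeomorph (𝓡∂ 3) (𝓡∂ 3) N N ∞, IsAmbientIsotopy Φ ∧
      (∀ t, ∀ z ∈ range f, Φ t z = z ∨ Φ t z ∈ f '' (𝓡∂ 3).interior (M : Type _)) ∧
      ∀ᶠ z in 𝓝 (f y), z ∈ range f → Φ 1 z ∈ f '' (𝓡∂ 3).interior (M : Type _) := by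
  rcases (𝓡∂ 3).isInteriorPoint_or_isBoundaryPoint y with hy | hy
  · refine ⟨_, IsAmbientIsotopy.refl N, fun _ _ _ => Or.inl rfl, ?_⟩
    filter_upwards [hf.isOpen_image_interior.mem_nhds (mem_image_of_mem f hy)] with z hz _
    exact hz
  let u := extChartAt (𝓡∂ 3) (f y)
  let w := inwardImage f y
  obtain ⟨r, hr0, hshift⟩ := exists_shift_of_isBoundaryPoint hf hy
  let ι := interiorChart (𝓡∂ 3) (f y)
  have hmem : u (f y) ∈ ι.target := ⟨mem_extChartAt_target (f y), hqi⟩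
  obtain ⟨r₁, hr₁, hr₁t⟩ := Metric.mem_nhds_iff.1 (ι.open_target.mem_nhds hmem)
  let r' := min r r₁
  have hr' : 0 < r' := lt_min hr0 hr₁
  let B : Set E3 := Metric.ball (u (f y)) r'
  have hBt : B ⊆ ι.target := (Metric.ball_subset_ball (min_le_right _ _)).trans hr₁t
  have hBr : B ⊆ Metric.ball (u (f y)) r := Metric.ball_subset_ball (min_le_left _ _)
  let ρ : ContDiffBump (u (f y)) := ⟨r' / 4, r' / 2, by positivity, by linarith⟩
  obtain ⟨δ, hδ, hall⟩ := exists_isotopy_displacement (N := N) (c := u.symm) (B := B)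
    (v := fun x => ρ x • w) (K := Metric.closedBall (u (f y)) (r' / 2)) (by simp)
    Metric.isOpen_ball (ι.contMDiffOn_invFun.mono hBt)
    (u.symm.injOn.mono fun x hx => (hBt hx).1)
    (fun x hx => ((ι.symm.isLocalDiffeomorphAt _ _ _ (hBt hx)).mfderivToContinuousLinearEquiv
      (by simp)).injective)
    (ρ.contDiff.smul contDiff_const) (isCompact_closedBall _ _)
    (Metric.closedBall_subset_ball (by linarith))
    (fun x hx => by
      rw [ρ.zero_of_le_dist, zero_smul]
      exact (not_le.1 hx).le)
  obtain ⟨Φ, hΦ, hΦB, hΦn⟩ := hall (δ / 2) (by rw [abs_of_pos (by linarith)]; linarith)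
  -- Points move by nonnegative multiples of the inward image: where the multiple is positive they
  -- land in the image of the interior, otherwise they do not move.
  have hpush : ∀ t, ∀ x ∈ B, u.symm x ∈ range f →
      0 < (δ / 2 * Real.smoothTransition t) * ρ x →
      Φ t (u.symm x) ∈ f '' (𝓡∂ 3).interior (M : Type _) := by
    intro t x hx hxf hpos
    obtain ⟨h1, h2⟩ := hΦB t x hx
    rw [h2]
    rw [smul_smul] at h1 ⊢
    exact hshift x (hBr hx) (hBt hx).1 hxf _ hpos (hBr h1)
  refine ⟨Φ, hΦ, fun t z hz => ?_, ?_⟩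
  · by_cases hzB : z ∈ u.symm '' B
    · obtain ⟨x, hx, rfl⟩ := hzB
      have hnn : 0 ≤ (δ / 2 * Real.smoothTransition t) * ρ x :=
        mul_nonneg (mul_nonneg (by linarith) (Real.smoothTransition.nonneg t)) ρ.nonneg
      rcases hnn.eq_or_lt with h | h
      · left
        rw [(hΦB t x hx).2, smul_smul, ← h, zero_smul, add_zero]
      · exact Or.inr (hpush t x hx hz h)
    · exact Or.inl (hΦn t z hzB)
  · have h1 : ∀ᶠ z in 𝓝 (f y), z ∈ u.source := extChartAt_source_mem_nhds (f y)
    have h2 : ∀ᶠ z in 𝓝 (f y), u z ∈ Metric.ball (u (f y)) (r' / 2) :=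
      (continuousAt_extChartAt (f y)).eventually (Metric.ball_mem_nhds _ (by positivity))
    filter_upwards [h1, h2] with z hz1 hz2 hzf
    have hzB : u z ∈ B := Metric.ball_subset_ball (by linarith) hz2
    have := hpush 1 (u z) hzB (by rwa [u.left_inv hz1]) (by
      rw [Real.smoothTransition.one, mul_one]
      exact mul_pos (by linarith) (ρ.pos_of_mem_ball hz2))
    rwa [u.left_inv hz1] at this

/-- A compact set of interior points of `N` in the image of `f` can be pushed into the image of the
interior by an ambient isotopy that moves points of the image of `f` only into the image of the
interior. -/
theorem exists_isotopy_cross (hf : IsSmoothEmb f) {A : Set N} (hA : IsCompact A)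
    (hAf : A ⊆ range f) (hAi : A ⊆ (𝓡∂ 3).interior (N : Type _)) :
    ∃ Φ : ℝ → Diffeomorph (𝓡∂ 3) (𝓡∂ 3) N N ∞, IsAmbientIsotopy Φ ∧
      (∀ t, ∀ z ∈ range f, Φ t z = z ∨ Φ t z ∈ f '' (𝓡∂ 3).interior (M : Type _)) ∧
      ∀ z ∈ A, Φ 1 z ∈ f '' (𝓡∂ 3).interior (M : Type _) := by
  -- Membership in the range becomes a hypothesis on `z`, so that the statement makes sense for
  -- arbitrary sets and can be proved by induction over a cover.
  suffices h : ∃ Φ : ℝ → Diffeomorph (𝓡∂ 3) (𝓡∂ 3) N N ∞, IsAmbientIsotopy Φ ∧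
      (∀ t, ∀ z ∈ range f, Φ t z = z ∨ Φ t z ∈ f '' (𝓡∂ 3).interior (M : Type _)) ∧
      ∀ z ∈ A, z ∈ range f → Φ 1 z ∈ f '' (𝓡∂ 3).interior (M : Type _) by
    obtain ⟨Φ, h1, h2, h3⟩ := h
    exact ⟨Φ, h1, h2, fun z hz => h3 z hz (hAf hz)⟩
  refine hA.induction_on (p := fun A => ∃ Φ : ℝ → Diffeomorph (𝓡∂ 3) (𝓡∂ 3) N N ∞,
    IsAmbientIsotopy Φ ∧
      (∀ t, ∀ z ∈ range f, Φ t z = z ∨ Φ t z ∈ f '' (𝓡∂ 3).interior (M : Type _)) ∧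
      ∀ z ∈ A, z ∈ range f → Φ 1 z ∈ f '' (𝓡∂ 3).interior (M : Type _)) ?_ ?_ ?_ ?_
  · exact ⟨_, IsAmbientIsotopy.refl N, fun _ _ _ => Or.inl rfl, fun z hz => hz.elim⟩
  · rintro s t hst ⟨Φ, h1, h2, h3⟩
    exact ⟨Φ, h1, h2, fun z hz => h3 z (hst hz)⟩
  · rintro s t ⟨Φ, h1, h2, h3⟩ ⟨Ψ, h1', h2', h3'⟩
    -- The second isotopy cannot undo the first, because it preserves the image of the interior.
    have hS : ∀ t, ∀ z ∈ f '' (𝓡∂ 3).interior (M : Type _),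
        Ψ t z ∈ f '' (𝓡∂ 3).interior (M : Type _) := fun t z hz => by
      rcases h2' t z (image_subset_range _ _ hz) with h | h
      · rwa [h]
      · exact h
    refine ⟨_, h1.trans h1', fun t z hz => ?_, fun z hz hzf => ?_⟩
    · change Ψ t (Φ t z) = z ∨ Ψ t (Φ t z) ∈ _
      rcases h2 t z hz with h | h
      · rw [h]
        exact h2' t z hz
      · exact Or.inr (hS t _ h)
    · change Ψ 1 (Φ 1 z) ∈ _
      rcases hz with hz | hz
      · exact hS 1 _ (h3 z hz hzf)
      · rcases h2 1 z hzf with h | h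
        · rw [h]
          exact h3' z hz hzf
        · exact hS 1 _ h
  · intro x hx
    obtain ⟨y, rfl⟩ := hAf hx
    obtain ⟨Φ, h1, h2, h3⟩ := exists_isotopy_cross_local hf (hAi hx)
    exact ⟨_, mem_nhdsWithin_of_mem_nhds h3, Φ, h1, h2, fun z hz => hz⟩

end Cross

/-! ### Attached cells and their attaching region -/

theorem CellAttachment.box_subset {V W : Type*} [NormedAddCommGroup V] [NormedAddCommGroup W] {C : Set W} :
    Metric.ball (0 : V) 1 ×ˢ interior C ⊆ Metric.closedBall 0 1 ×ˢ C :=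
  prod_mono Metric.ball_subset_closedBall interior_subset

theorem CellAttachment.isOpen_box {V W : Type*} [NormedAddCommGroup V] [NormedAddCommGroup W] {C : Set W} :
    IsOpen (Metric.ball (0 : V) 1 ×ˢ interior C) :=
  Metric.isOpen_ball.prod isOpen_interior

section Cells

variable {M N : OrientedThreeManifold} {J V W : Type*}
  [NormedAddCommGroup V] [NormedSpace ℝ V] [NormedAddCommGroup W] [NormedSpace ℝ W]

/-- `N` is obtained from the image of `f` by attaching pairwise disjoint cells, copies of the
product of the unit ball of `V` and the compact set `C`, along the product of the unit sphere
and `C`. -/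
structure CellAttachment (f : M → N) (C : Set W) (h : J → V × W → N) : Prop where
  finrank : Module.finrank ℝ (V × W) = 3
  isCompact : IsCompact C
  continuousOn : ∀ j, ContinuousOn (h j) (Metric.closedBall 0 1 ×ˢ C)
  injOn : ∀ j, InjOn (h j) (Metric.closedBall 0 1 ×ˢ C)
  disjoint : ∀ i j, ∀ x ∈ Metric.closedBall (0 : V) 1 ×ˢ C,
    ∀ y ∈ Metric.closedBall (0 : V) 1 ×ˢ C, h i x = h j y → i = j
  contMDiffOn : ∀ j, ContMDiffOn 𝓘(ℝ, V × W) (𝓡∂ 3) ∞ (h j) (Metric.ball 0 1 ×ˢ interior C)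
  immersion : ∀ j, ∀ x ∈ Metric.ball (0 : V) 1 ×ˢ interior C,
    Injective (mfderiv 𝓘(ℝ, V × W) (𝓡∂ 3) (h j) x)
  cover : ∀ z : N, z ∈ range f ∨ ∃ j, ∃ x ∈ Metric.closedBall (0 : V) 1 ×ˢ C, h j x = z
  mem_range_iff : ∀ j, ∀ x ∈ Metric.closedBall (0 : V) 1 ×ˢ C, h j x ∈ range f ↔ ‖x.1‖ = 1
  sphere : ∀ j, ∀ x ∈ Metric.closedBall (0 : V) 1 ×ˢ C, ‖x.1‖ = 1 →
    h j x ∈ f '' (𝓡∂ 3).boundary (M : Type _)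
  ends : ∀ j, ∀ x ∈ Metric.closedBall (0 : V) 1 ×ˢ C, x.2 ∉ interior C →
    (𝓡∂ 3).IsBoundaryPoint (h j x)
  isClosed : IsClosed (⋃ j, h j '' (Metric.closedBall 0 1 ×ˢ (C \ interior C)))

namespace CellAttachment

variable {f : M → N} {C : Set W} {h : J → V × W → N}

/-- The open cell. -/
def cell (C : Set W) (h : J → V × W → N) (j : J) : Set N :=
  h j '' (Metric.ball 0 1 ×ˢ interior C)

theorem isOpen_cell_and_subset [FiniteDimensional ℝ V] [FiniteDimensional ℝ W]
    (H : CellAttachment f C h) (j : J) :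
    IsOpen (cell C h j) ∧ cell C h j ⊆ (𝓡∂ 3).interior (N : Type _) := by
  obtain ⟨g, h1, h2, -⟩ := exists_smooth_leftInverse_of_injOn (I := 𝓘(ℝ, V × W)) (J := 𝓡∂ 3)
    (by rw [H.finrank]; simp) isOpen_box (H.contMDiffOn j)
    (fun x _ => ModelWithCorners.interior_eq_univ (I := 𝓘(ℝ, V × W)) (M := V × W) ▸ mem_univ x)
    ((H.injOn j).mono box_subset) (H.immersion j)
  exact ⟨h1, h2⟩

theorem isOpen_cell [FiniteDimensional ℝ V] [FiniteDimensional ℝ W]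
    (H : CellAttachment f C h) (j : J) : IsOpen (cell C h j) := (H.isOpen_cell_and_subset j).1

theorem cell_subset [FiniteDimensional ℝ V] [FiniteDimensional ℝ W]
    (H : CellAttachment f C h) (j : J) : cell C h j ⊆ (𝓡∂ 3).interior (N : Type _) :=
  (H.isOpen_cell_and_subset j).2

theorem notMem_range (H : CellAttachment f C h) {j : J} {z : N} (hz : z ∈ cell C h j) : z ∉ range f := by
  obtain ⟨x, hx, rfl⟩ := hz
  rw [H.mem_range_iff j x (box_subset hx)]
  have := hx.1
  rw [mem_ball_zero_iff] at this
  exact this.ne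

theorem eq_of_mem_cell (H : CellAttachment f C h) {i j : J} {z : N}
    (hi : z ∈ cell C h i) (hj : z ∈ cell C h j) : i = j := by
  obtain ⟨x, hx, rfl⟩ := hi
  obtain ⟨y, hy, hxy⟩ := hj
  exact H.disjoint i j x (box_subset hx) y (box_subset hy) hxy.symm

theorem snd_mem_interior (H : CellAttachment f C h) {j : J} {x : V × W}
    (hx : x ∈ Metric.closedBall (0 : V) 1 ×ˢ C) (hi : h j x ∈ (𝓡∂ 3).interior (N : Type _)) : x.2 ∈ interior C := by
  by_contra hcon
  exact (ModelWithCorners.isInteriorPoint_iff_not_isBoundaryPoint _).1 hi (H.ends j x hx hcon)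

/-- The side of a cell lies in the range of `f` and its ends lie in the boundary of `N`, so for
interior points of `N` only the open cell remains. -/
theorem mem_range_or_mem_cell (H : CellAttachment f C h) {z : N}
    (hz : z ∈ (𝓡∂ 3).interior (N : Type _)) :
    z ∈ range f ∨ ∃ j, z ∈ cell C h j := by
  rcases H.cover z with h1 | ⟨j, x, hx, rfl⟩
  · exact Or.inl h1
  · by_cases hx1 : ‖x.1‖ = 1
    · exact Or.inl ((H.mem_range_iff j x hx).2 hx1)
    · refine Or.inr ⟨j, x, ⟨?_, H.snd_mem_interior hx hz⟩, rfl⟩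
      have := hx.1
      rw [mem_closedBall_zero_iff] at this
      rw [mem_ball_zero_iff]
      exact lt_of_le_of_ne this hx1

/-- The attaching region lies in the interior of `N`. -/
theorem sphere_subset_interior [FiniteDimensional ℝ V] [FiniteDimensional ℝ W]
    (H : CellAttachment f C h) (hf : IsSmoothEmb f) {j : J} {x : V × W}
    (hx1 : ‖x.1‖ = 1) (hxC : x.2 ∈ interior C) : h j x ∈ (𝓡∂ 3).interior (N : Type _) := by
  have hx : x ∈ Metric.closedBall (0 : V) 1 ×ˢ C :=
    ⟨by simp [hx1], interior_subset hxC⟩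
  by_contra hcon
  have hbd : (𝓡∂ 3).IsBoundaryPoint (h j x) :=
    (ModelWithCorners.isBoundaryPoint_iff_not_isInteriorPoint _).2 hcon
  obtain ⟨y, hy, hyx⟩ := H.sphere j x hx hx1
  have hout : h j x ∉ ⋃ j, h j '' (Metric.closedBall 0 1 ×ˢ (C \ interior C)) := by
    intro hmem
    obtain ⟨i, x', hx', he⟩ := mem_iUnion.1 hmem
    have hx'' : x' ∈ Metric.closedBall (0 : V) 1 ×ˢ C := ⟨hx'.1, hx'.2.1⟩
    obtain rfl := H.disjoint i j x' hx'' x hx he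
    obtain rfl := H.injOn i hx'' hx he
    exact hx'.2.2 hxC
  -- Away from the closed set of ends, points outside the range lie in open cells, which are
  -- interior. If the given point were in the boundary, the range would therefore be a neighbourhood
  -- of it.
  have hev : ∀ᶠ z in 𝓝 (f y), (𝓡∂ 3).IsBoundaryPoint z → z ∈ range f := by
    rw [hyx]
    filter_upwards [H.isClosed.isOpen_compl.mem_nhds hout] with z hz hzb
    rcases H.cover z with h1 | ⟨i, x', hx', rfl⟩
    · exact h1
    · by_cases hx'1 : ‖x'.1‖ = 1
      · exact (H.mem_range_iff i x' hx').2 hx'1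
      · exfalso
        have hx'C : x'.2 ∈ interior C := by
          by_contra hcon'
          exact hz (mem_iUnion.2 ⟨i, x', ⟨hx'.1, hx'.2, hcon'⟩, rfl⟩)
        have h1 : ‖x'.1‖ ≤ 1 := by simpa using hx'.1
        exact (ModelWithCorners.isBoundaryPoint_iff_not_isInteriorPoint _).1 hzb
          (H.cell_subset i ⟨x', ⟨by simpa using lt_of_le_of_ne h1 hx'1, hx'C⟩, rfl⟩)
  have hnh := range_mem_nhds_of_boundary_subset hf hy (hyx ▸ hbd) hev
  rw [hyx] at hnh
  -- The radial segment of the cell approaches the point from outside the range, which contradicts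
  -- that the range is a neighbourhood.
  have hcont : ContinuousWithinAt (fun s : ℝ => h j (s • x.1, x.2)) (Icc 0 1) 1 := by
    have h1 := H.continuousOn j x hx
    refine ContinuousWithinAt.comp (t := Metric.closedBall (0 : V) 1 ×ˢ C) (by simpa using h1)
      (by fun_prop) fun s hs => ⟨?_, hx.2⟩
    rw [mem_closedBall_zero_iff, norm_smul, hx1, mul_one, Real.norm_of_nonneg hs.1]
    exact hs.2
  have h2 : ∀ᶠ s in 𝓝[Icc 0 1] (1 : ℝ), h j (s • x.1, x.2) ∈ range f :=
    hcont.eventually (by beta_reduce; rw [one_smul]; exact hnh)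
  have h3 : ∀ᶠ s in 𝓝[Ico 0 1] (1 : ℝ), h j (s • x.1, x.2) ∈ range f :=
    h2.filter_mono (nhdsWithin_mono _ Ico_subset_Icc_self)
  have hne : (𝓝[Ico 0 1] (1 : ℝ)).NeBot := by
    rw [← mem_closure_iff_nhdsWithin_neBot, closure_Ico (by norm_num)]
    exact ⟨zero_le_one, le_rfl⟩
  obtain ⟨s, hs, hs'⟩ := (h3.and self_mem_nhdsWithin).exists
  have hsn : ‖s • x.1‖ = s := by rw [norm_smul, hx1, mul_one, Real.norm_of_nonneg hs'.1]
  have hs1 := (H.mem_range_iff j (s • x.1, x.2) ⟨by simpa [hsn] using hs'.2.le, hx.2⟩).1 hs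
  exact hs'.2.ne (hsn.symm.trans hs1)

end CellAttachment

end Cells

/-! ### Local finiteness of cells, and pushing compact sets out of them -/

namespace CellAttachment

variable {M N : OrientedThreeManifold} {J V W : Type*}
  [NormedAddCommGroup V] [NormedSpace ℝ V] [FiniteDimensional ℝ V]
  [NormedAddCommGroup W] [NormedSpace ℝ W] [FiniteDimensional ℝ W]
  {f : M → N} {C : Set W} {h : J → V × W → N}

/-- The open cells form a locally finite family in the interior of `N`. -/
theorem exists_finite_nhds (H : CellAttachment f C h) (hf : IsSmoothEmb f) {q : N}
    (hq : q ∈ (𝓡∂ 3).interior (N : Type _)) :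
    ∃ s : Set J, s.Finite ∧ ∀ᶠ z in 𝓝 q, ∀ j, z ∈ cell C h j → j ∈ s := by
  rcases H.mem_range_or_mem_cell hq with ⟨y, rfl⟩ | ⟨j, hj⟩
  · rcases (𝓡∂ 3).isInteriorPoint_or_isBoundaryPoint y with hy | hy
    · refine ⟨∅, finite_empty, ?_⟩
      filter_upwards [hf.isOpen_image_interior.mem_nhds (mem_image_of_mem f hy)] with z hz j hj
      exact (H.notMem_range hj (image_subset_range _ _ hz)).elim
    let u := extChartAt (𝓡∂ 3) (f y)
    let w := inwardImage f y
    obtain ⟨r, hr0, hshift⟩ := exists_shift_of_isBoundaryPoint hf hy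
    let ι := interiorChart (𝓡∂ 3) (f y)
    have hmem : u (f y) ∈ ι.target := ⟨mem_extChartAt_target (f y), hq⟩
    obtain ⟨r₁, hr₁, hr₁t⟩ := Metric.mem_nhds_iff.1 (ι.open_target.mem_nhds hmem)
    obtain ⟨r', hr', hr'r, hr'r₁⟩ : ∃ r' > 0, r' ≤ r ∧ r' ≤ r₁ :=
      ⟨min r r₁, lt_min hr0 hr₁, min_le_left _ _, min_le_right _ _⟩
    have hBt : Metric.ball (u (f y)) r' ⊆ ι.target := (Metric.ball_subset_ball hr'r₁).trans hr₁t
    have hBr : Metric.ball (u (f y)) r' ⊆ Metric.ball (u (f y)) r := Metric.ball_subset_ball hr'r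
    have hint : ∀ n ∈ Metric.ball (u (f y)) r', u.symm n ∈ (𝓡∂ 3).interior (N : Type _) :=
      fun n hn => isInteriorPoint_extChartAt_symm (hBt hn).1
        (mem_interior_range_halfSpace.1 (hBt hn).2)
    obtain ⟨τ, hτ, hτw⟩ : ∃ τ > 0, τ * ‖w‖ < r' / 2 := by
      refine ⟨r' / (2 * (‖w‖ + 1)), by positivity, ?_⟩
      rw [div_mul_eq_mul_div, div_lt_iff₀ (by positivity)]
      nlinarith [norm_nonneg w]
    have hball : ∀ n ∈ Metric.ball (u (f y)) (r' / 2), ∀ s ∈ Icc 0 τ,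
        n - s • w ∈ Metric.ball (u (f y)) r' := by
      intro n hn s hs
      rw [mem_ball_iff_norm] at hn ⊢
      have h1 : ‖s • w‖ ≤ τ * ‖w‖ := by
        rw [norm_smul, Real.norm_of_nonneg hs.1]
        exact mul_le_mul_of_nonneg_right hs.2 (norm_nonneg w)
      have h2 : n - s • w - u (f y) = (n - u (f y)) - s • w := by abel
      rw [h2]
      linarith [norm_sub_le (n - u (f y)) (s • w)]
    have hback : ∀ n ∈ Metric.ball (u (f y)) (r' / 2), ∀ s ∈ Icc 0 τ, 0 < s →
        u.symm (n - s • w) ∈ range f → u.symm n ∈ f '' (𝓡∂ 3).interior (M : Type _) := by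
      intro n hn s hs hs0 hmem
      have hb := hball n hn s hs
      have := hshift (n - s • w) (hBr hb) (hBt hb).1 hmem s hs0 (by
        rw [sub_add_cancel]
        exact Metric.ball_subset_ball (by linarith) hn)
      rwa [sub_add_cancel] at this
    have hc : u (f y) ∈ Metric.ball (u (f y)) (r' / 2) := Metric.mem_ball_self (by positivity)
    have hτI : τ ∈ Icc 0 τ := ⟨hτ.le, le_rfl⟩
    -- Stepping back from `f y` against the inward image must leave the range, since shifting
    -- forward from a point of the range would put `f y` in the image of the interior. So one enters
    -- some cell `j₀`.
    obtain ⟨j₀, hj₀⟩ : ∃ j, u.symm (u (f y) - τ • w) ∈ cell C h j := by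
      refine (H.mem_range_or_mem_cell (hint _ (hball _ hc τ hτI))).resolve_left fun hmem => ?_
      obtain ⟨y', hy', he⟩ := hback _ hc τ hτI hτ hmem
      rw [extChartAt_to_inv] at he
      obtain rfl := hf.isEmbedding.injective he
      exact (ModelWithCorners.isInteriorPoint_iff_not_isBoundaryPoint _).1 hy' hy
    refine ⟨{j₀}, finite_singleton j₀, ?_⟩
    have hsc : ContinuousOn u.symm (Metric.ball (u (f y)) r') :=
      (ι.contMDiffOn_invFun.mono hBt).continuousOn
    have h1 : ∀ᶠ n in 𝓝 (u (f y)), u.symm (n - τ • w) ∈ cell C h j₀ := by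
      have hca : ContinuousAt (fun n => u.symm (n - τ • w)) (u (f y)) :=
        ContinuousAt.comp (f := fun n => n - τ • w)
          (hsc.continuousAt (Metric.isOpen_ball.mem_nhds (hball _ hc τ hτI))) (by fun_prop)
      exact hca.eventually ((H.isOpen_cell j₀).mem_nhds hj₀)
    have h2 : ∀ᶠ n in 𝓝 (u (f y)), n ∈ Metric.ball (u (f y)) (r' / 2) :=
      Metric.ball_mem_nhds _ (by positivity)
    filter_upwards [(continuousAt_extChartAt (I := 𝓡∂ 3) (f y)).eventually h1,
      (continuousAt_extChartAt (I := 𝓡∂ 3) (f y)).eventually h2,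
      extChartAt_source_mem_nhds (I := 𝓡∂ 3) (f y)] with z hz1 hz2 hzs j hzj
    have hzu : u.symm (u z) = z := u.left_inv hzs
    -- For a nearby point `z` of a cell `j` the whole backward segment avoids the range, for the
    -- same reason. Being connected it stays in cell `j`, while its far end is in cell `j₀`; hence
    -- `j = j₀`.
    have hsub : (fun s : ℝ => u.symm (u z - s • w)) '' Icc 0 τ ⊆
        cell C h j ∪ ⋃ i ∈ {i | i ≠ j}, cell C h i := by
      rintro _ ⟨s, hs, rfl⟩
      have hcell : ∃ i, u.symm (u z - s • w) ∈ cell C h i := by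
        rcases hs.1.eq_or_lt with h0 | h0
        · refine ⟨j, ?_⟩
          rw [← h0, zero_smul, sub_zero, hzu]
          exact hzj
        · refine (H.mem_range_or_mem_cell (hint _ (hball _ hz2 s hs))).resolve_left fun hmem => ?_
          have := hback _ hz2 s hs h0 hmem
          rw [hzu] at this
          exact H.notMem_range hzj (image_subset_range _ _ this)
      obtain ⟨i, hi⟩ := hcell
      by_cases hij : i = j
      · exact Or.inl (hij ▸ hi)
      · exact Or.inr (mem_biUnion (s := {i | i ≠ j}) hij hi)
    have hpre : IsPreconnected ((fun s : ℝ => u.symm (u z - s • w)) '' Icc 0 τ) :=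
      isPreconnected_Icc.image _ (hsc.comp (by fun_prop) fun s hs => hball _ hz2 s hs)
    have hleft := hpre.subset_left_of_subset_union (H.isOpen_cell j)
      (isOpen_biUnion fun i _ => H.isOpen_cell i)
      (by
        refine disjoint_left.2 fun x hx hx' => ?_
        obtain ⟨i, hi, hxi⟩ := mem_iUnion₂.1 hx'
        exact hi (H.eq_of_mem_cell hxi hx)) hsub
      ⟨z, ⟨0, ⟨le_rfl, hτ.le⟩, by simp only [zero_smul, sub_zero]; exact hzu⟩, hzj⟩
    exact H.eq_of_mem_cell (hleft ⟨τ, hτI, rfl⟩) hz1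
  · refine ⟨{j}, finite_singleton j, ?_⟩
    filter_upwards [(H.isOpen_cell j).mem_nhds hj] with z hz i hi
    exact H.eq_of_mem_cell hi hz

/-- A compact set of interior points meets only finitely many cells. -/
theorem finite_setOf_inter_nonempty (H : CellAttachment f C h) (hf : IsSmoothEmb f) {K : Set N}
    (hK : IsCompact K) (hKi : K ⊆ (𝓡∂ 3).interior (N : Type _)) :
    {j | (K ∩ cell C h j).Nonempty}.Finite := by
  refine hK.induction_on (p := fun K => {j | (K ∩ cell C h j).Nonempty}.Finite) ?_ ?_ ?_ ?_
  · simp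
  · intro s t hst ht
    exact ht.subset fun j hj => hj.mono (inter_subset_inter_left _ hst)
  · intro s t hs ht
    refine (hs.union ht).subset fun j hj => ?_
    obtain ⟨z, hz | hz, hzj⟩ := hj
    · exact Or.inl ⟨z, hz, hzj⟩
    · exact Or.inr ⟨z, hz, hzj⟩
  · intro q hq
    obtain ⟨s, hs, hev⟩ := H.exists_finite_nhds hf (hKi hq)
    exact ⟨_, mem_nhdsWithin_of_mem_nhds hev, hs.subset fun j ⟨z, hz, hzj⟩ => hz j hzj⟩

/-- A compact set of interior points of `N` that misses the axis over a point of each ball can be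
pushed into the image of the interior of `M`. -/
theorem exists_push (H : CellAttachment f C h) (hf : IsSmoothEmb f) {K : Set N}
    (hK : IsCompact K) (hKi : K ⊆ (𝓡∂ 3).interior (N : Type _)) {p : J → V}
    (hp : ∀ j, ‖p j‖ < 1) (hKp : ∀ j, ∀ x ∈ Metric.ball (0 : V) 1 ×ˢ interior C, h j x ∈ K →
      x.1 ≠ p j) :
    ∃ Φ : ℝ → Diffeomorph (𝓡∂ 3) (𝓡∂ 3) N N ∞, IsAmbientIsotopy Φ ∧
      (∀ t, ∀ z ∈ f '' (𝓡∂ 3).interior (M : Type _), Φ t z ∈ f '' (𝓡∂ 3).interior (M : Type _)) ∧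
      ∀ z ∈ K, Φ 1 z ∈ f '' (𝓡∂ 3).interior (M : Type _) := by
  let J₀ : Set J := {j | (K ∩ cell C h j).Nonempty}
  have hJ₀ : J₀.Finite := H.finite_setOf_inter_nonempty hf hK hKi
  have hbox : IsCompact (Metric.closedBall (0 : V) 1 ×ˢ C) :=
    (isCompact_closedBall 0 1).prod H.isCompact
  let D : J → Set (V × W) := fun j => Metric.closedBall (0 : V) 1 ×ˢ C ∩ h j ⁻¹' K
  have hD : ∀ j, IsCompact (D j) := fun j =>
    hbox.of_isClosed_subset ((H.continuousOn j).preimage_isClosed_of_isClosed hbox.isClosed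
      hK.isClosed) inter_subset_left
  let C' : J → Set W := fun j => Prod.snd '' D j
  have hC' : ∀ j, IsCompact (C' j) := fun j => (hD j).image continuous_snd
  have hC'C : ∀ j, C' j ⊆ interior C := by
    rintro j _ ⟨x, hx, rfl⟩
    exact H.snd_mem_interior hx.1 (hKi hx.2)
  have hside : ∀ j, ∀ x ∈ Metric.sphere (0 : V) 1 ×ˢ C' j, ‖x.1‖ = 1 ∧ x.2 ∈ interior C ∧
      x ∈ Metric.closedBall (0 : V) 1 ×ˢ C := fun j x hx =>
    ⟨by simpa using hx.1, hC'C j hx.2, Metric.sphere_subset_closedBall hx.1,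
      interior_subset (hC'C j hx.2)⟩
  -- Everything to be carried across the attaching region: the part of `K` outside the cells, and
  -- the portions of the attaching spheres over the second coordinates that occur in `K`. It is
  -- compact because only finitely many cells meet `K`.
  let A : Set N := (K \ ⋃ j, cell C h j) ∪ ⋃ j ∈ J₀, h j '' (Metric.sphere (0 : V) 1 ×ˢ C' j)
  have hA : IsCompact A := by
    refine (hK.diff (isOpen_iUnion fun j => H.isOpen_cell j)).union
      (hJ₀.isCompact_biUnion fun j _ => ?_)
    exact ((isCompact_sphere 0 1).prod (hC' j)).image_of_continuousOn
      ((H.continuousOn j).mono fun x hx => (hside j x hx).2.2)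
  have hAfi : ∀ z ∈ A, z ∈ range f ∧ z ∈ (𝓡∂ 3).interior (N : Type _) := by
    rintro z (⟨hzK, hz⟩ | hz)
    · exact ⟨(H.mem_range_or_mem_cell (hKi hzK)).resolve_right
        fun ⟨j, hj⟩ => hz (mem_iUnion.2 ⟨j, hj⟩), hKi hzK⟩
    · obtain ⟨j, -, x, hx, rfl⟩ := mem_iUnion₂.1 hz
      obtain ⟨h1, h2, h3⟩ := hside j x hx
      exact ⟨(H.mem_range_iff j x h3).2 h1, H.sphere_subset_interior hf h1 h2⟩
  obtain ⟨Q, hQ, hQf, hQA⟩ := exists_isotopy_cross hf hA (fun z hz => (hAfi z hz).1)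
    (fun z hz => (hAfi z hz).2)
  let S : Set N := f '' (𝓡∂ 3).interior (M : Type _)
  -- The crossing `Q` is fixed first but applied last. Its open preimage `O` contains `A`, so the
  -- radial pushes need only reach `O`, not the attaching sphere itself.
  let O : Set N := Q 1 ⁻¹' S
  have hO : IsOpen O := hf.isOpen_image_interior.preimage (Q 1).continuous
  have hR : ∀ j ∈ J₀, ∃ R : ℝ → Diffeomorph (𝓡∂ 3) (𝓡∂ 3) N N ∞, IsAmbientIsotopy R ∧
      (∀ t, ∀ z ∉ cell C h j, R t z = z) ∧
      ∀ z ∈ K ∩ cell C h j, R 1 z ∈ O ∩ cell C h j := by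
    intro j hj
    let T : Set (V × W) := Metric.closedBall (0 : V) 1 ×ˢ C' j
    have hT : IsCompact T := (isCompact_closedBall 0 1).prod (hC' j)
    have hTb : T ⊆ Metric.closedBall (0 : V) 1 ×ˢ C :=
      prod_mono Subset.rfl ((hC'C j).trans interior_subset)
    -- The points that `Q` would fail to carry across form a compact set disjoint from the attaching
    -- sphere, hence lie within a radius smaller than one.
    let X : Set (V × W) := T ∩ h j ⁻¹' Oᶜ
    have hX : IsCompact X := hT.of_isClosed_subset
      (((H.continuousOn j).mono hTb).preimage_isClosed_of_isClosed hT.isClosed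
        hO.isClosed_compl) inter_subset_left
    obtain ⟨ρ, hρ1, hρX⟩ : ∃ ρ < 1, ∀ x ∈ X, ‖x.1‖ ≤ ρ := by
      rcases X.eq_empty_or_nonempty with h0 | h0
      · exact ⟨0, one_pos, fun x hx => by rw [h0] at hx; exact hx.elim⟩
      · obtain ⟨x₀, hx₀, hmax⟩ := hX.exists_isMaxOn h0
          (f := fun x : V × W => ‖x.1‖) (by fun_prop)
        refine ⟨‖x₀.1‖, lt_of_le_of_ne (by simpa using hx₀.1.1) fun h1 => hx₀.2 ?_, hmax⟩
        exact hQA _ (Or.inr (mem_biUnion hj ⟨x₀, ⟨by simpa using h1, hx₀.1.2⟩, rfl⟩))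
    obtain ⟨ρ', hρρ', hpρ', hρ'1⟩ : ∃ ρ', ρ ≤ ρ' ∧ ‖p j‖ ≤ ρ' ∧ ρ' < 1 :=
      ⟨max ρ ‖p j‖, le_max_left _ _, le_max_right _ _, max_lt hρ1 (hp j)⟩
    obtain ⟨η, hη, hηD⟩ := (hD j).exists_forall_le' (f := fun x : V × W => ‖x.1 - p j‖)
      (by fun_prop) (a := 0) (fun x hx => by
        rw [norm_pos_iff, sub_ne_zero]
        intro he
        have hx1 : x.1 ∈ Metric.ball (0 : V) 1 := by
          rw [he]; simpa using hp j
        exact hKp j x ⟨hx1, H.snd_mem_interior hx.1 (hKi hx.2)⟩ hx.2 he)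
    obtain ⟨R, hR, hRn, hRx⟩ := exists_isotopy_radial H.finrank isOpen_box (H.contMDiffOn j)
      ((H.injOn j).mono box_subset) (H.immersion j) (hC' j)
      (prod_mono (Metric.closedBall_subset_ball hρ'1) (hC'C j)) hpρ' hη
    refine ⟨R, hR, hRn, ?_⟩
    rintro _ ⟨hzK, x, hx, rfl⟩
    have hxD : x ∈ D j := ⟨box_subset hx, hzK⟩
    obtain ⟨x', hx', hx'C, hx'ρ, he⟩ := hRx x hx (mem_image_of_mem _ hxD) (hηD x hxD)
    rw [he]
    refine ⟨by_contra fun hcon => ?_, mem_image_of_mem _ hx'⟩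
    exact absurd (hρX x' ⟨⟨Metric.ball_subset_closedBall hx'.1, hx'C⟩, hcon⟩) (by linarith)
  -- The pushes in distinct cells have disjoint supports and keep `K ∩ cell C h j` in its cell, so
  -- they compose without interference.
  have hall : ∀ s : Finset J, (∀ j ∈ s, j ∈ J₀) →
      ∃ R : ℝ → Diffeomorph (𝓡∂ 3) (𝓡∂ 3) N N ∞, IsAmbientIsotopy R ∧
      (∀ t, ∀ z, (∀ j ∈ s, z ∉ cell C h j) → R t z = z) ∧
      ∀ j ∈ s, ∀ z ∈ K ∩ cell C h j, R 1 z ∈ O := by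
    classical
    intro s
    induction s using Finset.induction_on with
    | empty =>
      exact fun _ => ⟨_, IsAmbientIsotopy.refl N, fun _ _ _ => rfl, fun j hj => by simp at hj⟩
    | insert j s hjs ih =>
      intro hs
      obtain ⟨R, hR1, hR2, hR3⟩ := ih fun i hi => hs i (Finset.mem_insert_of_mem hi)
      obtain ⟨R', hR1', hR2', hR3'⟩ := hR j (hs j (Finset.mem_insert_self j s))
      refine ⟨_, hR1'.trans hR1, fun t z hz => ?_, fun i hi z hz => ?_⟩
      · change R t (R' t z) = z
        rw [hR2' t z (hz j (Finset.mem_insert_self j s)),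
          hR2 t z fun i hi => hz i (Finset.mem_insert_of_mem hi)]
      · change R 1 (R' 1 z) ∈ O
        rcases Finset.mem_insert.1 hi with rfl | hi
        · obtain ⟨h1, h2⟩ := hR3' z hz
          rw [hR2 1 _ fun i' hi' hmem => hjs (H.eq_of_mem_cell hmem h2 ▸ hi')]
          exact h1
        · rw [hR2' 1 z fun hmem => hjs (H.eq_of_mem_cell hmem hz.2 ▸ hi)]
          exact hR3 i hi z hz
  obtain ⟨R, hR1, hR2, hR3⟩ := hall hJ₀.toFinset fun j hj => hJ₀.mem_toFinset.1 hj
  have hRf : ∀ t, ∀ z ∈ range f, R t z = z := fun t z hz =>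
    hR2 t z fun j _ hmem => H.notMem_range hmem hz
  refine ⟨_, hR1.trans hQ, fun t z hz => ?_, fun z hz => ?_⟩
  · change Q t (R t z) ∈ _
    rw [hRf t z (image_subset_range _ _ hz)]
    rcases hQf t z (image_subset_range _ _ hz) with h1 | h1
    · rwa [h1]
    · exact h1
  · change Q 1 (R 1 z) ∈ _
    by_cases hzc : ∃ j, z ∈ cell C h j
    · obtain ⟨j, hj⟩ := hzc
      exact hR3 j (hJ₀.mem_toFinset.2 ⟨z, hz, hj⟩) z ⟨hz, hj⟩
    · rw [hR2 1 z fun j _ hmem => hzc ⟨j, hmem⟩]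
      exact hQA z (Or.inl ⟨hz, fun hmem => hzc (mem_iUnion.1 hmem)⟩)

end CellAttachment

/-! ### General position by Hausdorff dimension -/

section GeneralPosition

variable {E V W : Type*} [NormedAddCommGroup E] [NormedSpace ℝ E] [FiniteDimensional ℝ E]
  [NormedAddCommGroup V] [NormedSpace ℝ V] [FiniteDimensional ℝ V]
  [NormedAddCommGroup W] [NormedSpace ℝ W] [FiniteDimensional ℝ W]

/-- General position: in an embedded cell `V × W`, smooth families of dimension less than that of
`V` miss an axis `{p} × W`, and `p` may be taken in any given open set. -/
theorem exists_axis_avoiding (hdim : Module.finrank ℝ (V × W) = 3)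
    (hE : Module.finrank ℝ E < Module.finrank ℝ V) {N : OrientedThreeManifold}
    {ι : Type*} [Countable ι] {γ : ι → E → N} (hγ : ∀ i, ContMDiff 𝓘(ℝ, E) (𝓡∂ 3) ∞ (γ i))
    {c : V × W → N} {B : Set (V × W)} (hB : IsOpen B)
    (hc : ContMDiffOn 𝓘(ℝ, V × W) (𝓡∂ 3) ∞ c B) (hinj : InjOn c B)
    (himm : ∀ x ∈ B, Injective (mfderiv 𝓘(ℝ, V × W) (𝓡∂ 3) c x))
    {U : Set V} (hU : IsOpen U) (hUn : U.Nonempty) :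
    ∃ p ∈ U, ∀ x ∈ B, ∀ i e, γ i e = c x → x.1 ≠ p := by
  obtain ⟨g, hVo, hVi, hg, hgc⟩ := exists_smooth_leftInverse_of_injOn (I := 𝓘(ℝ, V × W))
    (J := 𝓡∂ 3) (by rw [hdim]; simp) hB hc
    (fun x _ => ModelWithCorners.interior_eq_univ (I := 𝓘(ℝ, V × W)) (M := V × W) ▸ mem_univ x)
    hinj himm
  let T : ι → Set E := fun i => γ i ⁻¹' (c '' B)
  let F : ι → E → V := fun i e => (g (γ i e)).1
  -- Smooth maps are locally Lipschitz and do not raise Hausdorff dimension; a countable union of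
  -- the projected images still has dimension below that of `V`, so its complement is dense.
  have hdimH : dimH (⋃ i, F i '' T i) < Module.finrank ℝ V := by
    rw [dimH_iUnion]
    refine lt_of_le_of_lt (iSup_le fun i => ?_) (Nat.cast_lt.2 hE)
    have hT : IsOpen (T i) := hVo.preimage (hγ i).continuous
    refine (dimH_image_le_of_locally_lipschitzOn fun e he => ?_).trans
      ((dimH_mono (subset_univ _)).trans (Real.dimH_univ_eq_finrank E).le)
    have h1 : ContMDiffAt 𝓘(ℝ, E) 𝓘(ℝ, V × W) ∞ (fun e => g (γ i e)) e :=
      ContMDiffAt.comp e (hg.contMDiffAt (hVo.mem_nhds he)) (hγ i e)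
    have h2 : ContDiffAt ℝ 1 (F i) e :=
      (contDiffAt_fst.comp e h1.contDiffAt).of_le (by norm_cast)
    obtain ⟨K, t, ht, hK⟩ := h2.exists_lipschitzOnWith
    exact ⟨K, t, mem_nhdsWithin_of_mem_nhds ht, hK⟩
  obtain ⟨p, hpU, hp⟩ := (dense_compl_of_dimH_lt_finrank hdimH).inter_open_nonempty U hU hUn
  refine ⟨p, hpU, fun x hx i e he hxp => hp ?_⟩
  refine mem_iUnion.2 ⟨i, e, ⟨x, hx, he.symm⟩, ?_⟩
  change (g (γ i e)).1 = p
  rw [he, hgc x hx, hxp]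

end GeneralPosition

/-! ### Pulling links and isotopies back along an embedding -/

section Pullback

variable {M N : OrientedThreeManifold}

theorem carriesOrientation_id {V : Type*} [AddCommGroup V] [Module ℝ V]
    (o : Orientation ℝ V (Fin 3)) : CarriesOrientation (LinearMap.id : V →ₗ[ℝ] V) o o :=
  ⟨LinearEquiv.refl ℝ V, rfl, by simp⟩

/-- A left inverse of an orientation preserving map preserves the orientation. -/
theorem carriesOrientation_leftInverse {f : M → N} {g : N → M} {x : M}
    (hf : MDifferentiableAt (𝓡∂ 3) (𝓡∂ 3) f x) (hg : MDifferentiableAt (𝓡∂ 3) (𝓡∂ 3) g (f x))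
    (hgf : ∀ᶠ y in 𝓝 x, g (f y) = y)
    (hor : CarriesOrientation (mfderiv (𝓡∂ 3) (𝓡∂ 3) f x).toLinearMap (M.orient x)
      (N.orient (f x))) :
    CarriesOrientation (mfderiv (𝓡∂ 3) (𝓡∂ 3) g (f x)).toLinearMap (N.orient (f x))
      (M.orient (g (f x))) := by
  have hcomp : mfderiv (𝓡∂ 3) (𝓡∂ 3) (g ∘ f) x =
      (mfderiv (𝓡∂ 3) (𝓡∂ 3) g (f x)).comp (mfderiv (𝓡∂ 3) (𝓡∂ 3) f x) :=
    mfderiv_comp x hg hf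
  have hid : (g ∘ f) =ᶠ[𝓝 x] id := hgf
  have hlin : ((mfderiv (𝓡∂ 3) (𝓡∂ 3) g (f x)).toLinearMap ∘ₗ
      (mfderiv (𝓡∂ 3) (𝓡∂ 3) f x).toLinearMap : E3 →ₗ[ℝ] E3) = LinearMap.id := by
    have h1 : ((mfderiv (𝓡∂ 3) (𝓡∂ 3) g (f x)).comp
        (mfderiv (𝓡∂ 3) (𝓡∂ 3) f x) : E3 →L[ℝ] E3) = ContinuousLinearMap.id ℝ E3 :=
      hcomp.symm.trans (hid.mfderiv_eq.trans mfderiv_id)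
    exact congrArg ContinuousLinearMap.toLinearMap h1
  refine hor.of_comp_left ?_
  have h2 : (M.orient (g (f x)) : Orientation ℝ E3 (Fin 3)) = M.orient x := by
    rw [hgf.self_of_nhds]
  have h3 : ∀ (o : Orientation ℝ E3 (Fin 3)) (A : E3 →ₗ[ℝ] E3), A = LinearMap.id →
      o = M.orient x → CarriesOrientation A (M.orient x) o := by
    rintro o A rfl rfl
    exact carriesOrientation_id _
  exact h3 _ _ hlin h2

/-- The inverse of an oriented embedding, on the image of the interior. -/
theorem OrientedEmbedding.exists_inverse [Nonempty M] (f : OrientedEmbedding M N) :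
    ∃ g : N → M, ContMDiffOn (𝓡∂ 3) (𝓡∂ 3) ∞ g (f.toFun '' (𝓡∂ 3).interior (M : Type _)) ∧
      (∀ x ∈ (𝓡∂ 3).interior (M : Type _), g (f.toFun x) = x) ∧
      ∀ z ∈ f.toFun '' (𝓡∂ 3).interior (M : Type _), f.toFun (g z) = z ∧
        CarriesOrientation (mfderiv (𝓡∂ 3) (𝓡∂ 3) g z).toLinearMap (N.orient z)
          (M.orient (g z)) := by
  obtain ⟨g, hS, -, hg, hgf⟩ := f.isSmoothEmb.exists_leftInverse
  refine ⟨g, hg, hgf, ?_⟩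
  rintro _ ⟨x, hx, rfl⟩
  refine ⟨by rw [hgf x hx], carriesOrientation_leftInverse
    ((f.isSmoothEmb.contMDiff x).mdifferentiableAt (by simp))
    ((hg.contMDiffAt (hS.mem_nhds (mem_image_of_mem _ hx))).mdifferentiableAt (by simp)) ?_
    (f.orientation_preserving x)⟩
  filter_upwards [(isOpen_interior_manifold M).mem_nhds hx] with y hy
  exact hgf y hy

/-- A link in the image of the interior is the image of a link. -/
theorem OrientedEmbedding.exists_mapLink_eq (f : OrientedEmbedding M N) (L : OrientedLink N)
    (hL : L.support ⊆ f.toFun '' (𝓡∂ 3).interior (M : Type _)) :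
    ∃ L₀ : OrientedLink M, f.mapLink L₀ = L := by
  rcases isEmpty_or_nonempty M with hM | hM
  · obtain ⟨L₀, -⟩ := OrientedLink.exists_of_finite (M := M) (ι := Empty)
      (γ := fun i => i.elim) (fun i => i.elim) (fun i => i.elim) (fun i => i.elim)
      (fun i => i.elim) (fun i => i.elim)
    have hE : IsEmpty (TangentBundle (𝓡∂ 3) M) := ⟨fun p => hM.false p.proj⟩
    refine ⟨L₀, OrientedLink.ext ?_⟩
    rw [f.mapLink_carrier, eq_empty_of_isEmpty L₀.carrier, image_empty]
    refine (eq_empty_of_forall_notMem fun p hp => ?_).symm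
    obtain ⟨x, -⟩ := hL (OrientedLink.mem_support_of_mem hp)
    exact hM.false x
  obtain ⟨g, hg, hgf, hfg⟩ := f.exists_inverse
  have hS := f.isSmoothEmb.isOpen_image_interior
  obtain ⟨L₀, hL₀⟩ := L.exists_map hS hg
    (fun z hz z' hz' h => by rw [← (hfg z hz).1, h, (hfg z' hz').1])
    (fun z hz => (hfg z hz).2.injective) hL
  refine ⟨L₀, OrientedLink.ext ?_⟩
  rw [f.mapLink_carrier, hL₀, image_image]
  have h1 : ∀ p ∈ L.carrier, tangentMap (𝓡∂ 3) (𝓡∂ 3) f.toFun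
      (tangentMap (𝓡∂ 3) (𝓡∂ 3) g p) = p := fun p hp => by
    have hpS := hL (OrientedLink.mem_support_of_mem hp)
    have h2 : tangentMap (𝓡∂ 3) (𝓡∂ 3) (f.toFun ∘ g) p = tangentMap (𝓡∂ 3) (𝓡∂ 3) f.toFun
        (tangentMap (𝓡∂ 3) (𝓡∂ 3) g p) :=
      tangentMap_comp_at p (f.isSmoothEmb.contMDiff.mdifferentiable (by simp) _)
        ((hg.contMDiffAt (hS.mem_nhds hpS)).mdifferentiableAt (by simp))
    rw [← h2, tangentMap_congr_of_eventuallyEq (g := id), tangentMap_id]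
    · rfl
    · filter_upwards [hS.mem_nhds hpS] with z hz
      exact (hfg z hz).1
  rw [image_congr h1, image_id']

/-- Tangent vectors of a link in the interior are recovered from those of its image. -/
theorem OrientedEmbedding.carrier_eq_of_inverse (f : OrientedEmbedding M N) {g : N → M}
    (hg : ContMDiffOn (𝓡∂ 3) (𝓡∂ 3) ∞ g (f.toFun '' (𝓡∂ 3).interior (M : Type _)))
    (hgf : ∀ x ∈ (𝓡∂ 3).interior (M : Type _), g (f.toFun x) = x) (L : OrientedLink M) :
    L.carrier = tangentMap (𝓡∂ 3) (𝓡∂ 3) g '' (f.mapLink L).carrier := by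
  have hS := f.isSmoothEmb.isOpen_image_interior
  rw [f.mapLink_carrier, image_image]
  have h1 : ∀ p ∈ L.carrier, tangentMap (𝓡∂ 3) (𝓡∂ 3) g
      (tangentMap (𝓡∂ 3) (𝓡∂ 3) f.toFun p) = p := fun p hp => by
    have hpi := L.support_subset_interior (OrientedLink.mem_support_of_mem hp)
    have h2 : tangentMap (𝓡∂ 3) (𝓡∂ 3) (g ∘ f.toFun) p = tangentMap (𝓡∂ 3) (𝓡∂ 3) g
        (tangentMap (𝓡∂ 3) (𝓡∂ 3) f.toFun p) :=
      tangentMap_comp_at p ((hg.contMDiffAt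
        (hS.mem_nhds (mem_image_of_mem _ hpi))).mdifferentiableAt (by simp))
        (f.isSmoothEmb.contMDiff.mdifferentiable (by simp) _)
    rw [← h2, tangentMap_congr_of_eventuallyEq (g := id), tangentMap_id]
    · rfl
    · filter_upwards [(isOpen_interior_manifold M).mem_nhds hpi] with x hx
      exact hgf x hx
  rw [image_congr h1, image_id']

/-- If an ambient isotopy keeps a link in the image of the interior, then the preimages of the first
and last link are ambient isotopic. -/
theorem OrientedEmbedding.ambientIsotopic_of_track (f : OrientedEmbedding M N) {B : OrientedLink N}
    {Ψ : ℝ → Diffeomorph (𝓡∂ 3) (𝓡∂ 3) N N ∞}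
    (hΨ : ContMDiff (𝓘(ℝ, ℝ).prod (𝓡∂ 3)) (𝓡∂ 3) ∞ (fun p : ℝ × N => Ψ p.1 p.2))
    (hS : ∀ t ∈ Icc (0 : ℝ) 1, ∀ z ∈ B.support,
      Ψ t z ∈ f.toFun '' (𝓡∂ 3).interior (M : Type _)) {L L' : OrientedLink M}
    (h₀ : (f.mapLink L).carrier = tangentMap (𝓡∂ 3) (𝓡∂ 3) (Ψ 0) '' B.carrier)
    (h₁ : (f.mapLink L').carrier = tangentMap (𝓡∂ 3) (𝓡∂ 3) (Ψ 1) '' B.carrier) :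
    AmbientIsotopic L L' := by
  rcases isEmpty_or_nonempty M with hM | hM
  · have hE : IsEmpty (TangentBundle (𝓡∂ 3) M) := ⟨fun p => hM.false p.proj⟩
    have : L = L' := OrientedLink.ext (by
      rw [eq_empty_of_isEmpty L.carrier, eq_empty_of_isEmpty L'.carrier])
    exact this ▸ AmbientIsotopic.refl L
  obtain ⟨g, hg, hgf, hfg⟩ := f.exists_inverse
  have hSo := f.isSmoothEmb.isOpen_image_interior
  -- The maps `g ∘ Ψ t` are defined only where `Ψ` stays in the image of the interior; this open set
  -- contains the track of the link, which is enough for isotopy extension in `M`.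
  let O : Set (ℝ × N) := (fun p : ℝ × N => Ψ p.1 p.2) ⁻¹'
    (f.toFun '' (𝓡∂ 3).interior (M : Type _))
  have hgd : ∀ z ∈ f.toFun '' (𝓡∂ 3).interior (M : Type _),
      MDifferentiableAt (𝓡∂ 3) (𝓡∂ 3) g z := fun z hz =>
    (hg.contMDiffAt (hSo.mem_nhds hz)).mdifferentiableAt (by simp)
  have hcar : ∀ t ∈ Icc (0 : ℝ) 1, ∀ A : OrientedLink M,
      (f.mapLink A).carrier = tangentMap (𝓡∂ 3) (𝓡∂ 3) (Ψ t) '' B.carrier →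
      A.carrier = tangentMap (𝓡∂ 3) (𝓡∂ 3) (fun z => g (Ψ t z)) '' B.carrier := by
    intro t ht A hA
    rw [f.carrier_eq_of_inverse hg hgf A, hA, image_image]
    refine image_congr fun p hp => ?_
    exact (tangentMap_comp_at (g := g) (f := Ψ t) p
      (hgd _ (hS t ht _ (OrientedLink.mem_support_of_mem hp)))
      (mdifferentiable_diffeomorph (Ψ t) _)).symm
  refine (AmbientIsotopicIn.of_family (U := univ) (F := fun t z => g (Ψ t z)) (O := O) B
    (hSo.preimage hΨ.continuous) (hg.comp hΨ.contMDiffOn fun p hp => hp) ?_ ?_ hS isOpen_univ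
    (fun _ _ _ _ => mem_univ _) (hcar 0 (by simp) L h₀) (hcar 1 (by simp) L' h₁)).ambientIsotopic
  · intro t _ z hz z' hz' he
    have : Ψ t z = Ψ t z' :=
      (hfg _ hz).1.symm.trans ((congrArg f.toFun he).trans (hfg _ hz').1)
    exact (Ψ t).injective this
  · intro t _ z hz
    have : mfderiv (𝓡∂ 3) (𝓡∂ 3) (fun z => g (Ψ t z)) z =
        (mfderiv (𝓡∂ 3) (𝓡∂ 3) g (Ψ t z)).comp (mfderiv (𝓡∂ 3) (𝓡∂ 3) (Ψ t) z) :=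
      mfderiv_comp z (hgd _ hz) (mdifferentiable_diffeomorph (Ψ t) z)
    rw [this]
    exact (hfg _ hz).2.injective.comp (injective_mfderiv_diffeomorph (Ψ t) z)

end Pullback

/-! ### Moving links and isotopies off the cells -/

namespace CellAttachment

variable {M N : OrientedThreeManifold} {J V W : Type*}
  [NormedAddCommGroup V] [NormedSpace ℝ V] [FiniteDimensional ℝ V]
  [NormedAddCommGroup W] [NormedSpace ℝ W] [FiniteDimensional ℝ W]
  {C : Set W} {h : J → V × W → N}

theorem _root_.Skein.OrientedLink.exists_diffeomorph_image (L : OrientedLink N)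
    (Φ : Diffeomorph (𝓡∂ 3) (𝓡∂ 3) N N ∞) :
    ∃ L' : OrientedLink N, L'.carrier = tangentMap (𝓡∂ 3) (𝓡∂ 3) Φ '' L.carrier :=
  L.exists_map isOpen_univ Φ.contMDiff.contMDiffOn Φ.injective.injOn
    (fun x _ => injective_mfderiv_diffeomorph Φ x) (subset_univ _)

/-- Every link can be moved off the cells. -/
theorem exists_ambientIsotopic_mapLink {f : OrientedEmbedding M N}
    (H : CellAttachment f.toFun C h) (hV : 1 < Module.finrank ℝ V) (L : OrientedLink N) :
    ∃ L₀ : OrientedLink M, AmbientIsotopic L (f.mapLink L₀) := by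
  obtain ⟨n, γ, hγ, hL⟩ := L.exists_param
  have hp : ∀ j, ∃ p ∈ Metric.ball (0 : V) 1, ∀ x ∈ Metric.ball (0 : V) 1 ×ˢ interior C,
      ∀ i e, γ i e = h j x → x.1 ≠ p := fun j =>
    exists_axis_avoiding H.finrank (by simpa using hV) hγ.contMDiff isOpen_box (H.contMDiffOn j)
      ((H.injOn j).mono box_subset) (H.immersion j) Metric.isOpen_ball (by simp)
  choose p hp1 hp2 using hp
  have hsupp : L.support = {x | ∃ i t, γ i t = x} := by
    rw [OrientedLink.support, hL, OrientedLink.proj_image_setOf]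
  obtain ⟨Φ, hΦ, -, hΦK⟩ := H.exists_push f.isSmoothEmb L.isCompact_support
    L.support_subset_interior (p := p) (fun j => by simpa using hp1 j) (fun j x hx hxL => by
      rw [hsupp] at hxL
      obtain ⟨i, t, he⟩ := hxL
      exact hp2 j x hx i t he)
  obtain ⟨L₁, hL₁⟩ := L.exists_diffeomorph_image (Φ 1)
  obtain ⟨L₀, hL₀⟩ := f.exists_mapLink_eq L₁ (by
    rw [OrientedLink.support_eq_image hL₁]
    rintro _ ⟨z, hz, rfl⟩
    exact hΦK z hz)
  exact ⟨L₀, Φ, hΦ.contMDiff, hΦ.zero, by rw [hL₀, hL₁]⟩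

/-- Links that are isotopic after attaching cells of index three are isotopic. -/
theorem ambientIsotopic_of_mapLink {f : OrientedEmbedding M N}
    (H : CellAttachment f.toFun C h) (hV : 2 < Module.finrank ℝ V) {L L' : OrientedLink M}
    (hLL' : AmbientIsotopic (f.mapLink L) (f.mapLink L')) : AmbientIsotopic L L' := by
  obtain ⟨Φ, hΦ, hΦ0, hΦ1⟩ := hLL'
  obtain ⟨n, γ, hγ, hL⟩ := (f.mapLink L).exists_param
  have hsupp : (f.mapLink L).support = {x | ∃ i t, γ i t = x} := by
    rw [OrientedLink.support, hL, OrientedLink.proj_image_setOf]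
  let K : Set N := (fun q : ℝ × N => Φ q.1 q.2) '' (Icc (0 : ℝ) 1 ×ˢ (f.mapLink L).support)
  have hK : IsCompact K :=
    (isCompact_Icc.prod (f.mapLink L).isCompact_support).image hΦ.continuous
  have hKi : K ⊆ (𝓡∂ 3).interior (N : Type _) := by
    rintro _ ⟨⟨t, z⟩, ⟨-, hz⟩, rfl⟩
    exact (mdifferentiable_diffeomorph (Φ t) z).isInteriorPoint_of_surjective_mfderiv
      (surjective_mfderiv_of_injective rfl (injective_mfderiv_diffeomorph (Φ t) z))
      ((f.mapLink L).support_subset_interior hz)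
  -- The track of a link under the isotopy is a two-parameter family, which is why `V` must have
  -- dimension greater than two.
  have htr : ∀ i, ContMDiff 𝓘(ℝ, ℝ × ℝ) (𝓡∂ 3) ∞ (fun q : ℝ × ℝ => Φ q.1 (γ i q.2)) := fun i =>
    ContMDiff.comp (g := fun q : ℝ × N => Φ q.1 q.2) hΦ
      (ContMDiff.prodMk (contDiff_fst.contMDiff)
        ((hγ.contMDiff i).comp (contDiff_snd (E := ℝ) (F := ℝ)).contMDiff))
  have hp : ∀ j, ∃ p ∈ Metric.ball (0 : V) 1, ∀ x ∈ Metric.ball (0 : V) 1 ×ˢ interior C,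
      ∀ i (e : ℝ × ℝ), Φ e.1 (γ i e.2) = h j x → x.1 ≠ p := fun j =>
    exists_axis_avoiding H.finrank (by simpa using hV) htr isOpen_box (H.contMDiffOn j)
      ((H.injOn j).mono box_subset) (H.immersion j) Metric.isOpen_ball (by simp)
  choose p hp1 hp2 using hp
  obtain ⟨P, hP, hPS, hPK⟩ := H.exists_push f.isSmoothEmb hK hKi (p := p)
    (fun j => by simpa using hp1 j) (fun j x hx hxL => by
      obtain ⟨⟨t, z⟩, ⟨-, hz⟩, he⟩ := hxL
      rw [hsupp] at hz
      obtain ⟨i, s, rfl⟩ := hz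
      exact hp2 j x hx i (t, s) he)
  -- The push preserves the image of the interior at all times, so its effect on a link coming from
  -- `M` is already an isotopy in `M`.
  have hmove : ∀ A : OrientedLink M, ∃ A' : OrientedLink M, AmbientIsotopic A A' ∧
      (f.mapLink A').carrier =
        tangentMap (𝓡∂ 3) (𝓡∂ 3) (P 1) '' (f.mapLink A).carrier := by
    intro A
    have hAS : ∀ z ∈ (f.mapLink A).support, z ∈ f.toFun '' (𝓡∂ 3).interior (M : Type _) := by
      rw [OrientedLink.support_eq_image (f.mapLink_carrier A)]
      exact image_mono A.support_subset_interior
    obtain ⟨B, hB⟩ := (f.mapLink A).exists_diffeomorph_image (P 1)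
    obtain ⟨A', hA'⟩ := f.exists_mapLink_eq B (by
      rw [OrientedLink.support_eq_image hB]
      rintro _ ⟨z, hz, rfl⟩
      exact hPS 1 z (hAS z hz))
    refine ⟨A', f.ambientIsotopic_of_track (B := f.mapLink A) hP.contMDiff
      (fun t _ z hz => hPS t z (hAS z hz)) ?_ (by rw [hA', hB]), by rw [hA', hB]⟩
    have : ⇑(P 0) = id := funext hP.zero
    rw [this, tangentMap_id, image_id]
  obtain ⟨A, hA, hAc⟩ := hmove L
  obtain ⟨A', hA', hAc'⟩ := hmove L'
  refine hA.trans (AmbientIsotopic.trans ?_ hA'.symm)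
  -- Composing the isotopy with the end of the push keeps its whole track in the image of the
  -- interior, so it can be pulled back to `M`.
  refine f.ambientIsotopic_of_track (B := f.mapLink L) (Ψ := fun t => (Φ t).trans (P 1))
    ((P 1).contMDiff.comp hΦ) (fun t ht z hz => hPK _ ⟨(t, z), ⟨ht, hz⟩, rfl⟩) ?_ ?_
  · have : ⇑((Φ 0).trans (P 1)) = P 1 := funext fun z => by simp [hΦ0]
    rw [this, hAc]
  · have : ⇑((Φ 1).trans (P 1)) = P 1 ∘ Φ 1 := rfl
    rw [this, tangentMap_comp (mdifferentiable_diffeomorph (P 1))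
      (mdifferentiable_diffeomorph (Φ 1)), image_comp, hAc', hΦ1]

end CellAttachment

/-! ### Handles and caps as attached cells -/

section Attachments

variable {M N : OrientedThreeManifold}

/-- A 2-handle is a single cell with `V` the plane and `C` the interval; the axes are the parallels
of the cocore, and the end discs form a compact, hence closed, set. -/
theorem IsTwoHandleAddition.exists_cellAttachment {f : M → N} (hf : IsTwoHandleAddition f) :
    ∃ h : Unit → EuclideanSpace ℝ (Fin 2) × ℝ → N,
      CellAttachment f (Icc (-1 : ℝ) 1) h := by
  obtain ⟨h, hc, hinj, hs, himm, hcov, hrange, hsph, hend⟩ := hf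
  have hint : interior twoHandle =
      Metric.ball (0 : EuclideanSpace ℝ (Fin 2)) 1 ×ˢ interior (Icc (-1 : ℝ) 1) := by
    rw [twoHandle, interior_prod_eq, interior_closedBall _ one_ne_zero]
  rw [hint] at hs himm
  have habs : ∀ x ∈ twoHandle, x.2 ∉ interior (Icc (-1 : ℝ) 1) → |x.2| = 1 := by
    intro x hx hx2
    rw [interior_Icc, mem_Ioo, not_and_or, not_lt, not_lt] at hx2
    obtain ⟨-, h1, h2⟩ := hx
    rcases hx2 with h3 | h3
    · rw [le_antisymm h3 h1]; simp
    · rw [le_antisymm h2 h3]; simp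
  have hcp : IsCompact (Metric.closedBall (0 : EuclideanSpace ℝ (Fin 2)) 1 ×ˢ
      (Icc (-1 : ℝ) 1 \ interior (Icc (-1 : ℝ) 1))) :=
    (isCompact_closedBall 0 1).prod (isCompact_Icc.diff isOpen_interior)
  exact ⟨fun _ => h, {
    finrank := by simp
    isCompact := isCompact_Icc
    continuousOn := fun _ => hc
    injOn := fun _ => hinj
    disjoint := fun _ _ _ _ _ _ _ => rfl
    contMDiffOn := fun _ => hs
    immersion := fun _ => himm
    cover := fun z => (hcov.symm ▸ mem_univ z : z ∈ range f ∪ h '' twoHandle).imp id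
      fun ⟨x, hx, hz⟩ => ⟨(), x, hx, hz⟩
    mem_range_iff := fun _ => hrange
    sphere := fun _ => hsph
    ends := fun _ x hx hx2 => hend x hx (habs x hx hx2)
    isClosed := by
      rw [iUnion_const]
      exact (hcp.image_of_continuousOn
        (hc.mono (prod_mono Subset.rfl sdiff_subset))).isClosed }⟩

theorem injective_mfderiv_comp_fst {b : E3 → N} {x : E3 × EuclideanSpace ℝ (Fin 0)}
    (hb : MDifferentiableAt 𝓘(ℝ, E3) (𝓡∂ 3) b x.1)
    (hi : Injective (mfderiv 𝓘(ℝ, E3) (𝓡∂ 3) b x.1)) :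
    Injective (mfderiv 𝓘(ℝ, E3 × EuclideanSpace ℝ (Fin 0)) (𝓡∂ 3) (fun x => b x.1) x) := by
  have hd : HasMFDerivAt 𝓘(ℝ, E3 × EuclideanSpace ℝ (Fin 0)) 𝓘(ℝ, E3)
      (Prod.fst : E3 × EuclideanSpace ℝ (Fin 0) → E3) x
      (ContinuousLinearMap.fst ℝ E3 (EuclideanSpace ℝ (Fin 0))) :=
    hasFDerivAt_fst.hasMFDerivAt
  have := (HasMFDerivAt.comp x hb.hasMFDerivAt hd).mfderiv
  change Injective (mfderiv 𝓘(ℝ, E3 × EuclideanSpace ℝ (Fin 0)) (𝓡∂ 3) (b ∘ Prod.fst) x)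
  rw [this]
  exact hi.comp fun x y hxy => Prod.ext hxy (Subsingleton.elim _ _)

/-- For 3-cells `V` is the whole space and `W` is zero-dimensional. Then `C` is a point with empty
frontier, so there are no ends, and the axes are points. -/
theorem IsSphereCapping.exists_cellAttachment {f : M → N} (hf : IsSphereCapping f) :
    ∃ (J : Type) (h : J → E3 × EuclideanSpace ℝ (Fin 0) → N), CellAttachment f univ h := by
  obtain ⟨J, b, hc, hinj, hdis, hs, himm, hcov, hrange, hsph⟩ := hf
  have hfst : ∀ x : E3 × EuclideanSpace ℝ (Fin 0), ∀ s : Set E3,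
      x ∈ s ×ˢ (univ : Set (EuclideanSpace ℝ (Fin 0))) ↔ x.1 ∈ s := by simp
  have hfi : Injective (Prod.fst : E3 × EuclideanSpace ℝ (Fin 0) → E3) := fun x y hxy =>
    Prod.ext hxy (Subsingleton.elim _ _)
  refine ⟨J, fun j x => b j x.1, {
    finrank := by simp
    isCompact := isCompact_univ
    continuousOn := fun j => (hc j).comp continuousOn_fst fun x hx => hx.1
    injOn := fun j x hx y hy hxy => hfi (hinj j hx.1 hy.1 hxy)
    disjoint := fun i j x hx y hy hxy => by
      by_contra hij
      exact disjoint_left.1 (hdis hij) (mem_image_of_mem _ hx.1) (hxy ▸ mem_image_of_mem _ hy.1)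
    contMDiffOn := fun j => (hs j).comp contDiff_fst.contMDiff.contMDiffOn fun x hx => hx.1
    immersion := fun j x hx => ?_
    cover := fun z => ?_
    mem_range_iff := fun j x hx => hrange j x.1 hx.1
    sphere := fun j x _ hx1 => hsph j x.1 (by simpa using hx1)
    ends := fun j x _ hx => (hx (by simp)).elim
    isClosed := by simp }⟩
  · exact injective_mfderiv_comp_fst
      (((hs j).contMDiffAt (Metric.isOpen_ball.mem_nhds hx.1)).mdifferentiableAt (by simp))
      (himm j x.1 hx.1)
  · rcases (hcov.symm ▸ mem_univ z : z ∈ range f ∪ ⋃ j, b j '' Metric.closedBall 0 1) with h | h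
    · exact Or.inl h
    · obtain ⟨j, x, hx, rfl⟩ := mem_iUnion.1 h
      exact Or.inr ⟨j, (x, 0), ⟨hx, mem_univ _⟩, rfl⟩

/-! ### Criteria for surjectivity and bijectivity of induced maps -/

section Surjective

variable {allowEmpty : Prop} {R : Type*} [CommRing R] {k : ℕ} {r : Fin k → R}

/-- The links span the skein module. -/
theorem surjective_of_linkClass_mem_range {P : Type*} [AddCommGroup P] [Module R P]
    {F : P →ₗ[R] SkeinModule allowEmpty N r}
    (h : ∀ L, linkClass allowEmpty r L ∈ LinearMap.range F) : Surjective F := by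
  have h1 : (LinearMap.range F).mkQ = 0 := by
    refine skeinModule_linearMap_ext fun L => ?_
    rw [Submodule.mkQ_apply, LinearMap.zero_apply, Submodule.Quotient.mk_eq_zero]
    exact h L
  rw [← LinearMap.range_eq_top, ← Submodule.ker_mkQ (LinearMap.range F), h1, LinearMap.ker_zero]

theorem nonempty_carrier_of_ambientIsotopic {L L' : OrientedLink N} (h : AmbientIsotopic L L')
    (hL : L.carrier.Nonempty) : L'.carrier.Nonempty := by
  obtain ⟨Φ, -, -, hΦ⟩ := h
  rw [hΦ]
  exact hL.image _

theorem OrientedEmbedding.nonempty_of_mapLink {f : OrientedEmbedding M N} {L : OrientedLink M}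
    (h : (f.mapLink L).carrier.Nonempty) : L.carrier.Nonempty := by
  rw [f.mapLink_carrier] at h
  exact h.of_image

/-- A link that is isotopic to the image of a link is isotopic to the image of an admissible
link. -/
theorem OrientedEmbedding.exists_mapAdmissible {f : OrientedEmbedding M N}
    (hex : ∀ L : OrientedLink N, ∃ L₀ : OrientedLink M, AmbientIsotopic L (f.mapLink L₀))
    (L : Link allowEmpty N) :
    ∃ L₀ : Link allowEmpty M, AmbientIsotopic L.1 (f.mapAdmissible L₀).1 := by
  obtain ⟨L₀, hL₀⟩ := hex L.1
  exact ⟨⟨L₀, L.2.imp id fun h =>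
    f.nonempty_of_mapLink (nonempty_carrier_of_ambientIsotopic hL₀ h)⟩, hL₀⟩

theorem IsInduced.surjective {f : OrientedEmbedding M N}
    {F : SkeinModule allowEmpty M r →ₗ[R] SkeinModule allowEmpty N r}
    (hF : IsInduced allowEmpty r f.toFun F)
    (hex : ∀ L : OrientedLink N, ∃ L₀ : OrientedLink M, AmbientIsotopic L (f.mapLink L₀)) :
    Surjective F := by
  refine surjective_of_linkClass_mem_range fun L => ?_
  obtain ⟨L₀, hL₀⟩ := f.exists_mapAdmissible hex L
  refine ⟨linkClass allowEmpty r L₀, ?_⟩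
  rw [hF.apply_linkClass]
  exact (linkClass_eq_of_ambientIsotopic hL₀).symm

/-- The induced map is an isomorphism if links, isotopies and skein families can be moved into the
image of the embedding. -/
theorem IsInduced.bijective {f : OrientedEmbedding M N}
    {F : SkeinModule allowEmpty M r →ₗ[R] SkeinModule allowEmpty N r}
    (hF : IsInduced allowEmpty r f.toFun F)
    (hex : ∀ L : OrientedLink N, ∃ L₀ : OrientedLink M, AmbientIsotopic L (f.mapLink L₀))
    (hiso : ∀ L L' : OrientedLink M, AmbientIsotopic (f.mapLink L) (f.mapLink L') →
      AmbientIsotopic L L')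
    (hskein : ∀ L : Fin k → OrientedLink N, IsSkeinFamily L → ∃ L₀ : Fin k → OrientedLink M,
      IsSkeinFamily L₀ ∧ ∀ i, AmbientIsotopic (L i) (f.mapLink (L₀ i))) : Bijective F := by
  refine ⟨?_, hF.surjective hex⟩
  choose ψ hψ using f.exists_mapAdmissible (allowEmpty := allowEmpty) hex
  -- The inverse sends a link to the class of any link of `M` isotopic to it; `hiso` removes the
  -- dependence on the choice, also for the terms of a skein family, whose representatives need not
  -- be the chosen ones.
  obtain ⟨G, hG⟩ := exists_skeinModule_lift (r := r)
    (fun L : Link allowEmpty N => linkClass allowEmpty r (ψ L))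
    (fun L L' h => linkClass_eq_of_ambientIsotopic
      (hiso _ _ (((hψ L).symm.trans h).trans (hψ L'))))
    (fun L hL => by
      obtain ⟨L₀, hL₀, hLi⟩ := hskein _ hL
      have hadm : ∀ i, allowEmpty ∨ (L₀ i).carrier.Nonempty := fun i =>
        (L i).2.imp id fun h =>
          f.nonempty_of_mapLink (nonempty_carrier_of_ambientIsotopic (hLi i) h)
      rw [← sum_smul_linkClass_eq_zero (r := r) (allowEmpty := allowEmpty)
        (L := fun i => ⟨L₀ i, hadm i⟩) hL₀]
      refine Finset.sum_congr rfl fun i _ => ?_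
      congr 1
      exact linkClass_eq_of_ambientIsotopic (hiso _ _ ((hψ (L i)).symm.trans (hLi i))))
  have hGF : G ∘ₗ F = LinearMap.id := by
    refine skeinModule_linearMap_ext fun L => ?_
    rw [LinearMap.comp_apply, hF.apply_linkClass, hG, LinearMap.id_apply]
    exact linkClass_eq_of_ambientIsotopic (hiso _ _ (hψ (f.mapAdmissible L)).symm)
  exact LeftInverse.injective (g := G) fun x => LinearMap.congr_fun hGF x

/-- The cocore has codimension two, which suffices to free one-dimensional links but not the
two-dimensional tracks of isotopies. -/
theorem IsInduced.surjective_of_isTwoHandleAddition {f : OrientedEmbedding M N}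
    {F : SkeinModule allowEmpty M r →ₗ[R] SkeinModule allowEmpty N r}
    (hF : IsInduced allowEmpty r f.toFun F) (hf : IsTwoHandleAddition f.toFun) :
    Surjective F := by
  obtain ⟨h, H⟩ := hf.exists_cellAttachment
  exact hF.surjective (H.exists_ambientIsotopic_mapLink (by simp))

end Surjective

end Attachments

/-! ### Orientation behaviour along smooth families -/

section OrientationTransport

theorem CarriesOrientation.of_comp_right {V W Z : Type*} [AddCommGroup V] [Module ℝ V]
    [AddCommGroup W] [Module ℝ W] [AddCommGroup Z] [Module ℝ Z] {A : V →ₗ[ℝ] W} {B : W →ₗ[ℝ] Z}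
    {o : Orientation ℝ V (Fin 3)} {o' : Orientation ℝ W (Fin 3)} {o'' : Orientation ℝ Z (Fin 3)}
    (hB : CarriesOrientation B o' o'') (hBA : CarriesOrientation (B ∘ₗ A) o o'') :
    CarriesOrientation A o o' := by
  obtain ⟨e, rfl, rfl⟩ := hB
  obtain ⟨e', he', h⟩ := hBA
  refine ⟨e'.trans e.symm, ?_, ?_⟩
  · ext w
    have := LinearMap.congr_fun he' w
    simp only [LinearMap.comp_apply, LinearEquiv.coe_coe] at this
    simp [this]
  · have h1 : e.trans e.symm = LinearEquiv.refl ℝ W := LinearEquiv.ext fun v => by simp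
    rw [map_trans_orientation, h, ← map_trans_orientation, h1]
    simp

/-- Two isomorphisms whose determinants have the same sign act alike on orientations. -/
theorem CarriesOrientation.of_det_mul_pos {A B : E3 →ₗ[ℝ] E3} {o o' : Orientation ℝ E3 (Fin 3)}
    (hA : CarriesOrientation A o o') (h : 0 < LinearMap.det A * LinearMap.det B) :
    CarriesOrientation B o o' := by
  obtain ⟨e, rfl, rfl⟩ := hA
  have hB : IsUnit (LinearMap.det B) :=
    isUnit_iff_ne_zero.2 fun h0 => by rw [h0, mul_zero] at h; exact h.false
  let e' : E3 ≃ₗ[ℝ] E3 := LinearEquiv.ofIsUnitDet (v := (EuclideanSpace.basisFun (Fin 3) ℝ).toBasis)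
    (v' := (EuclideanSpace.basisFun (Fin 3) ℝ).toBasis) (f := B) (by
      rwa [LinearMap.det_toMatrix])
  have he' : (e' : E3 →ₗ[ℝ] E3) = B := LinearMap.ext fun x => rfl
  refine ⟨e', he', ?_⟩
  have h1 : e' = e.trans (e.symm.trans e') := LinearEquiv.ext fun v => by simp
  rw [h1, map_trans_orientation, Orientation.map_eq_iff_det_pos _ _ (by simp)]
  have h2 : LinearMap.det (e.symm.trans e' : E3 ≃ₗ[ℝ] E3).toLinearMap *
      LinearMap.det (e : E3 →ₗ[ℝ] E3) = LinearMap.det B := by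
    rw [← LinearMap.det_comp, ← he']
    congr 1
    ext v
    simp
  rw [← h2] at h
  have h3 : (0 : ℝ) < (LinearMap.det (e : E3 →ₗ[ℝ] E3)) ^ 2 := by
    have : LinearMap.det (e : E3 →ₗ[ℝ] E3) ≠ 0 := fun h0 => by
      rw [h0, zero_mul] at h; exact h.false
    positivity
  by_contra hcon
  nlinarith [not_lt.1 hcon]

theorem exists_carriesOrientation {D : E3 →ₗ[ℝ] E3} (hD : Injective D)
    (o' : Orientation ℝ E3 (Fin 3)) : ∃ o, CarriesOrientation D o o' := by
  let e : E3 ≃ₗ[ℝ] E3 := LinearEquiv.ofInjectiveEndo D hD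
  refine ⟨Orientation.map (Fin 3) e.symm o', e, rfl, ?_⟩
  rw [← map_trans_orientation]
  have : e.symm.trans e = LinearEquiv.refl ℝ E3 := LinearEquiv.ext fun v => by simp
  rw [this]
  simp

theorem continuous_det_clm :
    Continuous fun A : E3 →L[ℝ] E3 => LinearMap.det (A : E3 →ₗ[ℝ] E3) := by
  have := ContinuousLinearMap.continuous_det (𝕜 := ℝ) (E := E3)
  exact this

variable {N : OrientedThreeManifold}

/-- Along a smooth family of immersions the behaviour on orientations does not change. -/
theorem carriesOrientation_of_family {F : ℝ → E3 → N} {y : E3} {o : Orientation ℝ E3 (Fin 3)}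
    (hF : ∀ t, ContMDiffAt 𝓘(ℝ, ℝ × E3) (𝓡∂ 3) ∞ (fun p : ℝ × E3 => F p.1 p.2) (t, y))
    (hinj : ∀ t, Injective (mfderiv 𝓘(ℝ, E3) (𝓡∂ 3) (F t) y))
    (h₀ : CarriesOrientation (V := E3) (mfderiv 𝓘(ℝ, E3) (𝓡∂ 3) (F 0) y).toLinearMap o
      (N.orient (F 0 y))) (t : ℝ) :
    CarriesOrientation (V := E3) (mfderiv 𝓘(ℝ, E3) (𝓡∂ 3) (F t) y).toLinearMap o
      (N.orient (F t y)) := by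
  let P : ℝ → Prop := fun t => CarriesOrientation (V := E3)
    (mfderiv 𝓘(ℝ, E3) (𝓡∂ 3) (F t) y).toLinearMap o (N.orient (F t y))
  -- In a chart where the target orientation is constant, the behaviour depends only on the sign of
  -- a continuous, nonvanishing determinant; the time line is connected.
  suffices h : IsLocallyConstant P by
    have := h.apply_eq_of_preconnectedSpace 0 t
    change P t
    rw [← this]
    exact h₀
  rw [IsLocallyConstant.iff_eventually_eq]
  intro t₀
  obtain ⟨o', ho'⟩ := N.orient_locally_constant (F t₀ y)
  let u := extChartAt (𝓡∂ 3) (F t₀ y)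
  have hFt : ∀ t, ContMDiffAt 𝓘(ℝ, E3) (𝓡∂ 3) ∞ (F t) y := fun t =>
    ContMDiffAt.comp y (g := fun p : ℝ × E3 => F p.1 p.2) (f := fun z => (t, z)) (hF t)
      (contDiff_const.prodMk contDiff_id).contMDiff.contMDiffAt
  have hcont : ContinuousAt (fun t => F t y) t₀ :=
    ContinuousAt.comp (g := fun p : ℝ × E3 => F p.1 p.2) (f := fun t => (t, y))
      (hF t₀).continuousAt (by fun_prop)
  let B : ℝ → E3 →L[ℝ] E3 := fun t => fderiv ℝ (fun z => u (F t z)) y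
  have hB : ContinuousAt B t₀ := by
    have h1 : ContMDiffAt 𝓘(ℝ, ℝ × E3) 𝓘(ℝ, E3) ∞ (fun p : ℝ × E3 => u (F p.1 p.2)) (t₀, y) :=
      ContMDiffAt.comp (t₀, y) (g := u) contMDiffAt_extChartAt (hF t₀)
    exact (ContDiffAt.fderiv (m := 0) (f := fun t z => u (F t z)) (g := fun _ => y)
      h1.contDiffAt contDiffAt_const (by norm_cast)).continuousAt
  have hkey : ∀ᶠ t in 𝓝 t₀, (P t ↔ CarriesOrientation (B t).toLinearMap o o') ∧
      LinearMap.det (B t : E3 →ₗ[ℝ] E3) ≠ 0 := by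
    filter_upwards [hcont.eventually ho', hcont.eventually
      (extChartAt_source_mem_nhds (I := 𝓡∂ 3) (F t₀ y))] with t ht hts
    have hud : MDifferentiableAt (𝓡∂ 3) 𝓘(ℝ, E3) u (F t y) :=
      (contMDiffAt_extChartAt' (by rwa [extChartAt_source] at hts)).mdifferentiableAt
        (n := ∞) (by simp)
    have hcomp : B t = (mfderiv (𝓡∂ 3) 𝓘(ℝ, E3) u (F t y)).comp
        (mfderiv 𝓘(ℝ, E3) (𝓡∂ 3) (F t) y) := by
      have := mfderiv_comp y hud ((hFt t).mdifferentiableAt (by simp))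
      rw [← this, mfderiv_eq_fderiv]
      rfl
    have hlin : (B t).toLinearMap = (mfderiv (𝓡∂ 3) 𝓘(ℝ, E3) u (F t y)).toLinearMap ∘ₗ
        (mfderiv 𝓘(ℝ, E3) (𝓡∂ 3) (F t) y).toLinearMap := by
      rw [hcomp]; rfl
    refine ⟨?_, ?_⟩
    · rw [hlin]
      exact ⟨fun h => ht.comp h, fun h => ht.of_comp_right h⟩
    · have hBi : Injective (B t) := by
        rw [hcomp]
        exact ht.injective.comp (hinj t)
      have : LinearMap.ker (B t).toLinearMap = ⊥ := LinearMap.ker_eq_bot.2 hBi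
      intro h0
      exact (LinearMap.bot_lt_ker_of_det_eq_zero h0).ne' this
  have hdet : ContinuousAt (fun t => LinearMap.det (B t₀ : E3 →ₗ[ℝ] E3) *
      LinearMap.det (B t : E3 →ₗ[ℝ] E3)) t₀ :=
    continuousAt_const.mul (continuous_det_clm.continuousAt.comp hB)
  have h0 := hkey.self_of_nhds
  have hpos : ∀ᶠ t in 𝓝 t₀, 0 < LinearMap.det (B t₀ : E3 →ₗ[ℝ] E3) *
      LinearMap.det (B t : E3 →ₗ[ℝ] E3) :=
    hdet.eventually (lt_mem_nhds (mul_self_pos.2 h0.2))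
  filter_upwards [hkey, hpos] with t ht htp
  refine propext (ht.1.trans (Iff.trans ?_ h0.1.symm))
  exact ⟨fun h => h.of_det_mul_pos (by rwa [mul_comm]), fun h => h.of_det_mul_pos htp⟩

/-- The diffeomorphisms of an ambient isotopy preserve the orientation. -/
theorem IsAmbientIsotopy.carriesOrientation {Φ : ℝ → Diffeomorph (𝓡∂ 3) (𝓡∂ 3) N N ∞}
    (hΦ : IsAmbientIsotopy Φ) (t : ℝ) {x : N} (hx : x ∈ (𝓡∂ 3).interior (N : Type _)) :
    CarriesOrientation (mfderiv (𝓡∂ 3) (𝓡∂ 3) (Φ t) x).toLinearMap (N.orient x)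
      (N.orient (Φ t x)) := by
  let v := extChartAt (𝓡∂ 3) x
  let y : E3 := v x
  have hyx : v.symm y = x := extChartAt_to_inv x
  have hvs : ContMDiffAt 𝓘(ℝ, E3) (𝓡∂ 3) ∞ v.symm y :=
    contMDiffAt_extChartAt_symm_of_isInteriorPoint hx
  have hvd : MDifferentiableAt 𝓘(ℝ, E3) (𝓡∂ 3) v.symm y := hvs.mdifferentiableAt (by simp)
  have hvinj : Injective (mfderiv 𝓘(ℝ, E3) (𝓡∂ 3) v.symm y) :=
    (((interiorChart (𝓡∂ 3) x).symm.isLocalDiffeomorphAt _ _ _ (x := y)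
      ⟨mem_extChartAt_target x, hx⟩).mfderivToContinuousLinearEquiv (by simp)).injective
  let D : E3 →ₗ[ℝ] E3 := (mfderiv 𝓘(ℝ, E3) (𝓡∂ 3) v.symm y).toLinearMap
  -- The orientation is read in the chart at `x`, so that the claim holds at time zero; the chart is
  -- cancelled again at the end.
  obtain ⟨o, ho⟩ : ∃ o : Orientation ℝ E3 (Fin 3), CarriesOrientation D o (N.orient x) :=
    exists_carriesOrientation hvinj (N.orient x)
  have hcomp : ∀ t, mfderiv 𝓘(ℝ, E3) (𝓡∂ 3) (fun z => Φ t (v.symm z)) y =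
      (mfderiv (𝓡∂ 3) (𝓡∂ 3) (Φ t) (v.symm y)).comp (mfderiv 𝓘(ℝ, E3) (𝓡∂ 3) v.symm y) := fun t =>
    mfderiv_comp y (mdifferentiable_diffeomorph (Φ t) _) hvd
  have key := carriesOrientation_of_family (N := N) (F := fun t z => Φ t (v.symm z)) (y := y)
    (o := o)
    (fun t => by
      refine ContMDiffAt.comp (t, y) (g := fun p : ℝ × N => Φ p.1 p.2)
        (f := fun p : ℝ × E3 => (p.1, v.symm p.2)) hΦ.contMDiff.contMDiffAt ?_
      exact ContMDiffAt.prodMk contDiff_fst.contMDiff.contMDiffAt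
        (ContMDiffAt.comp (t, y) (g := v.symm) (f := fun p : ℝ × E3 => p.2) hvs
          contDiff_snd.contMDiff.contMDiffAt))
    (fun t => by
      rw [hcomp t]
      exact (injective_mfderiv_diffeomorph (Φ t) _).comp hvinj)
    (by
      have h1 : (fun z => Φ 0 (v.symm z)) = v.symm := funext fun z => hΦ.zero _
      have h2 : ∀ (F : E3 → N), F = v.symm → CarriesOrientation (V := E3)
          (mfderiv 𝓘(ℝ, E3) (𝓡∂ 3) F y).toLinearMap o (N.orient (F y)) := by
        rintro _ rfl
        have h3 : (N.orient (v.symm y) : Orientation ℝ E3 (Fin 3)) = N.orient x := by rw [hyx]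
        exact Eq.mpr (congrArg (CarriesOrientation D o) h3) ho
      exact h2 _ h1) t
  have h4 : ∀ x', x' = x → CarriesOrientation (V := E3)
      ((mfderiv (𝓡∂ 3) (𝓡∂ 3) (Φ t) x').toLinearMap ∘ₗ D) o (N.orient (Φ t x')) →
      CarriesOrientation (mfderiv (𝓡∂ 3) (𝓡∂ 3) (Φ t) x).toLinearMap (N.orient x)
      (N.orient (Φ t x)) := by
    rintro _ rfl h
    exact CarriesOrientation.of_comp_left (V := E3) ho h
  refine h4 _ hyx ?_
  have h5 := hcomp t
  have h6 := congrArg ContinuousLinearMap.toLinearMap h5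
  exact Eq.mp (congrArg (fun A => CarriesOrientation (V := E3) A o (N.orient (Φ t (v.symm y)))) h6)
    key

end OrientationTransport

/-! ### Shrinking the parametrized ball of a skein family -/

section Shrink

/-- A space is diffeomorphic to an arbitrarily small neighbourhood of its closed unit ball by a map
that fixes a neighbourhood of this ball. -/
theorem exists_shrink {R : ℝ} (hR : 1 < R) :
    ∃ σ : E3 → E3, ContDiff ℝ ∞ σ ∧ Injective σ ∧ (∀ x, Injective (fderiv ℝ σ x)) ∧
      (∀ x, ‖σ x‖ ^ 2 < R) ∧ ∀ x ∈ Metric.closedBall (0 : E3) 1, σ =ᶠ[𝓝 x] id := by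
  obtain ⟨a, ha1, haR⟩ := exists_between hR
  -- The weight vanishes up to `a > 1` and blows up at `R`. The radial map `τ` therefore fixes a
  -- neighbourhood of the closed unit ball and stretches the ball of squared radius `R` over the
  -- whole space; `σ` is its inverse.
  let w : ℝ → ℝ := fun s => Real.smoothTransition (s - a) / (R - s)
  have hw0 : ∀ s ≤ a, w s = 0 := fun s hs => by
    simp [w, Real.smoothTransition.zero_of_nonpos (sub_nonpos.2 hs)]
  have hwnn : ∀ s < R, 0 ≤ w s := fun s hs =>
    div_nonneg (Real.smoothTransition.nonneg _) (by linarith)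
  have hwmono : ∀ s s', s ≤ s' → s' < R → w s ≤ w s' := fun s s' hss hs' =>
    div_le_div₀ (Real.smoothTransition.nonneg _)
      (Real.smoothTransition.monotone (by linarith)) (by linarith) (by linarith)
  have hws : ContDiffOn ℝ ∞ w (Iio R) :=
    ((Real.smoothTransition.contDiff.comp (contDiff_id.sub contDiff_const)).contDiffOn).div
      (contDiffOn_const.sub contDiffOn_id) fun s hs => (sub_pos.2 hs).ne'
  let τ : E3 → E3 := fun y => (1 + w (‖y‖ ^ 2)) • y
  let B : Set E3 := {y | ‖y‖ ^ 2 < R}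
  have hB : IsOpen B := isOpen_lt (by fun_prop) continuous_const
  have hτs : ContDiffOn ℝ ∞ τ B :=
    (contDiffOn_const.add (hws.comp (contDiff_norm_sq ℝ).contDiffOn fun y hy => hy)).smul
      contDiffOn_id
  -- As `w` is nonnegative and increasing, `τ` is strongly monotone. By Cauchy–Schwarz it does not
  -- shrink distances, which gives injectivity of `τ` and of its derivatives at once.
  have hmono : ∀ y ∈ B, ∀ y' ∈ B, ‖y'‖ ≤ ‖y‖ →
      ‖y - y'‖ ^ 2 ≤ inner ℝ (τ y - τ y') (y - y') := by
    intro y hy y' hy' hle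
    have h1 : τ y - τ y' = (1 + w (‖y'‖ ^ 2)) • (y - y') + (w (‖y‖ ^ 2) - w (‖y'‖ ^ 2)) • y := by
      simp only [τ]
      module
    have h2 : 0 ≤ inner ℝ y (y - y') := by
      rw [inner_sub_right, real_inner_self_eq_norm_sq]
      nlinarith [real_inner_le_norm y y', norm_nonneg y, norm_nonneg y']
    have h3 : w (‖y'‖ ^ 2) ≤ w (‖y‖ ^ 2) :=
      hwmono _ _ (pow_le_pow_left₀ (norm_nonneg _) hle 2) hy
    rw [h1, inner_add_left, inner_smul_left, inner_smul_left, real_inner_self_eq_norm_sq]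
    simp only [conj_trivial]
    nlinarith [hwnn _ hy', sq_nonneg ‖y - y'‖, mul_nonneg (sub_nonneg.2 h3) h2,
      mul_nonneg (hwnn _ hy') (sq_nonneg ‖y - y'‖)]
  have hexp : ∀ y ∈ B, ∀ y' ∈ B, ‖y - y'‖ ≤ ‖τ y - τ y'‖ := by
    have h1 : ∀ y ∈ B, ∀ y' ∈ B, ‖y'‖ ≤ ‖y‖ → ‖y - y'‖ ≤ ‖τ y - τ y'‖ := by
      intro y hy y' hy' hle
      have h2 := hmono y hy y' hy' hle
      have h3 := real_inner_le_norm (τ y - τ y') (y - y')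
      by_contra! hcon
      have h4 : 0 < ‖y - y'‖ := lt_of_le_of_lt (norm_nonneg _) hcon
      nlinarith
    intro y hy y' hy'
    rcases le_total ‖y'‖ ‖y‖ with h | h
    · exact h1 y hy y' hy' h
    · rw [norm_sub_rev y, norm_sub_rev (τ y)]
      exact h1 y' hy' y hy h
  have hinj : InjOn τ B := fun y hy y' hy' h => by
    have := hexp y hy y' hy'
    rw [h, sub_self, norm_zero] at this
    exact sub_eq_zero.1 (norm_le_zero_iff.1 this)
  have himm : ∀ y ∈ B, Injective (fderiv ℝ τ y) := by
    intro y hy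
    refine (injective_iff_map_eq_zero _).2 fun v hv => ?_
    have hd : HasFDerivAt τ (fderiv ℝ τ y) y :=
      ((hτs.contDiffAt (hB.mem_nhds hy)).differentiableAt (by simp)).hasFDerivAt
    have h1 := (hd.lim_real v).norm
    rw [hv, norm_zero] at h1
    refine norm_le_zero_iff.1 (ge_of_tendsto h1 ?_)
    have h2 : Tendsto (fun c : ℝ => y + c⁻¹ • v) atTop (𝓝 y) := by
      have := tendsto_const_nhds (x := y) |>.add
        ((tendsto_inv_atTop_zero (𝕜 := ℝ)).smul_const v)
      simpa using this
    filter_upwards [h2.eventually (hB.mem_nhds hy), eventually_gt_atTop 0] with c hc hc0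
    have h3 := hexp _ hc y hy
    rw [add_sub_cancel_left, norm_smul, Real.norm_of_nonneg (inv_nonneg.2 hc0.le)] at h3
    rw [norm_smul, Real.norm_of_nonneg hc0.le]
    calc ‖v‖ = c * (c⁻¹ * ‖v‖) := by field_simp
      _ ≤ _ := mul_le_mul_of_nonneg_left h3 hc0.le
  have hsurj : τ '' B = univ := by
    refine eq_univ_of_forall fun x => ?_
    by_cases hx0 : x = 0
    · refine ⟨0, by simp only [B, mem_ofPred_eq]; norm_num; linarith, by simp [τ, hx0]⟩
    have hxpos : 0 < ‖x‖ := norm_pos_iff.2 hx0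
    let m := Real.smoothTransition ((R - a) / 2)
    have hm : 0 < m := Real.smoothTransition.pos_of_pos (by linarith)
    -- At the radius `√v ≥ 1` the stretched length is at least `‖x‖`, so the intermediate value
    -- theorem on the ray of `x` finds a preimage.
    obtain ⟨v, hv1, hvR, hvw⟩ : ∃ v, 1 ≤ v ∧ v < R ∧ ‖x‖ ≤ w v := by
      obtain ⟨d, hd, hd1, hd2⟩ : ∃ d > 0, d ≤ (R - a) / 2 ∧ d ≤ m / ‖x‖ :=
        ⟨min ((R - a) / 2) (m / ‖x‖), lt_min (by linarith) (by positivity), min_le_left _ _,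
          min_le_right _ _⟩
      refine ⟨R - d, by linarith, by linarith, ?_⟩
      have h1 : m ≤ Real.smoothTransition (R - d - a) :=
        Real.smoothTransition.monotone (by linarith)
      simp only [w]
      rw [sub_sub_cancel, le_div_iff₀ hd]
      rw [le_div_iff₀ hxpos] at hd2
      linarith
    have hcont : ContinuousOn (fun r : ℝ => (1 + w (r ^ 2)) * r) (Icc 0 (√v)) := by
      refine (continuousOn_const.add (hws.continuousOn.comp (by fun_prop) fun r hr => ?_)).mul
        continuousOn_id
      have : r ^ 2 ≤ v := by
        have := pow_le_pow_left₀ hr.1 hr.2 2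
        rwa [Real.sq_sqrt (by linarith)] at this
      exact lt_of_le_of_lt this hvR
    obtain ⟨r, hr, hrx⟩ := intermediate_value_Icc (Real.sqrt_nonneg v) hcont
      (show ‖x‖ ∈ Icc _ _ from ⟨by simp, by
        simp only [Real.sq_sqrt (by linarith : (0 : ℝ) ≤ v)]
        have h1 : 1 ≤ √v := by rw [Real.one_le_sqrt]; exact hv1
        nlinarith [hwnn v hvR]⟩)
    have hr2 : r ^ 2 < R := by
      have := pow_le_pow_left₀ hr.1 hr.2 2
      rw [Real.sq_sqrt (by linarith)] at this
      linarith
    have hnorm : ‖(r / ‖x‖) • x‖ = r := by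
      rw [norm_smul, Real.norm_of_nonneg (div_nonneg hr.1 hxpos.le), div_mul_cancel₀ _ hxpos.ne']
    refine ⟨(r / ‖x‖) • x, ?_, ?_⟩
    · change ‖(r / ‖x‖) • x‖ ^ 2 < R
      rwa [hnorm]
    · simp only [τ, hnorm, smul_smul]
      beta_reduce at hrx
      rw [← mul_div_assoc, hrx, div_self hxpos.ne', one_smul]
  obtain ⟨σ, -, -, hσ, hστ⟩ := exists_smooth_leftInverse_of_injOn (I := 𝓘(ℝ, E3))
    (J := 𝓘(ℝ, E3)) rfl hB hτs.contMDiffOn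
    (fun x _ => ModelWithCorners.interior_eq_univ (I := 𝓘(ℝ, E3)) (M := E3) ▸ mem_univ x)
    hinj (fun x hx => by rw [mfderiv_eq_fderiv]; exact himm x hx)
  rw [hsurj, contMDiffOn_univ] at hσ
  have hσ' : ContDiff ℝ ∞ σ := hσ.contDiff
  have hσB : ∀ x, σ x ∈ B ∧ τ (σ x) = x := fun x => by
    obtain ⟨y, hy, rfl⟩ := (hsurj.symm ▸ mem_univ x : x ∈ τ '' B)
    rw [hστ y hy]
    exact ⟨hy, rfl⟩
  have hleft : LeftInverse τ σ := fun x => (hσB x).2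
  refine ⟨σ, hσ', hleft.injective, fun x => ?_, fun x => (hσB x).1, fun x hx => ?_⟩
  · have h1 : HasFDerivAt τ (fderiv ℝ τ (σ x)) (σ x) :=
      ((hτs.contDiffAt (hB.mem_nhds (hσB x).1)).differentiableAt (by simp)).hasFDerivAt
    have h2 : HasFDerivAt σ (fderiv ℝ σ x) x :=
      (hσ'.differentiable (by simp) x).hasFDerivAt
    have h3 := h1.comp x h2
    rw [hleft.comp_eq_id] at h3
    have h4 := h3.unique (hasFDerivAt_id x)
    refine LeftInverse.injective (g := fderiv ℝ τ (σ x)) fun v => ?_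
    exact DFunLike.congr_fun h4 v
  · have : ∀ᶠ y in 𝓝 x, ‖y‖ ^ 2 < a := by
      have hc : ContinuousAt (fun y : E3 => ‖y‖ ^ 2) x := by fun_prop
      refine hc.eventually (gt_mem_nhds (lt_of_le_of_lt ?_ ha1))
      have : ‖x‖ ≤ 1 := by simpa using hx
      exact pow_le_one₀ (norm_nonneg x) this
    filter_upwards [this] with y hy
    have h1 : τ y = y := by simp [τ, hw0 _ hy.le]
    have h2 := hστ y (show ‖y‖ ^ 2 < R by linarith)
    rwa [h1] at h2

/-- The ball of a skein family may be taken in any neighbourhood of the image of the closed unit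
ball. -/
theorem IsSkeinFamilyIn.exists_shrink {N : OrientedThreeManifold} {k : ℕ} {b : E3 → N}
    {L : Fin k → OrientedLink N} (h : IsSkeinFamilyIn b L) {O : Set N} (hO : IsOpen O)
    (hbO : b '' Metric.closedBall 0 1 ⊆ O) :
    ∃ b' : E3 → N, IsSkeinFamilyIn b' L ∧ ∀ x, b' x ∈ O := by
  have hpre : IsOpen (b ⁻¹' O) := hO.preimage h.contMDiff.continuous
  obtain ⟨δ, hδ, hδO⟩ := (isCompact_closedBall (0 : E3) 1).exists_thickening_subset_open hpre
    (image_subset_iff.1 hbO)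
  obtain ⟨σ, hσ, hσi, hσd, hσR, hσid⟩ := Skein.exists_shrink (R := (1 + δ) ^ 2) (by nlinarith)
  have hσ1 : ∀ x ∈ Metric.closedBall (0 : E3) 1, σ x = x := fun x hx => (hσid x hx).eq_of_nhds
  have hσO : ∀ x, b (σ x) ∈ O := fun x => by
    refine hδO ?_
    rw [thickening_closedBall hδ zero_le_one, mem_ball_zero_iff, add_comm]
    exact lt_of_pow_lt_pow_left₀ 2 (by linarith) (hσR x)
  -- The determinant is continuous, never zero, and equal to one at the origin, where `σ` is locally
  -- the identity.
  have hdet : ∀ x, 0 < LinearMap.det (fderiv ℝ σ x : E3 →ₗ[ℝ] E3) := by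
    have hne : ∀ x, LinearMap.det (fderiv ℝ σ x : E3 →ₗ[ℝ] E3) ≠ 0 := fun x h0 =>
      (LinearMap.bot_lt_ker_of_det_eq_zero h0).ne' (LinearMap.ker_eq_bot.2 (hσd x))
    have hcont : Continuous fun x => LinearMap.det (fderiv ℝ σ x : E3 →ₗ[ℝ] E3) :=
      continuous_det_clm.comp (hσ.continuous_fderiv (by simp))
    have h0 : LinearMap.det (fderiv ℝ σ 0 : E3 →ₗ[ℝ] E3) = 1 := by
      rw [(hσid 0 (by simp)).fderiv_eq, fderiv_id]
      exact LinearMap.det_id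
    intro x
    by_contra hcon
    obtain ⟨z, hz⟩ := mem_range_of_exists_le_of_exists_ge hcont ⟨x, not_lt.1 hcon⟩
      ⟨0, h0.symm ▸ zero_le_one⟩
    exact hne z hz
  have hsd : ∀ x, MDifferentiableAt 𝓘(ℝ, E3) 𝓘(ℝ, E3) σ x := fun x =>
    (hσ.contMDiff x).mdifferentiableAt (by simp)
  have hbd : ∀ x, MDifferentiableAt 𝓘(ℝ, E3) (𝓡∂ 3) b x := fun x =>
    (h.contMDiff x).mdifferentiableAt (by simp)
  have hsm : ContMDiff 𝓘(ℝ, E3) (𝓡∂ 3) ∞ (fun x => b (σ x)) := h.contMDiff.comp hσ.contMDiff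
  have hori : ∀ x, CarriesOrientation (V := E3)
      (mfderiv 𝓘(ℝ, E3) (𝓡∂ 3) (fun x => b (σ x)) x).toLinearMap stdOrientation
        (N.orient (b (σ x))) := fun x => by
    have : mfderiv 𝓘(ℝ, E3) (𝓡∂ 3) (fun x => b (σ x)) x =
        (mfderiv 𝓘(ℝ, E3) (𝓡∂ 3) b (σ x)).comp (mfderiv 𝓘(ℝ, E3) 𝓘(ℝ, E3) σ x) :=
      mfderiv_comp x (hbd _) (hsd x)
    rw [this, mfderiv_eq_fderiv]
    refine (h.orientation (σ x)).comp ?_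
    exact CarriesOrientation.of_det_mul_pos (carriesOrientation_id stdOrientation) (by
      rw [LinearMap.det_id, one_mul]; exact hdet x)
  have himg : (fun x => b (σ x)) '' Metric.closedBall 0 1 = b '' Metric.closedBall 0 1 :=
    image_congr fun x hx => by rw [hσ1 x hx]
  have htan : ∀ q : TangentBundle 𝓘(ℝ, E3) E3, q.proj ∈ Metric.closedBall (0 : E3) 1 →
      tangentMap 𝓘(ℝ, E3) (𝓡∂ 3) (fun x => b (σ x)) q = tangentMap 𝓘(ℝ, E3) (𝓡∂ 3) b q := by
    intro q hq
    refine tangentMap_congr_of_eventuallyEq ?_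
    filter_upwards [hσid _ hq] with x hx
    rw [hx, id]
  have hinjb : Injective fun x => b (σ x) := h.isEmbedding.injective.comp hσi
  refine ⟨fun x => b (σ x), ⟨hsm, (isOpenEmbedding_of_immersion (by simp) hsm hinjb
    fun x => (hori x).injective).isEmbedding, hori, fun x => h.interior _, ?_, ?_⟩, hσO⟩
  · intro i p hp
    have hp' := hp
    rw [himg] at hp
    rw [h.inside i p hp]
    constructor
    · rintro ⟨q, hq, rfl⟩
      obtain ⟨x, hx, hxq⟩ := hp
      have : x = q.proj := h.isEmbedding.injective hxq
      exact ⟨q, hq, htan q (this ▸ hx)⟩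
    · rintro ⟨q, hq, rfl⟩
      obtain ⟨x, hx, hxq⟩ := hp'
      have : x = q.proj := hinjb hxq
      exact ⟨q, hq, (htan q (this ▸ hx)).symm⟩
  · intro i j p hp
    rw [himg] at hp
    exact h.outside i j p hp

end Shrink

/-! ### Skein families and capping off spheres -/

section Capping

variable {M N : OrientedThreeManifold} {k : ℕ}

/-- A compact parametrized ball can be moved by an ambient isotopy off a family of points that meets
compact sets of interior points in finite sets. -/
theorem exists_isotopy_ball_avoiding {b : E3 → N} (hb : ContMDiff 𝓘(ℝ, E3) (𝓡∂ 3) ∞ b)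
    (hinj : Injective b) (himm : ∀ x, Injective (mfderiv 𝓘(ℝ, E3) (𝓡∂ 3) b x))
    {J : Type*} {q : J → N} (hq : {j | q j ∈ b '' Metric.closedBall 0 2}.Finite) :
    ∃ Φ : ℝ → Diffeomorph (𝓡∂ 3) (𝓡∂ 3) N N ∞, IsAmbientIsotopy Φ ∧
      ∀ j, Φ 1 (q j) ∉ b '' Metric.closedBall 0 1 := by
  let T : Set E3 := ⋃ j ∈ {j | q j ∈ b '' Metric.closedBall 0 2}, b ⁻¹' {q j}
  have hT : T.Finite := hq.biUnion fun j _ => (subsingleton_singleton.preimage hinj).finite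
  -- Only finitely many points are concerned, so a centre `p` off them exists with a positive margin
  -- `η`; pushing radially from `p` inside the ball of radius two expels them from the unit ball.
  obtain ⟨p, hp1, hpT⟩ := (hT.countable.dense_compl ℝ).inter_open_nonempty
    (Metric.ball (0 : E3) 1) Metric.isOpen_ball (by simp)
  obtain ⟨η, hη, hηT⟩ := Metric.mem_nhds_iff.1 (hT.isClosed.isOpen_compl.mem_nhds hpT)
  let B : Set (E3 × EuclideanSpace ℝ (Fin 0)) := Metric.ball 0 2 ×ˢ univ
  obtain ⟨Φ, hΦ, hΦn, hΦx⟩ := exists_isotopy_radial (N := N) (V := E3)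
    (W := EuclideanSpace ℝ (Fin 0)) (by simp) (c := fun x => b x.1) (B := B)
    (Metric.isOpen_ball.prod isOpen_univ) (hb.comp contDiff_fst.contMDiff).contMDiffOn
    (fun x _ y _ hxy => Prod.ext (hinj hxy) (Subsingleton.elim _ _))
    (fun x _ => injective_mfderiv_comp_fst ((hb x.1).mdifferentiableAt (by simp)) (himm x.1))
    (C := univ) isCompact_univ (ρ := 1)
    (prod_mono (Metric.closedBall_subset_ball one_lt_two) Subset.rfl) (p := p)
    (by simpa using (mem_ball_zero_iff.1 hp1).le) hη
  refine ⟨Φ, hΦ, fun j hj => ?_⟩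
  by_cases hjB : q j ∈ (fun x : E3 × EuclideanSpace ℝ (Fin 0) => b x.1) '' B
  · obtain ⟨x, hx, hxq⟩ := hjB
    have hxT : x.1 ∈ T := mem_biUnion (show q j ∈ b '' Metric.closedBall 0 2 from
      ⟨x.1, Metric.ball_subset_closedBall hx.1, hxq⟩) hxq
    obtain ⟨x', -, -, hx'1, he⟩ := hΦx x hx (mem_univ _) (by
      by_contra! hcon
      exact hηT (mem_ball_iff_norm.2 hcon) hxT)
    rw [← hxq, he] at hj
    obtain ⟨y, hy, hyx⟩ := hj
    rw [← hinj hyx] at hx'1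
    exact absurd (mem_closedBall_zero_iff.1 hy) (not_le.2 hx'1)
  · rw [hΦn 1 _ hjB] at hj
    obtain ⟨y, hy, hyq⟩ := hj
    exact hjB ⟨(y, 0), ⟨Metric.closedBall_subset_ball one_lt_two hy, mem_univ _⟩, hyq⟩

theorem IsSkeinFamilyIn.map_diffeomorph {b : E3 → N} {L : Fin k → OrientedLink N}
    (h : IsSkeinFamilyIn b L) {Φ : Diffeomorph (𝓡∂ 3) (𝓡∂ 3) N N ∞}
    (hΦ : ∀ x ∈ (𝓡∂ 3).interior (N : Type _), CarriesOrientation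
      (mfderiv (𝓡∂ 3) (𝓡∂ 3) Φ x).toLinearMap (N.orient x) (N.orient (Φ x)))
    {L' : Fin k → OrientedLink N}
    (hL' : ∀ i, (L' i).carrier = tangentMap (𝓡∂ 3) (𝓡∂ 3) Φ '' (L i).carrier) :
    IsSkeinFamilyIn (fun x => Φ (b x)) L' :=
  h.map (isOpen_interior_manifold N) Φ.contMDiff.contMDiffOn Φ.injective.injOn hΦ h.interior
    (fun i => (L i).support_subset_interior) hL'

theorem IsSkeinFamilyIn.exists_carriers {L : Fin k → OrientedLink N}
    (Φ : Diffeomorph (𝓡∂ 3) (𝓡∂ 3) N N ∞) : ∃ L' : Fin k → OrientedLink N,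
      ∀ i, (L' i).carrier = tangentMap (𝓡∂ 3) (𝓡∂ 3) Φ '' (L i).carrier := by
  choose L' hL' using fun i => (L i).exists_diffeomorph_image Φ
  exact ⟨L', hL'⟩

/-- Skein families can be moved off attached 3-cells. -/
theorem CellAttachment.exists_isSkeinFamily {f : OrientedEmbedding M N} {J : Type*}
    {h : J → E3 × EuclideanSpace ℝ (Fin 0) → N} (H : CellAttachment f.toFun univ h)
    {L : Fin k → OrientedLink N} (hL : IsSkeinFamily L) :
    ∃ L₀ : Fin k → OrientedLink M, IsSkeinFamily L₀ ∧
      ∀ i, AmbientIsotopic (L i) (f.mapLink (L₀ i)) := by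
  obtain ⟨b, hb⟩ := isSkeinFamily_iff.1 hL
  have hbox : ∀ v ∈ Metric.ball (0 : E3) 1, ((v, 0) : E3 × EuclideanSpace ℝ (Fin 0)) ∈
      Metric.ball (0 : E3) 1 ×ˢ interior (univ : Set (EuclideanSpace ℝ (Fin 0))) :=
    fun v hv => ⟨hv, by simp⟩
  -- The ball is three-dimensional, so it cannot be made to miss the cell centres by counting
  -- dimensions. The isotopy drags the centres off the ball, and the inverse of its end map then
  -- moves ball and links off the centres.
  obtain ⟨Φ, hΦ, hΦq⟩ := exists_isotopy_ball_avoiding hb.contMDiff hb.isEmbedding.injective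
    (fun x => (hb.orientation x).injective) (q := fun j => h j (0, 0))
    ((H.finite_setOf_inter_nonempty f.isSmoothEmb
      ((isCompact_closedBall (0 : E3) 2).image hb.contMDiff.continuous)
      (by rintro _ ⟨x, -, rfl⟩; exact hb.interior x)).subset
      fun j hj => ⟨_, hj, _, hbox 0 (by simp), rfl⟩)
  obtain ⟨L₁, hL₁⟩ := IsSkeinFamilyIn.exists_carriers (L := L) (Φ 1).symm
  have hLL₁ : ∀ i, AmbientIsotopic (L i) (L₁ i) := fun i => by
    refine AmbientIsotopic.symm ⟨Φ, hΦ.contMDiff, hΦ.zero, ?_⟩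
    have hid : (⇑(Φ 1) ∘ ⇑(Φ 1).symm) = id := by
      funext x
      simp
    rw [hL₁, ← image_comp, ← tangentMap_comp (mdifferentiable_diffeomorph (Φ 1))
      (mdifferentiable_diffeomorph (Φ 1).symm), hid, tangentMap_id, image_id]
  have hb₁ : IsSkeinFamilyIn (fun x => (Φ 1).symm (b x)) L₁ := by
    refine hb.map_diffeomorph (fun z hz => ?_) hL₁
    obtain ⟨x, rfl⟩ := (Φ 1).surjective z
    refine carriesOrientation_leftInverse (mdifferentiable_diffeomorph (Φ 1) x)
      (mdifferentiable_diffeomorph (Φ 1).symm _) (Eventually.of_forall fun y => by simp)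
      (hΦ.carriesOrientation 1 ?_)
    have := (mdifferentiable_diffeomorph (Φ 1).symm (Φ 1 x)).isInteriorPoint_of_surjective_mfderiv
      (surjective_mfderiv_of_injective rfl (injective_mfderiv_diffeomorph (Φ 1).symm _)) hz
    rwa [(Φ 1).symm_apply_apply] at this
  set b₁ : E3 → N := fun x => (Φ 1).symm (b x) with hb₁def
  have hK₁ : IsCompact (b₁ '' Metric.closedBall 0 1) :=
    (isCompact_closedBall 0 1).image hb₁.contMDiff.continuous
  have hq₁ : ∀ j, h j (0, 0) ∉ b₁ '' Metric.closedBall 0 1 := by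
    rintro j ⟨x, hx, he⟩
    refine hΦq j ⟨x, hx, ?_⟩
    rw [← he, hb₁def, (Φ 1).apply_symm_apply]
  choose n γ hγ hLγ using fun i => (L₁ i).exists_param
  have hsupp : ∀ i, (L₁ i).support = {x | ∃ l t, γ i l t = x} := fun i => by
    rw [OrientedLink.support, hLγ, OrientedLink.proj_image_setOf]
  -- The centre of each cell has an open neighbourhood missing the compact ball; within it, general
  -- position finds a point that also misses all the links.
  have hp : ∀ j, ∃ p ∈ Metric.ball (0 : E3) 1 ∩ (fun v => h j (v, 0)) ⁻¹'
      (b₁ '' Metric.closedBall 0 1)ᶜ,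
      ∀ x ∈ Metric.ball (0 : E3) 1 ×ˢ interior (univ : Set (EuclideanSpace ℝ (Fin 0))),
      ∀ (l : Σ i, Fin (n i)) (t : ℝ), γ l.1 l.2 t = h j x → x.1 ≠ p := fun j => by
    refine exists_axis_avoiding H.finrank (by simp)
      (γ := fun (l : Σ i, Fin (n i)) t => γ l.1 l.2 t)
      (fun l => (hγ l.1).contMDiff l.2) isOpen_box (H.contMDiffOn j) ((H.injOn j).mono box_subset) (H.immersion j)
      (U := Metric.ball (0 : E3) 1 ∩ (fun v => h j (v, 0)) ⁻¹'
        (b₁ '' Metric.closedBall 0 1)ᶜ) ?_ ⟨0, by simp, hq₁ j⟩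
    exact (((H.contMDiffOn j).continuousOn).comp (by fun_prop) hbox).isOpen_inter_preimage
      Metric.isOpen_ball hK₁.isClosed.isOpen_compl
  choose p hp1 hp2 using hp
  obtain ⟨P, hP, -, hPK⟩ := H.exists_push f.isSmoothEmb
    (hK₁.union (isCompact_iUnion fun i => (L₁ i).isCompact_support))
    (union_subset (by rintro _ ⟨x, -, rfl⟩; exact hb₁.interior x)
      (iUnion_subset fun i => (L₁ i).support_subset_interior))
    (p := p) (fun j => by simpa using (hp1 j).1) (by
      rintro j x hx (hxK | hxK) hxp
      · refine (hp1 j).2 ?_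
        have : x = (p j, 0) := Prod.ext hxp (Subsingleton.elim _ _)
        rwa [this] at hxK
      · obtain ⟨i, hi⟩ := mem_iUnion.1 hxK
        rw [hsupp] at hi
        obtain ⟨l, t, he⟩ := hi
        exact hp2 j x hx ⟨i, l⟩ t he hxp)
  obtain ⟨L₂, hL₂⟩ := IsSkeinFamilyIn.exists_carriers (L := L₁) (P 1)
  have hb₂ : IsSkeinFamilyIn (fun x => P 1 (b₁ x)) L₂ :=
    hb₁.map_diffeomorph (fun z hz => hP.carriesOrientation 1 hz) hL₂
  have hL₂S : ∀ i, (L₂ i).support ⊆ f.toFun '' (𝓡∂ 3).interior (M : Type _) := fun i => by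
    rw [OrientedLink.support_eq_image (hL₂ i)]
    rintro _ ⟨z, hz, rfl⟩
    exact hPK z (Or.inr (mem_iUnion.2 ⟨i, hz⟩))
  -- Only the closed unit ball has been pushed into the image of the interior, whereas a skein
  -- family needs a parametrization of all of space; shrinking it makes the pullback to `M`
  -- possible.
  obtain ⟨b₃, hb₃, hb₃S⟩ := hb₂.exists_shrink f.isSmoothEmb.isOpen_image_interior (by
    rintro _ ⟨x, hx, rfl⟩
    exact hPK _ (Or.inl (mem_image_of_mem _ hx)))
  have hM : Nonempty M := by
    obtain ⟨x, -⟩ := hb₃S 0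
    exact ⟨x⟩
  obtain ⟨g, hg, hgf, hfg⟩ := f.exists_inverse
  choose L₀ hL₀ using fun i => f.exists_mapLink_eq (L₂ i) (hL₂S i)
  refine ⟨L₀, isSkeinFamily_iff.2 ⟨_, hb₃.map f.isSmoothEmb.isOpen_image_interior hg
    (fun z hz z' hz' he => by rw [← (hfg z hz).1, he, (hfg z' hz').1])
    (fun z hz => (hfg z hz).2) hb₃S hL₂S fun i => ?_⟩, fun i => ?_⟩
  · rw [f.carrier_eq_of_inverse hg hgf (L₀ i), hL₀ i]
  · refine (hLL₁ i).trans ⟨P, hP.contMDiff, hP.zero, ?_⟩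
    rw [hL₀ i, hL₂ i]

theorem IsInduced.bijective_of_isSphereCapping {allowEmpty : Prop} {R : Type*} [CommRing R]
    {r : Fin k → R} {f : OrientedEmbedding M N}
    {F : SkeinModule allowEmpty M r →ₗ[R] SkeinModule allowEmpty N r}
    (hF : IsInduced allowEmpty r f.toFun F) (hf : IsSphereCapping f.toFun) : Bijective F := by
  obtain ⟨J, h, H⟩ := hf.exists_cellAttachment
  exact hF.bijective (H.exists_ambientIsotopic_mapLink (by simp))
    (fun _ _ => H.ambientIsotopic_of_mapLink (by simp))
    (fun _ => H.exists_isSkeinFamily)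

end Capping

/-! ### Disjoint sums and tensor products -/

section DisjointSum

variable {M N P : OrientedThreeManifold}

theorem IsDisjointSum.symm {i : M → P} {j : N → P} (h : IsDisjointSum i j) : IsDisjointSum j i :=
  ⟨h.2.1, h.1, h.2.2.symm⟩

theorem IsDisjointSum.notMem_right {i : M → P} {j : N → P} (h : IsDisjointSum i j) {z : P}
    (hi : z ∈ range i) : z ∉ range j :=
  disjoint_left.1 h.2.2.disjoint hi

theorem IsDisjointSum.mem_or_mem {i : M → P} {j : N → P} (h : IsDisjointSum i j) (z : P) :
    z ∈ range i ∨ z ∈ range j := by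
  have : z ∈ range i ⊔ range j := h.2.2.sup_eq_top ▸ mem_univ z
  exact this

/-- A connected set that meets a summand lies in it. -/
theorem IsDisjointSum.subset_range {i : M → P} {j : N → P} (h : IsDisjointSum i j) {s : Set P}
    (hs : IsPreconnected s) (hsi : (s ∩ range i).Nonempty) : s ⊆ range i :=
  hs.subset_left_of_subset_union h.1 h.2.1 h.2.2.disjoint (fun z _ => h.mem_or_mem z) hsi

/-- An embedding with open range sends boundary points to boundary points, so an interior point of
`P` can only come from an interior point. -/
theorem OrientedEmbedding.mem_image_interior (i : OrientedEmbedding M P)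
    (hi : IsOpen (range i.toFun)) {z : P} (hz : z ∈ range i.toFun)
    (hzi : z ∈ (𝓡∂ 3).interior (P : Type _)) : z ∈ i.toFun '' (𝓡∂ 3).interior (M : Type _) := by
  obtain ⟨x, rfl⟩ := hz
  rcases (𝓡∂ 3).isInteriorPoint_or_isBoundaryPoint x with hx | hx
  · exact mem_image_of_mem _ hx
  · exact ((ModelWithCorners.isInteriorPoint_iff_not_isBoundaryPoint _).1 hzi
      (isBoundaryPoint_of_range_mem_nhds i.isSmoothEmb hx (hi.mem_nhds (mem_range_self x)))).elim

theorem OrientedEmbedding.proj_mem_range (i : OrientedEmbedding M P) {L : OrientedLink M}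
    {p : TangentBundle (𝓡∂ 3) P} (hp : p ∈ (i.mapLink L).carrier) : p.proj ∈ range i.toFun := by
  rw [i.mapLink_carrier] at hp
  obtain ⟨q, -, rfl⟩ := hp
  exact mem_range_self q.proj

theorem OrientedEmbedding.mapLink_injective (i : OrientedEmbedding M P) :
    Injective i.mapLink := by
  intro L L' h
  rcases isEmpty_or_nonempty M with hM | hM
  · have hE : IsEmpty (TangentBundle (𝓡∂ 3) M) := ⟨fun p => hM.false p.proj⟩
    exact OrientedLink.ext (by
      rw [eq_empty_of_isEmpty L.carrier, eq_empty_of_isEmpty L'.carrier])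
  · obtain ⟨g, hg, hgf, -⟩ := i.exists_inverse
    exact OrientedLink.ext (by
      rw [i.carrier_eq_of_inverse hg hgf L, i.carrier_eq_of_inverse hg hgf L', h])

variable {i : OrientedEmbedding M P} {j : OrientedEmbedding N P}

/-- The part of a link in a summand. -/
theorem IsDisjointSum.exists_restrict (h : IsDisjointSum i.toFun j.toFun) (L : OrientedLink P) :
    ∃ A : OrientedLink M, (i.mapLink A).carrier = {p ∈ L.carrier | p.proj ∈ range i.toFun} := by
  obtain ⟨n, γ, hγ, hL⟩ := L.exists_param
  -- Each component is connected and so lies entirely in one summand; the restriction just selects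
  -- components.
  have hconst : ∀ l t, γ l 0 ∈ range i.toFun ↔ γ l t ∈ range i.toFun := by
    have : ∀ l s t, γ l s ∈ range i.toFun → γ l t ∈ range i.toFun := fun l s t hs =>
      h.subset_range (isPreconnected_range (hγ.contMDiff l).continuous)
        ⟨_, mem_range_self s, hs⟩ (mem_range_self t)
    exact fun l t => ⟨this l 0 t, this l t 0⟩
  obtain ⟨B, hB⟩ := OrientedLink.exists_of_finite (M := P) (ι := {l // γ l 0 ∈ range i.toFun})
    (γ := fun l => γ l) (fun l => hγ.contMDiff l) (fun l => hγ.periodic l)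
    (fun l l' s t he => ⟨Subtype.ext (hγ.injective _ _ s t he).1, (hγ.injective _ _ s t he).2⟩)
    (fun l => hγ.regular l) (fun l => hγ.interior l)
  have hB' : B.carrier = {p ∈ L.carrier | p.proj ∈ range i.toFun} := by
    rw [hB, hL]
    ext p
    constructor
    · rintro ⟨l, t, c, hc, rfl⟩
      exact ⟨⟨l, t, c, hc, rfl⟩, (hconst l t).1 l.2⟩
    · rintro ⟨⟨l, t, c, hc, rfl⟩, hp⟩
      exact ⟨⟨l, (hconst l t).2 hp⟩, t, c, hc, rfl⟩
  obtain ⟨A, hA⟩ := i.exists_mapLink_eq B fun z hz => by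
    refine i.mem_image_interior h.1 ?_ (B.support_subset_interior hz)
    obtain ⟨p, hp, rfl⟩ := hz
    rw [hB'] at hp
    exact hp.2
  exact ⟨A, by rw [hA, hB']⟩

/-- The disjoint union of links in the summands. -/
theorem IsDisjointSum.exists_union (h : IsDisjointSum i.toFun j.toFun) (L : OrientedLink M)
    (L' : OrientedLink N) :
    ∃ A : OrientedLink P, A.carrier = (i.mapLink L).carrier ∪ (j.mapLink L').carrier := by
  obtain ⟨n, γ, hγ, hL⟩ := (i.mapLink L).exists_param
  obtain ⟨n', γ', hγ', hL'⟩ := (j.mapLink L').exists_param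
  have hi : ∀ l t, γ l t ∈ range i.toFun := fun l t =>
    i.proj_mem_range (p := tangentMap 𝓘(ℝ, ℝ) (𝓡∂ 3) (γ l) ⟨t, (1 : ℝ)⟩)
      (L := L) (by rw [hL]; exact ⟨l, t, 1, one_pos, rfl⟩)
  have hj : ∀ l t, γ' l t ∈ range j.toFun := fun l t =>
    j.proj_mem_range (p := tangentMap 𝓘(ℝ, ℝ) (𝓡∂ 3) (γ' l) ⟨t, (1 : ℝ)⟩)
      (L := L') (by rw [hL']; exact ⟨l, t, 1, one_pos, rfl⟩)
  obtain ⟨A, hA⟩ := OrientedLink.exists_of_finite (M := P) (ι := Fin n ⊕ Fin n')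
    (γ := Sum.elim γ γ') (by rintro (l | l); exacts [hγ.contMDiff l, hγ'.contMDiff l])
    (by rintro (l | l); exacts [hγ.periodic l, hγ'.periodic l])
    (by
      rintro (l | l) (l' | l') s t he
      · obtain ⟨h1, h2⟩ := hγ.injective l l' s t he
        exact ⟨congrArg _ h1, h2⟩
      · exact (h.notMem_right (hi l s) (by
          have he' : γ l s = γ' l' t := he
          rw [he']; exact hj l' t)).elim
      · exact (h.notMem_right (hi l' t) (by
          have he' : γ' l s = γ l' t := he
          rw [← he']; exact hj l s)).elim
      · obtain ⟨h1, h2⟩ := hγ'.injective l l' s t he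
        exact ⟨congrArg _ h1, h2⟩)
    (by rintro (l | l); exacts [hγ.regular l, hγ'.regular l])
    (by rintro (l | l); exacts [hγ.interior l, hγ'.interior l])
  refine ⟨A, ?_⟩
  rw [hA, hL, hL']
  ext p
  constructor
  · rintro ⟨l | l, hl⟩
    · exact Or.inl ⟨l, hl⟩
    · exact Or.inr ⟨l, hl⟩
  · rintro (⟨l, hl⟩ | ⟨l, hl⟩)
    · exact ⟨Sum.inl l, hl⟩
    · exact ⟨Sum.inr l, hl⟩

/-- An isotopy in one summand gives an isotopy of disjoint unions. -/
theorem IsDisjointSum.ambientIsotopic_union (h : IsDisjointSum i.toFun j.toFun)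
    {L₁ L₂ : OrientedLink M} (hL : AmbientIsotopic L₁ L₂) {L' : OrientedLink N}
    {A₁ A₂ : OrientedLink P}
    (hA₁ : A₁.carrier = (i.mapLink L₁).carrier ∪ (j.mapLink L').carrier)
    (hA₂ : A₂.carrier = (i.mapLink L₂).carrier ∪ (j.mapLink L').carrier) :
    AmbientIsotopic A₁ A₂ := by
  -- Isotopy extension is supported in the open range of `i`, so it fixes the link in the other
  -- summand together with its tangent vectors.
  obtain ⟨Φ, hΦ, hΦ0, hΦn, hΦ1⟩ :=
    i.ambientIsotopicIn_mapLink hL h.1 (image_subset_range _ _)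
  refine ⟨Φ, hΦ, hΦ0, ?_⟩
  have h1 : ∀ p ∈ (j.mapLink L').carrier, tangentMap (𝓡∂ 3) (𝓡∂ 3) (Φ 1) p = p := fun p hp => by
    rw [tangentMap_congr_of_eventuallyEq (g := id), tangentMap_id]
    · rfl
    · filter_upwards [h.2.1.mem_nhds (j.proj_mem_range hp)] with z hz
      exact hΦn 1 z (h.symm.notMem_right hz)
  rw [hA₁, hA₂, image_union, ← hΦ1, image_congr h1, image_id']

/-- An isotopy of links in a disjoint sum restricts to an isotopy of the parts in a summand. -/
theorem IsDisjointSum.ambientIsotopic_restrict (h : IsDisjointSum i.toFun j.toFun)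
    {A₁ A₂ : OrientedLink P} (hA : AmbientIsotopic A₁ A₂) {L₁ L₂ : OrientedLink M}
    (h₁ : (i.mapLink L₁).carrier = {p ∈ A₁.carrier | p.proj ∈ range i.toFun})
    (h₂ : (i.mapLink L₂).carrier = {p ∈ A₂.carrier | p.proj ∈ range i.toFun}) :
    AmbientIsotopic L₁ L₂ := by
  obtain ⟨Φ, hΦ, hΦ0, hΦ1⟩ := hA
  -- An isotopy moves each point along a connected path, hence within its own summand.
  have hpath : ∀ t z, Φ t z ∈ range i.toFun ↔ z ∈ range i.toFun := by
    have hpre : ∀ z, IsPreconnected (range fun t => Φ t z) := fun z =>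
      isPreconnected_range (hΦ.continuous.comp (by fun_prop : Continuous fun t : ℝ => (t, z)))
    intro t z
    constructor
    · intro hz
      have := h.subset_range (hpre z) ⟨_, mem_range_self t, hz⟩ (mem_range_self 0)
      rwa [hΦ0] at this
    · intro hz
      exact h.subset_range (hpre z) ⟨_, mem_range_self 0, (hΦ0 z).symm ▸ hz⟩ (mem_range_self t)
  refine i.ambientIsotopic_of_track (B := i.mapLink L₁) hΦ (fun t _ z hz => ?_) ?_ ?_
  · refine i.mem_image_interior h.1 ((hpath t z).2 ?_) ?_
    · obtain ⟨p, hp, rfl⟩ := hz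
      exact i.proj_mem_range hp
    · exact (mdifferentiable_diffeomorph (Φ t) z).isInteriorPoint_of_surjective_mfderiv
        (surjective_mfderiv_of_injective rfl (injective_mfderiv_diffeomorph (Φ t) z))
        ((i.mapLink L₁).support_subset_interior hz)
  · have : ⇑(Φ 0) = id := funext hΦ0
    rw [this, tangentMap_id, image_id]
  · rw [h₁, h₂, hΦ1]
    ext p
    constructor
    · rintro ⟨⟨q, hq, rfl⟩, hp⟩
      exact ⟨q, ⟨hq, (hpath 1 q.proj).1 hp⟩, rfl⟩
    · rintro ⟨q, ⟨hq, hqi⟩, rfl⟩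
      exact ⟨⟨q, hq, rfl⟩, (hpath 1 q.proj).2 hqi⟩

variable {k : ℕ}

/-- The ball lies in one summand, so the link in the other never meets it and is merely a constant
part outside. -/
theorem IsDisjointSum.isSkeinFamily_union (h : IsDisjointSum i.toFun j.toFun)
    {L : Fin k → OrientedLink M} (hL : IsSkeinFamily L) {L' : OrientedLink N}
    {A : Fin k → OrientedLink P}
    (hA : ∀ a, (A a).carrier = (i.mapLink (L a)).carrier ∪ (j.mapLink L').carrier) :
    IsSkeinFamily A := by
  obtain ⟨b, hb⟩ := isSkeinFamily_iff.1 hL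
  have hib : IsSkeinFamilyIn (fun x => i.toFun (b x)) fun a => i.mapLink (L a) :=
    hb.map isOpen_univ i.isSmoothEmb.contMDiff.contMDiffOn
      i.isSmoothEmb.isEmbedding.injective.injOn (fun x _ => i.orientation_preserving x)
      (fun x => mem_univ _) (fun a => subset_univ _) fun a => rfl
  refine isSkeinFamily_iff.2 ⟨_, hib.contMDiff, hib.isEmbedding, hib.orientation, hib.interior,
    fun a p hp => ?_, fun a a' p hp => ?_⟩
  · rw [← hib.inside a p hp, hA]
    refine or_iff_left fun hpj => ?_
    obtain ⟨x, -, hx⟩ := hp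
    exact h.notMem_right (hx ▸ mem_range_self (b x)) (j.proj_mem_range hpj)
  · rw [hA, hA]
    exact or_congr_left (hib.outside a a' p hp)

/-- A skein family whose ball meets a summand restricts to a skein family there, and its part in
the other summand is constant. -/
theorem IsDisjointSum.isSkeinFamily_restrict (h : IsDisjointSum i.toFun j.toFun) {b : E3 → P}
    {A : Fin k → OrientedLink P} (hb : IsSkeinFamilyIn b A) (hbi : b 0 ∈ range i.toFun)
    {L : Fin k → OrientedLink M} {L' : Fin k → OrientedLink N}
    (hL : ∀ a, (i.mapLink (L a)).carrier = {p ∈ (A a).carrier | p.proj ∈ range i.toFun})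
    (hL' : ∀ a, (j.mapLink (L' a)).carrier = {p ∈ (A a).carrier | p.proj ∈ range j.toFun}) :
    IsSkeinFamily L ∧ ∀ a a', L' a = L' a' := by
  have hbr : ∀ x, b x ∈ range i.toFun := fun x =>
    h.subset_range (isPreconnected_range hb.contMDiff.continuous) ⟨_, mem_range_self 0, hbi⟩
      (mem_range_self x)
  constructor
  · have hres : IsSkeinFamilyIn b fun a => i.mapLink (L a) := by
      refine ⟨hb.contMDiff, hb.isEmbedding, hb.orientation, hb.interior, fun a p hp => ?_,
        fun a a' p hp => ?_⟩
      · rw [← hb.inside a p hp, hL]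
        obtain ⟨x, -, hx⟩ := hp
        exact and_iff_left (hx ▸ hbr x)
      · rw [hL, hL]
        exact and_congr_left' (hb.outside a a' p hp)
    have hM : Nonempty M := by
      obtain ⟨x, -⟩ := hbi
      exact ⟨x⟩
    obtain ⟨g, hg, hgf, hfg⟩ := i.exists_inverse
    refine isSkeinFamily_iff.2 ⟨_, hres.map i.isSmoothEmb.isOpen_image_interior hg
      (fun z hz z' hz' he => by rw [← (hfg z hz).1, he, (hfg z' hz').1])
      (fun z hz => (hfg z hz).2)
      (fun x => i.mem_image_interior h.1 (hbr x) (hb.interior x)) (fun a => ?_) fun a => ?_⟩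
    · rw [OrientedLink.support_eq_image (i.mapLink_carrier (L a))]
      exact image_mono (L a).support_subset_interior
    · exact i.carrier_eq_of_inverse hg hgf (L a)
  · intro a a'
    refine j.mapLink_injective (OrientedLink.ext ?_)
    rw [hL', hL']
    ext p
    refine and_congr_left fun hp => hb.outside a a' p ?_
    rintro ⟨x, -, hx⟩
    exact h.notMem_right (hbr x) (hx ▸ hp)

variable {R : Type*} [CommRing R] {r : Fin k → R}

/-- The skein module of a disjoint sum is the tensor product of the skein modules. -/
theorem IsDisjointSum.exists_linearEquiv (h : IsDisjointSum i.toFun j.toFun) :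
    ∃ Φ : SkeinModule True M r ⊗[R] SkeinModule True N r ≃ₗ[R] SkeinModule True P r,
      ∀ (L : Link True M) (L' : Link True N), ∃ L'' : Link True P,
        L''.1.carrier = tangentMap (𝓡∂ 3) (𝓡∂ 3) i.toFun '' L.1.carrier ∪
          tangentMap (𝓡∂ 3) (𝓡∂ 3) j.toFun '' L'.1.carrier ∧
        Φ (linkClass True r L ⊗ₜ[R] linkClass True r L') = linkClass True r L'' := by
  have hU : ∀ (L : Link True M) (L' : Link True N), ∃ A : Link True P,
      A.1.carrier = (i.mapLink L.1).carrier ∪ (j.mapLink L'.1).carrier := fun L L' => by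
    obtain ⟨A, hA⟩ := h.exists_union L.1 L'.1
    exact ⟨⟨A, Or.inl trivial⟩, hA⟩
  -- The part of a link in one summand may be empty, so the empty link has to be admitted here.
  have hU' : ∀ A : Link True P, ∃ L : Link True M,
      (i.mapLink L.1).carrier = {p ∈ A.1.carrier | p.proj ∈ range i.toFun} := fun A => by
    obtain ⟨L, hL⟩ := h.exists_restrict A.1
    exact ⟨⟨L, Or.inl trivial⟩, hL⟩
  have hV' : ∀ A : Link True P, ∃ L : Link True N,
      (j.mapLink L.1).carrier = {p ∈ A.1.carrier | p.proj ∈ range j.toFun} := fun A => by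
    obtain ⟨L, hL⟩ := h.symm.exists_restrict A.1
    exact ⟨⟨L, Or.inl trivial⟩, hL⟩
  choose union hunion using hU
  choose resi hresi using hU'
  choose resj hresj using hV'
  have hG : ∀ L : Link True M, ∃ G : SkeinModule True N r →ₗ[R] SkeinModule True P r,
      ∀ L', G (linkClass True r L') = linkClass True r (union L L') := fun L => by
    refine exists_skeinModule_lift (fun L' => linkClass True r (union L L')) ?_ ?_
    · intro L₁ L₂ h12
      exact linkClass_eq_of_ambientIsotopic (h.symm.ambientIsotopic_union h12
        ((hunion L L₁).trans (union_comm _ _)) ((hunion L L₂).trans (union_comm _ _)))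
    · intro L' hL'
      exact sum_smul_linkClass_eq_zero (h.symm.isSkeinFamily_union hL' (L' := L.1)
        fun a => (hunion L (L' a)).trans (union_comm _ _))
  choose G hG using hG
  obtain ⟨F, hF⟩ := exists_skeinModule_lift (r := r) G
    (fun L₁ L₂ h12 => skeinModule_linearMap_ext fun L' => by
      rw [hG, hG]
      exact linkClass_eq_of_ambientIsotopic
        (h.ambientIsotopic_union h12 (hunion L₁ L') (hunion L₂ L')))
    (fun L hL => skeinModule_linearMap_ext fun L' => by
      simp only [LinearMap.sum_apply, LinearMap.smul_apply, hG, LinearMap.zero_apply]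
      exact sum_smul_linkClass_eq_zero (h.isSkeinFamily_union hL fun a => hunion (L a) L'))
  -- The ball of the family is connected, so only one tensor factor varies; the other is constant
  -- and factors out of the relation.
  have hskein : ∀ A : Fin k → Link True P, IsSkeinFamily (fun a => (A a).1) →
      ∑ a, r a • (linkClass True r (resi (A a)) ⊗ₜ[R] linkClass True r (resj (A a))) = 0 := by
    intro A hA
    rcases isEmpty_or_nonempty (Fin k) with hk | ⟨⟨a₀⟩⟩
    · simp
    obtain ⟨b, hb⟩ := isSkeinFamily_iff.1 hA
    rcases h.mem_or_mem (b 0) with hb0 | hb0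
    · obtain ⟨h1, h2⟩ := h.isSkeinFamily_restrict hb hb0 (fun a => hresi (A a))
        (fun a => hresj (A a))
      have h3 : ∀ a, resj (A a) = resj (A a₀) := fun a => Subtype.ext (h2 a a₀)
      simp only [h3, TensorProduct.smul_tmul', ← TensorProduct.sum_tmul]
      rw [sum_smul_linkClass_eq_zero h1, TensorProduct.zero_tmul]
    · obtain ⟨h1, h2⟩ := h.symm.isSkeinFamily_restrict hb hb0 (fun a => hresj (A a))
        (fun a => hresi (A a))
      have h3 : ∀ a, resi (A a) = resi (A a₀) := fun a => Subtype.ext (h2 a a₀)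
      simp only [h3, ← TensorProduct.tmul_smul, ← TensorProduct.tmul_sum]
      rw [sum_smul_linkClass_eq_zero h1, TensorProduct.tmul_zero]
  obtain ⟨Q, hQ⟩ := exists_skeinModule_lift (r := r)
    (fun A : Link True P => linkClass True r (resi A) ⊗ₜ[R] linkClass True r (resj A))
    (fun A₁ A₂ hA => by
      rw [linkClass_eq_of_ambientIsotopic (h.ambientIsotopic_restrict hA (hresi A₁) (hresi A₂)),
        linkClass_eq_of_ambientIsotopic
          (h.symm.ambientIsotopic_restrict hA (hresj A₁) (hresj A₂))])
    hskein
  have hresi' : ∀ L L', resi (union L L') = L := fun L L' => by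
    refine Subtype.ext (i.mapLink_injective (OrientedLink.ext ?_))
    rw [hresi, hunion]
    ext p
    exact ⟨fun ⟨hp, hpi⟩ => hp.resolve_right fun hpj =>
      h.notMem_right hpi (j.proj_mem_range hpj), fun hp => ⟨Or.inl hp, i.proj_mem_range hp⟩⟩
  have hresj' : ∀ L L', resj (union L L') = L' := fun L L' => by
    refine Subtype.ext (j.mapLink_injective (OrientedLink.ext ?_))
    rw [hresj, hunion]
    ext p
    exact ⟨fun ⟨hp, hpj⟩ => hp.resolve_left fun hpi =>
      h.notMem_right (i.proj_mem_range hpi) hpj, fun hp => ⟨Or.inr hp, j.proj_mem_range hp⟩⟩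
  -- Restriction and union are inverse on links themselves, not only up to isotopy, so the two
  -- linear maps are inverse on generators.
  have hres : ∀ A, union (resi A) (resj A) = A := fun A => by
    refine Subtype.ext (OrientedLink.ext ?_)
    rw [hunion, hresi, hresj]
    ext p
    exact ⟨fun hp => hp.elim And.left And.left, fun hp =>
      (h.mem_or_mem p.proj).imp (fun hi => ⟨hp, hi⟩) fun hj => ⟨hp, hj⟩⟩
  refine ⟨LinearEquiv.ofLinearMap (TensorProduct.lift F) Q ?_ ?_, fun L L' =>
    ⟨union L L', hunion L L', ?_⟩⟩
  · refine skeinModule_linearMap_ext fun A => ?_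
    rw [LinearMap.comp_apply, hQ, TensorProduct.lift.tmul, hF, hG, hres, LinearMap.id_apply]
  · refine TensorProduct.ext (skeinModule_linearMap_ext fun L => skeinModule_linearMap_ext
      fun L' => ?_)
    change Q (TensorProduct.lift F (linkClass True r L ⊗ₜ[R] linkClass True r L')) =
      linkClass True r L ⊗ₜ[R] linkClass True r L'
    rw [TensorProduct.lift.tmul, hF, hG, hQ, hresi', hresj']
  · rw [LinearEquiv.coe_ofLinearMap, TensorProduct.lift.tmul, hF, hG]

end DisjointSum

end Skein

end

theorem proposition4 {R : Type*} [CommRing R] {k : ℕ} (r : Fin k → R) :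
    -- (a) an orientation preserving embedding induces a unique homomorphism
    (∀ (allowEmpty : Prop) (M N : Skein.OrientedThreeManifold)
      (f : Skein.OrientedEmbedding M N),
      ∃! F : Skein.SkeinModule allowEmpty M r →ₗ[R] Skein.SkeinModule allowEmpty N r,
        Skein.IsInduced allowEmpty r f.toFun F) ∧
    -- (b) isotopic embeddings induce the same homomorphism
    (∀ (allowEmpty : Prop) (M N : Skein.OrientedThreeManifold)
      (f g : Skein.OrientedEmbedding M N),
      Skein.IsotopicEmbeddings f.toFun g.toFun →
      ∀ F G : Skein.SkeinModule allowEmpty M r →ₗ[R] Skein.SkeinModule allowEmpty N r,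
        Skein.IsInduced allowEmpty r f.toFun F → Skein.IsInduced allowEmpty r g.toFun G →
        F = G) ∧
    -- (c) adding a 2-handle induces an epimorphism
    (∀ (allowEmpty : Prop) (M N : Skein.OrientedThreeManifold)
      (f : Skein.OrientedEmbedding M N),
      Skein.IsTwoHandleAddition f.toFun →
      ∀ F : Skein.SkeinModule allowEmpty M r →ₗ[R] Skein.SkeinModule allowEmpty N r,
        Skein.IsInduced allowEmpty r f.toFun F → Function.Surjective F) ∧
    -- (d) capping off boundary 2-spheres induces an isomorphism
    (∀ (allowEmpty : Prop) (M N : Skein.OrientedThreeManifold)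
      (f : Skein.OrientedEmbedding M N),
      Skein.IsSphereCapping f.toFun →
      ∀ F : Skein.SkeinModule allowEmpty M r →ₗ[R] Skein.SkeinModule allowEmpty N r,
        Skein.IsInduced allowEmpty r f.toFun F → Function.Bijective F) ∧
    -- (e) disjoint sums give tensor products (here the empty link is a link)
    (∀ (M N P : Skein.OrientedThreeManifold)
      (i : Skein.OrientedEmbedding M P) (j : Skein.OrientedEmbedding N P),
      Skein.IsDisjointSum i.toFun j.toFun →
      ∃ Φ : Skein.SkeinModule True M r ⊗[R] Skein.SkeinModule True N r ≃ₗ[R]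
          Skein.SkeinModule True P r,
        ∀ (L : Skein.Link True M) (L' : Skein.Link True N), ∃ L'' : Skein.Link True P,
          L''.1.carrier = tangentMap (𝓡∂ 3) (𝓡∂ 3) i.toFun '' L.1.carrier ∪
            tangentMap (𝓡∂ 3) (𝓡∂ 3) j.toFun '' L'.1.carrier ∧
          Φ (Skein.linkClass True r L ⊗ₜ[R] Skein.linkClass True r L') =
            Skein.linkClass True r L'') := by
  exact ⟨fun _ _ _ f => Skein.existsUnique_isInduced f,
    fun _ _ _ _ _ h _ _ hF hG => Skein.isInduced_eq_of_isotopic h hF hG,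
    fun _ _ _ _ h _ hF => hF.surjective_of_isTwoHandleAddition h,
    fun _ _ _ _ h _ hF => hF.bijective_of_isSphereCapping h,
    fun _ _ _ _ _ h => h.exists_linearEquiv⟩
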